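/- Let $a>0$. For $x,t\in\mathbb R$ let $\psi_0(x,t)=(2\pi)^{-1/4}(1+it)^{-1/2}\exp\!\big(-\tfrac{x^2}{4(1+it)}\big)$ and let $\psi_n$ be defined by $\sqrt{n+1}\,\psi_{n+1}=a^+\psi_n$ with $a^+=(i+t)\partial_x-ix/2$. Let $\Phi(z)=e^{-|z|^2/2}$, $a_n=(n!)^{-1/2}$, and let $\psi_z=\Phi(z)\sum_n a_nz^n\psi_n$ ($z\in\mathbb C$) be the coherent states of the free particle. Let $L=\partial_x-a\tanh(ax)$, $\varphi_n=L\psi_n$, $\varphi_z=L\psi_z$, $h_1=-\partial_x^2-2a^2\,\mathrm{sech}^2(ax)$ (self-adjoint in $L^2(\mathbb R)$), let $H_1\subset L^2(\mathbb R)$ be the closed linear span of the $\varphi_n(\cdot,t)$, $n\ge 0$, let $S_{nk}=\langle\varphi_n|\varphi_k\rangle$, and let $S^{-1}$ be its inverse, the matrix of a bounded operator on $\ell^2$. Put $$\rho(t)=\frac{1}{2\pi a}\exp\!\Big(\frac{t^2}{8}-a|t|\Big).$$ Let $\nu$ be the generalized measure on $\mathbb R$ with Fourier transform $d\tilde\nu(t)=\rho(t)\,dt$: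 since $\rho$ grows, $\int F\,d\nu$ means $\lim_{T\to\infty}\int F(x)\,\nu_T(x)\,dx$ with $\nu_T(x)=\int e^{-itx}\kappa(t/T)\rho(t)\,dt$, where it is required that for every even real $\kappa\in C_c^\infty(\mathbb R)$ with $\kappa(0)=1$ the integrals converge absolutely for all $T>0$ and the limit exists and does not depend on $\kappa$. Let $d\mu_\varphi=dy\,d\nu(x)$ on $\mathbb C$, $z=x+iy$, be understood in the same way, as the limit of the measures $\nu_T(x)\,dx\,dy$. Then $\varphi_n(\cdot,t),\varphi_z(\cdot,t)\in L^2(\mathbb R)$, and $\varphi_z=L\psi_z=\Phi(z)\sum_n a_nz^n\varphi_n$ in $L^2(\mathbb R)$. The space $H_1$ does not depend on $t$ and is the orthogonal complement of the bound state $\mathrm{sech}(ax)$ of $h_1$. The vectors $\varphi_z$, $z\in\mathbb C$, are coherent states for $h_1$ in the sense of Klauder's definition, with respect to $\mu_\varphi$: 1. $\varphi_z(\cdot,t)\in H_1$ for all $z$ in the domain $\mathcal D=\mathbb C$ and all $t$; 2. $\int_{\mathbb C}d\mu_\varphi(z)\,\langle f|\varphi_z\rangle\langle\varphi_z|g\rangle=\langle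 f|g\rangle$ for all $f,g\in H_1$, at every time $t$; 3. every $\varphi_z$ lies in the domain of $h_1$ and $(i\partial_t-h_1)\varphi_z=0$, both in $L^2(\mathbb R)$ and pointwise, $\varphi_z(x,t)$ being smooth in $(x,t)$. The measure $\mu_\varphi$ solves the moment problem in the complex plane $$a_na_k\int_{\mathbb C}d\mu_\varphi\,|\Phi|^2z^n\bar z^k=S^{-1}_{nk}\qquad(n,k\ge0),$$ where $S$ and $S^{-1}$ do not depend on $t$. Moreover $\int F\,d\nu=\int\tilde F(t)\rho(t)\,dt$, $\tilde F(t)=\int e^{itx}F(x)\,dx$, whenever $F\in L^1(\mathbb R)$ and $\tilde F\rho\in L^1(\mathbb R)$. -/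

import Mathlib

open MeasureTheory Filter Topology
open scoped ContDiff

noncomputable section

namespace SolitonCS

/-- The Hilbert space `L²(ℝ)` of square-integrable complex wave functions of the variable `x`. -/
abbrev L2 : Type := Lp ℂ 2 (volume : Measure ℝ)

open Classical in
/-- The vector of `L²(ℝ)` given by a square-integrable function (zero if `f` is not
square-integrable; square-integrability is always asserted separately where this is used). -/
def toL2 (f : ℝ → ℂ) : L2 :=
  if h : MemLp f 2 (volume : Measure ℝ) then h.toLp f else 0

/-! ### The free particle -/

/-- The creation operator `a⁺ = (i + t) ∂ₓ - i x / 2` at time `t`. -/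
def raise (t : ℝ) (f : ℝ → ℂ) : ℝ → ℂ := fun x =>
  (Complex.I + (t : ℂ)) * deriv f x - Complex.I * (x : ℂ) / 2 * f x

/-- The normalized vacuum
`ψ₀(x,t) = (2π)^(-1/4) (1 + i t)^(-1/2) exp (-x² / (4 (1 + i t)))`: the solution of the free
Schrödinger equation annihilated by `a = (i - t) ∂ₓ + i x / 2`. -/
def psiVac (t : ℝ) : ℝ → ℂ := fun x =>
  (((2 * Real.pi) ^ (-(1 / 4) : ℝ) : ℝ) : ℂ) * (1 + Complex.I * (t : ℂ)) ^ (-(1 / 2) : ℂ) *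
    Complex.exp (-((x : ℂ) ^ 2) / (4 * (1 + Complex.I * (t : ℂ))))

/-- The discrete basis `ψₙ(·,t)`, given by `a⁺ ψₙ = √(n+1) ψₙ₊₁`. -/
def psi (t : ℝ) : ℕ → ℝ → ℂ
  | 0 => psiVac t
  | n + 1 => fun x => raise t (psi t n) x / ((Real.sqrt ((n : ℝ) + 1) : ℝ) : ℂ)

/-- `aₙ = (n!)^(-1/2)`. -/
def coef (n : ℕ) : ℝ := (Real.sqrt (Nat.factorial n : ℝ))⁻¹

/-- `Φ(z, z̄) = exp (-z z̄ / 2)`. -/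
def Phi (z : ℂ) : ℝ := Real.exp (-(‖z‖ ^ 2) / 2)

/-- The free-particle coherent states `ψ_z = Φ ∑ aₙ zⁿ ψₙ`. -/
def psiZ (z : ℂ) (t : ℝ) : ℝ → ℂ := fun x =>
  (Phi z : ℂ) * ∑' n : ℕ, (coef n : ℂ) * z ^ n * psi t n x

/-! ### The Darboux transformation and the soliton potential -/

/-- The Darboux operator `L = -a tanh (a x) + ∂ₓ`. -/
def darboux (a : ℝ) (f : ℝ → ℂ) : ℝ → ℂ := fun x =>
  -((a * Real.tanh (a * x) : ℝ) : ℂ) * f x + deriv f x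

/-- `φₙ = L ψₙ`. -/
def phi (a : ℝ) (n : ℕ) (t : ℝ) : ℝ → ℂ := darboux a (psi t n)

/-- `φ_z = L ψ_z`. -/
def phiZ (a : ℝ) (z : ℂ) (t : ℝ) : ℝ → ℂ := darboux a (psiZ z t)

/-- The soliton potential `V₁(x) = -2 a² sech² (a x)`. -/
def solitonPotential (a x : ℝ) : ℝ := -2 * a ^ 2 / Real.cosh (a * x) ^ 2

/-- The normalized bound state `(a/2)^(1/2) sech (a x)` of the soliton potential. -/
def boundState (a : ℝ) : ℝ → ℂ := fun x => ((Real.sqrt (a / 2) / Real.cosh (a * x) : ℝ) : ℂ)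

/-- The graph of the Hamiltonian `h = -∂ₓ² + V` in `L²(ℝ)`: `f` lies in the domain of `h` and
`h f = v`, where `f, v ∈ L²(ℝ)` and the equation holds in the sense of distributions. For a bounded
smooth potential this is the self-adjoint closure of `-∂ₓ² + V` on smooth functions of compact
support. -/
def HamiltonianGraph (V : ℝ → ℝ) (f v : L2) : Prop :=
  ∀ η : ℝ → ℂ, ContDiff ℝ ∞ η → HasCompactSupport η →
    ∫ x, f x * (-(iteratedDeriv 2 η x) + (V x : ℂ) * η x) = ∫ x, v x * η x

/-- The Hilbert space `H₁`: the closed linear span of the functions `φₙ(·,t)`. -/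
def solitonSpace (a t : ℝ) : Submodule ℂ L2 :=
  (Submodule.span ℂ (Set.range fun n : ℕ => toL2 (phi a n t))).topologicalClosure

/-! ### The measure `dμ = dy dν(x)` -/

/-- `ρ(t) = exp (t² / 8 - a |t|) / (2 π a)`. -/
def rho (a t : ℝ) : ℝ := Real.exp (t ^ 2 / 8 - a * |t|) / (2 * Real.pi * a)

/-- Smooth even cutoffs of compact support, equal to `1` at the origin. -/
structure IsCutoff (κ : ℝ → ℝ) : Prop where
  smooth : ContDiff ℝ ∞ κ
  compact : HasCompactSupport κ
  even : ∀ t, κ (-t) = κ t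
  one : κ 0 = 1

/-- The density of the measure `ν_T` whose Fourier transform is `κ(t/T) ρ(t) dt`, that is,
`∫ exp (-i t x) κ(t/T) ρ(t) dt`; the integrand is even in `t` up to the exponential, so that only
the cosine contributes. -/
def nuDensity (a : ℝ) (κ : ℝ → ℝ) (T x : ℝ) : ℝ :=
  ∫ t : ℝ, κ (t / T) * rho a t * Real.cos (t * x)

/-- `∫ F dν = I`. As `ρ` grows, `ν` is a generalized measure: it is the limit as `T → ∞` of the
measures `dν_T` of Fourier transform `κ(t/T) ρ(t) dt`, for every cutoff `κ`. -/
def HasNuIntegral (a : ℝ) (F : ℝ → ℂ) (I : ℂ) : Prop :=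
  ∀ κ : ℝ → ℝ, IsCutoff κ →
    (∀ T : ℝ, 0 < T → Integrable fun x : ℝ => F x * (nuDensity a κ T x : ℂ)) ∧
    Tendsto (fun T : ℝ => ∫ x : ℝ, F x * (nuDensity a κ T x : ℂ)) atTop (𝓝 I)

/-- `∫_ℂ F dμ = I` for `dμ = dy dν(x)`, `z = x + i y`; the integrals against the approximating
measures `dy dν_T(x)` converge absolutely. -/
def HasMuIntegral (a : ℝ) (F : ℂ → ℂ) (I : ℂ) : Prop :=
  ∀ κ : ℝ → ℝ, IsCutoff κ →
    (∀ T : ℝ, 0 < T → Integrable fun z : ℂ => F z * (nuDensity a κ T z.re : ℂ)) ∧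
    Tendsto (fun T : ℝ => ∫ z : ℂ, F z * (nuDensity a κ T z.re : ℂ)) atTop (𝓝 I)

/-- `f̃(t) = ∫ exp (i t x) f(x) dx`. -/
def fourierInt (F : ℝ → ℂ) (t : ℝ) : ℂ :=
  ∫ x : ℝ, Complex.exp (Complex.I * (t : ℂ) * (x : ℂ)) * F x

/-! ### Coherent states -/

/-- Klauder's definition of a system of coherent states `χ_z(t)`, `z ∈ D ⊆ ℂ`, in a Hilbert space
`H` of wave functions, for the Hamiltonian with potential `V` and the (generalized) measure with
integral `integral F I` (`∫_D F dμ = I`). -/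
structure IsCoherentSystem (H : Submodule ℂ L2) (V : ℝ → ℝ) (D : Set ℂ)
    (integral : (ℂ → ℂ) → ℂ → Prop) (χ : ℂ → ℝ → L2) : Prop where
  /-- the states are vectors of `H` -/
  mem : ∀ z ∈ D, ∀ t, χ z t ∈ H
  /-- `D` is a domain -/
  isOpen : IsOpen D
  isConnected : IsConnected D
  /-- resolution of the identity operator of `H` -/
  resolution : ∀ t, ∀ f ∈ H, ∀ g ∈ H,
    integral (fun z => inner ℂ f (χ z t) * inner ℂ (χ z t) g) (inner ℂ f g)
  /-- the states lie in the domain of the Hamiltonian and solve the Schrödinger equation -/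
  schrodinger : ∀ z ∈ D, ∀ t, ∃ v : L2, HamiltonianGraph V (χ z t) v ∧
    HasDerivAt (χ z) (-Complex.I • v) t

/-! ### The moments -/

/-- `S_{nk} = ⟨φₙ | φₖ⟩ = ⟨ψₙ | g₀ | ψₖ⟩`, `g₀ = L⁺ L = -∂ₓ² + a²`. -/
def gram (a t : ℝ) (n k : ℕ) : ℂ := inner ℂ (toL2 (phi a n t)) (toL2 (phi a k t))

/-- The `k`-th unit vector of `ℓ²`. -/
def unitVec (k : ℕ) : lp (fun _ : ℕ => ℂ) 2 := lp.single 2 k 1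

/-- `R = S⁻¹` for infinite matrices: `R` is the matrix of a bounded operator of `ℓ²` which is a
left and right inverse of `S` on the unit vectors. -/
def IsInverseMatrix (S R : ℕ → ℕ → ℂ) : Prop :=
  ∃ A : lp (fun _ : ℕ => ℂ) 2 →L[ℂ] lp (fun _ : ℕ => ℂ) 2,
    (∀ n k, R n k = A (unitVec k) n) ∧
    (∀ k, ∃ s : lp (fun _ : ℕ => ℂ) 2, (∀ n, s n = S n k) ∧ A s = unitVec k) ∧
    (∀ n k, HasSum (fun j => S n j * R j k) (if n = k then 1 else 0))

end SolitonCS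

end

noncomputable section

namespace SolitonCS

/-! ### Square-integrable functions -/

/-! The proof replaces $H_1$ by a model in which the coherent states are modulated Gaussians and the
resolution of the identity becomes Plancherel's theorem.

Since $a+a^+=2i\partial_x$, the operator $\partial_x$ acts on the basis $\psi_n(\cdot,t)$ by a
Jacobi matrix independent of $t$, which is also, up to a factor, the matrix of multiplication by $x$
in the real Hermite functions $e_n=i^n\psi_n(\cdot,0)$ (`osc`). From $L^+L=-\partial_x^2+a^2$ it
follows that $S_{nk}=\langle e_n|q^2e_k\rangle$ with $q^2=x^2/4+a^2$ (`gram_eq_jacobi`,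
`inner_wosc`). So $\varphi_n\mapsto q\,e_n$ extends to an isometry of $H_1$ into $L^2$ under which
inner products with $\varphi_z$ become inner products with $q\,e_z$, where $e_z=\Phi\sum a_nz^ne_n$
(`exists_model`). Surjectivity is not needed, because only inner products enter the resolution of
the identity.

For $z=x+iy$, $e_z(s)$ is a unimodular constant times $(2\pi)^{-1/4}e^{iys}e^{-(s/2-x)^2}$
(`packet_eq`). Plancherel in $y$ leaves $\int\bar w_1w_2\,q^2(s)\,p(s,x)\,ds$ with
$p=\sqrt{2\pi}\,e^{-2(x-s/2)^2}$ (`integral_inner_mul_inner_wpacket`). In $x$, the Fourier transform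
of $p$ is $\pi e^{-t^2/8}e^{its/2}$; the growth of $\rho$ cancels this Gaussian, and what remains is
the transform of $e^{-a|t|}/(2a)$ at $s/2$, which is $1/q^2(s)$. With a cutoff the product differs
from $1$ by $O(1/T)$ uniformly in $s$ (`exists_multiplier_sub_one_le`), so dominated convergence
gives $\langle w_1|w_2\rangle$ (`hasMuIntegral_wpacket`).

The vectors $q^{-1}e_n$ are biorthogonal to $q\,e_n$. Inserting them in the same resolution gives
the moments as the matrix of $q^{-2}$, the inverse of the matrix $S$ of $q^2$
(`hasMuIntegral_moment`, `isInverseMatrix_gram`).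

If $f\perp\varphi_n$ for all $n$, then $f\perp\varphi_z$ for all $z$. Suitable $z$ make $\psi_z$
proportional to a plane wave times $\psi_0$, so Fourier inversion yields $\int\bar f\,Lu=0$ for all
test functions $u$. Taking $u=\cosh(ax)\,v$ shows that $\cosh(ax)\bar f$ is constant
(`mem_span_boundState`); hence the description of $H_1$. The Schrödinger equation is an identity
between explicit Gaussian expressions, carried to $L^2$ by a Gaussian majorant locally uniform in
time. -/

lemma toL2_eq {f : ℝ → ℂ} (h : MemLp f 2 volume) : toL2 f = h.toLp f := by
  simp [toL2, h]

lemma coeFn_toL2 {f : ℝ → ℂ} (h : MemLp f 2 volume) : (toL2 f : ℝ → ℂ) =ᵐ[volume] f := by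
  rw [toL2_eq h]; exact h.coeFn_toLp

lemma toL2_coeFn (f : L2) : toL2 (f : ℝ → ℂ) = f := by
  rw [toL2_eq (Lp.memLp f)]; exact Lp.toLp_coeFn f (Lp.memLp f)

lemma toL2_congr {f g : ℝ → ℂ} (hf : MemLp f 2 volume) (h : f =ᵐ[volume] g) :
    toL2 f = toL2 g := by
  rw [toL2_eq hf, toL2_eq (hf.ae_eq h)]
  exact (MemLp.toLp_eq_toLp_iff _ _).2 h

lemma toL2_add {f g : ℝ → ℂ} (hf : MemLp f 2 volume) (hg : MemLp g 2 volume) :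
    toL2 (fun x => f x + g x) = toL2 f + toL2 g := by
  rw [toL2_eq hf, toL2_eq hg, toL2_eq (f := fun x => f x + g x) (hf.add hg)]; rfl

lemma toL2_smul (c : ℂ) {f : ℝ → ℂ} (hf : MemLp f 2 volume) :
    toL2 (fun x => c * f x) = c • toL2 f := by
  rw [toL2_eq hf, toL2_eq (f := fun x => c * f x) (hf.const_smul c)]; rfl

lemma inner_eq_integral (f g : L2) :
    inner ℂ f g = ∫ x, (starRingEnd ℂ) (f x) * g x := by
  rw [MeasureTheory.L2.inner_def]
  refine integral_congr_ae (ae_of_all _ fun x => ?_)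
  simp [mul_comm]

lemma inner_toL2_right (f : L2) {g : ℝ → ℂ} (hg : MemLp g 2 volume) :
    inner ℂ f (toL2 g) = ∫ x, (starRingEnd ℂ) (f x) * g x := by
  rw [inner_eq_integral]
  refine integral_congr_ae ?_
  filter_upwards [coeFn_toL2 hg] with x hx
  rw [hx]

lemma inner_toL2 {f g : ℝ → ℂ} (hf : MemLp f 2 volume) (hg : MemLp g 2 volume) :
    inner ℂ (toL2 f) (toL2 g) = ∫ x, (starRingEnd ℂ) (f x) * g x := by
  rw [inner_toL2_right _ hg]
  refine integral_congr_ae ?_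
  filter_upwards [coeFn_toL2 hf] with x hx
  rw [hx]

lemma norm_sq_toL2 {f : ℝ → ℂ} (hf : MemLp f 2 volume) :
    ‖toL2 f‖ ^ 2 = ∫ x, ‖f x‖ ^ 2 := by
  have h := inner_self_eq_norm_sq_to_K (𝕜 := ℂ) (toL2 f)
  rw [inner_toL2 hf hf] at h
  have h2 : (∫ x, (starRingEnd ℂ) (f x) * f x) = ((∫ x, ‖f x‖ ^ 2 : ℝ) : ℂ) := by
    rw [← integral_complex_ofReal]
    refine integral_congr_ae (ae_of_all _ fun x => ?_)
    simp only
    rw [Complex.conj_mul']; push_cast; rfl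
  rw [h2] at h
  exact Complex.ofReal_injective (by rw [h]; simp)

lemma integrable_mul_of_memLp {f g : ℝ → ℂ} (hf : MemLp f 2 volume) (hg : MemLp g 2 volume) :
    Integrable fun x => f x * g x :=
  MemLp.integrable_mul hf hg

lemma memLp_conj {f : ℝ → ℂ} (hf : MemLp f 2 volume) :
    MemLp (fun x => (starRingEnd ℂ) (f x)) 2 volume := by
  refine hf.of_le (Complex.continuous_conj.comp_aestronglyMeasurable hf.1) (ae_of_all _ fun x => ?_)
  simp

lemma memLp_bdd_mul {f b : ℝ → ℂ} (hf : MemLp f 2 volume) (hb : AEStronglyMeasurable b volume)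
    {C : ℝ} (hC : ∀ x, ‖b x‖ ≤ C) : MemLp (fun x => b x * f x) 2 volume := by
  refine hf.of_le_mul (c := C) (hb.mul hf.1) (ae_of_all _ fun x => ?_)
  rw [norm_mul]
  exact mul_le_mul_of_nonneg_right (hC x) (norm_nonneg _)

/-- A series of square-integrable functions which converges pointwise, and whose norms are
summable, converges in `L²`. -/
lemma hasSum_toL2 {f : ℕ → ℝ → ℂ} {F : ℝ → ℂ} (hf : ∀ n, MemLp (f n) 2 volume)
    (hs : Summable fun n => ‖toL2 (f n)‖) (hF : ∀ x, HasSum (fun n => f n x) (F x)) :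
    MemLp F 2 volume ∧ HasSum (fun n => toL2 (f n)) (toL2 F) := by
  obtain ⟨s, hsum⟩ := Summable.of_norm hs
  have ht := hsum.tendsto_sum_nat
  -- Norm convergence gives almost everywhere convergence along a subsequence, which identifies the
  -- $L^2$ sum with the pointwise one.
  obtain ⟨ns, hns, hae⟩ := (tendstoInMeasure_of_tendsto_Lp ht).exists_seq_tendsto_ae
  have hco : ∀ᵐ x, ∀ N : ℕ, (∑ n ∈ Finset.range N, toL2 (f n) : L2) x
      = ∑ n ∈ Finset.range N, f n x := by
    rw [ae_all_iff]
    intro N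
    induction N with
    | zero => simp
    | succ N ih =>
      rw [Finset.sum_range_succ]
      filter_upwards [ih, Lp.coeFn_add (∑ n ∈ Finset.range N, toL2 (f n)) (toL2 (f N)),
        coeFn_toL2 (hf N)] with x h1 h2 h3
      rw [h2, Pi.add_apply, h1, h3, Finset.sum_range_succ]
  have hsF : (s : ℝ → ℂ) =ᵐ[volume] F := by
    filter_upwards [hae, hco] with x h1 h2
    have h3 := ((hF x).tendsto_sum_nat).comp hns.tendsto_atTop
    refine tendsto_nhds_unique h1 (h3.congr fun k => ?_)
    exact (h2 (ns k)).symm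
  have hmem : MemLp F 2 volume := (Lp.memLp s).ae_eq hsF
  refine ⟨hmem, ?_⟩
  rwa [← toL2_congr (Lp.memLp s) hsF, toL2_coeFn]

/-! ### Functions of Gaussian decay -/

/-- Continuous functions bounded by a Gaussian. -/
def GaussDecay (f : ℝ → ℂ) : Prop :=
  Continuous f ∧ ∃ C δ : ℝ, 0 < δ ∧ ∀ x, ‖f x‖ ≤ C * Real.exp (-δ * x ^ 2)

namespace GaussDecay

variable {f g b : ℝ → ℂ}

lemma add (hf : GaussDecay f) (hg : GaussDecay g) : GaussDecay fun x => f x + g x := by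
  obtain ⟨cf, C, δ, hδ, h⟩ := hf
  obtain ⟨cg, D, ε, hε, k⟩ := hg
  have hC : 0 ≤ C := by simpa using (norm_nonneg _).trans (h 0)
  have hD : 0 ≤ D := by simpa using (norm_nonneg _).trans (k 0)
  refine ⟨cf.add cg, C + D, min δ ε, lt_min hδ hε, fun x => (norm_add_le _ _).trans ?_⟩
  rw [add_mul]
  refine add_le_add ((h x).trans ?_) ((k x).trans ?_)
  · gcongr; exact min_le_left _ _
  · gcongr; exact min_le_right _ _

lemma bdd_mul (hf : GaussDecay f) (hb : Continuous b) {B : ℝ} (hB : ∀ x, ‖b x‖ ≤ B) :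
    GaussDecay fun x => b x * f x := by
  obtain ⟨cf, C, δ, hδ, h⟩ := hf
  have hB0 : 0 ≤ B := (norm_nonneg _).trans (hB 0)
  refine ⟨hb.mul cf, B * C, δ, hδ, fun x => ?_⟩
  rw [norm_mul, mul_assoc]
  exact mul_le_mul (hB x) (h x) (norm_nonneg _) hB0

lemma const_mul (c : ℂ) (hf : GaussDecay f) : GaussDecay fun x => c * f x :=
  hf.bdd_mul continuous_const (fun _ => le_rfl)

lemma neg (hf : GaussDecay f) : GaussDecay fun x => -f x := by
  simpa using hf.const_mul (-1)

lemma conj (hf : GaussDecay f) : GaussDecay fun x => (starRingEnd ℂ) (f x) := by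
  obtain ⟨cf, C, δ, hδ, h⟩ := hf
  exact ⟨Complex.continuous_conj.comp cf, C, δ, hδ, fun x => by simpa using h x⟩

lemma mul (hf : GaussDecay f) (hg : GaussDecay g) : GaussDecay fun x => f x * g x := by
  obtain ⟨cf, C, δ, hδ, h⟩ := hf
  have hC : 0 ≤ C := by simpa using (norm_nonneg _).trans (h 0)
  refine hg.bdd_mul cf (B := C) fun x => (h x).trans ?_
  have : Real.exp (-δ * x ^ 2) ≤ 1 := Real.exp_le_one_iff.2 (by nlinarith [sq_nonneg x])
  nlinarith

/-- Half of the exponent is spent on the factor $|x|$, through $|x|\le(1+x^2)/2$ and $1+u\le e^u$.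
-/
lemma abs_mul_exp_le {δ : ℝ} (hδ : 0 < δ) (x : ℝ) :
    |x| * Real.exp (-δ * x ^ 2) ≤ (1 / 2 + 1 / δ) * Real.exp (-(δ / 2) * x ^ 2) := by
  have h1 : δ / 2 * x ^ 2 + 1 ≤ Real.exp (δ / 2 * x ^ 2) := Real.add_one_le_exp _
  have h2 : |x| ≤ (1 / 2 + 1 / δ) * Real.exp (δ / 2 * x ^ 2) := by
    have h3 : |x| ≤ (1 + x ^ 2) / 2 := by nlinarith [sq_nonneg (|x| - 1), sq_abs x]
    have h4 : x ^ 2 / 2 ≤ 1 / δ * Real.exp (δ / 2 * x ^ 2) := by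
      rw [one_div, inv_mul_eq_div, le_div_iff₀ hδ]; linarith
    have h5 : 1 ≤ Real.exp (δ / 2 * x ^ 2) := Real.one_le_exp (by positivity)
    rw [add_mul]; linarith
  calc |x| * Real.exp (-δ * x ^ 2)
      ≤ (1 / 2 + 1 / δ) * Real.exp (δ / 2 * x ^ 2) * Real.exp (-δ * x ^ 2) := by gcongr
    _ = _ := by rw [mul_assoc, ← Real.exp_add]; ring_nf

lemma id_mul (hf : GaussDecay f) : GaussDecay fun x => (x : ℂ) * f x := by
  obtain ⟨cf, C, δ, hδ, h⟩ := hf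
  have hC : 0 ≤ C := by simpa using (norm_nonneg _).trans (h 0)
  refine ⟨Complex.continuous_ofReal.mul cf, C * (1 / 2 + 1 / δ), δ / 2, by positivity, fun x => ?_⟩
  rw [norm_mul, Complex.norm_real, Real.norm_eq_abs]
  calc |x| * ‖f x‖ ≤ |x| * (C * Real.exp (-δ * x ^ 2)) := by gcongr; exact h x
    _ = C * (|x| * Real.exp (-δ * x ^ 2)) := by ring
    _ ≤ C * ((1 / 2 + 1 / δ) * Real.exp (-(δ / 2) * x ^ 2)) := by
        exact mul_le_mul_of_nonneg_left (abs_mul_exp_le hδ x) hC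
    _ = _ := by ring

lemma integrable (hf : GaussDecay f) : Integrable f := by
  obtain ⟨cf, C, δ, hδ, h⟩ := hf
  refine Integrable.mono' ((integrable_exp_neg_mul_sq hδ).const_mul C) cf.aestronglyMeasurable
    (ae_of_all _ h)

lemma memLp (hf : GaussDecay f) : MemLp f 2 volume := by
  rw [memLp_two_iff_integrable_sq_norm hf.1.aestronglyMeasurable]
  refine (hf.mul hf).integrable.norm.congr (ae_of_all _ fun x => ?_)
  simp [sq]

lemma exp_quadratic {b : ℂ} (hb : b.re < 0) (c d : ℂ) :
    GaussDecay fun x : ℝ => Complex.exp (b * (x : ℂ) ^ 2 + c * x + d) := by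
  refine ⟨by fun_prop, Real.exp (c.re ^ 2 / (2 * -b.re) + d.re), -b.re / 2, by linarith,
    fun x => ?_⟩
  rw [Complex.norm_exp, ← Real.exp_add, Real.exp_le_exp]
  have h1 : (b * (x : ℂ) ^ 2 + c * x + d).re = b.re * x ^ 2 + c.re * x + d.re := by
    rw [← Complex.ofReal_pow, Complex.add_re, Complex.add_re, Complex.re_mul_ofReal,
      Complex.re_mul_ofReal]
  rw [h1]
  -- Completing the square: half of the quadratic term absorbs the linear one.
  have h2 : c.re * x ≤ c.re ^ 2 / (2 * -b.re) + -b.re / 2 * x ^ 2 := by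
    have hb' : 0 < 2 * -b.re := by linarith
    rw [← sub_nonneg]
    have : c.re ^ 2 / (2 * -b.re) + -b.re / 2 * x ^ 2 - c.re * x
        = (c.re + b.re * x) ^ 2 / (2 * -b.re) := by
      field_simp [hb.ne]; ring
    rw [this]; positivity
  linarith

end GaussDecay

lemma integral_mul_deriv_gaussDecay {u v u' v' : ℝ → ℂ} (hu : ∀ x, HasDerivAt u (u' x) x)
    (hv : ∀ x, HasDerivAt v (v' x) x) (h1 : GaussDecay fun x => u x * v' x)
    (h2 : GaussDecay fun x => u' x * v x) (h3 : GaussDecay fun x => u x * v x) :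
    ∫ x, u x * v' x = -∫ x, u' x * v x :=
  integral_mul_deriv_eq_deriv_mul_of_integrable (fun x _ => hu x) (fun x _ => hv x)
    h1.integrable h2.integrable h3.integrable

/-! ### The free-particle basis in closed form -/

/-- The complex width `w = 1 + i t`. -/
def width (t : ℝ) : ℂ := 1 + Complex.I * (t : ℂ)

/-- The coefficient of `x z` in the exponent of the generating function. -/
def slope (t : ℝ) : ℂ := -Complex.I / width t

/-- Twice the coefficient of `z²` in the exponent of the generating function. -/
def twist (t : ℝ) : ℂ := (1 - Complex.I * (t : ℂ)) / width t

lemma width_re (t : ℝ) : (width t).re = 1 := by simp [width]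

lemma width_ne_zero (t : ℝ) : width t ≠ 0 := by
  intro h
  have := width_re t
  rw [h] at this
  simp at this

/-- Together with `slope_add_twist`, this makes $a^+$ act on a polynomial times the vacuum by the
three-term recursion of `herm`. -/
lemma raise_mul_slope (t : ℝ) : (Complex.I + t) * slope t = twist t := by
  rw [slope, twist, mul_div_assoc', div_left_inj' (width_ne_zero t)]
  linear_combination -Complex.I_sq

lemma slope_add_twist (t : ℝ) : slope t + Complex.I / 2 * twist t = -Complex.I / 2 := by
  rw [slope, twist]
  field_simp [width_ne_zero t]
  rw [width]; ring

lemma inv_width (t : ℝ) : (width t)⁻¹ = Complex.I * slope t := by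
  rw [slope]
  field_simp [width_ne_zero t]
  simp

lemma psiVac_eq (t x : ℝ) : psiVac t x =
    (((2 * Real.pi) ^ (-(1 / 4) : ℝ) : ℝ) : ℂ) * (width t) ^ (-(1 / 2) : ℂ) *
    Complex.exp (-(4 * width t)⁻¹ * (x : ℂ) ^ 2) := by
  rw [psiVac, width]; congr 2; rw [div_eq_mul_inv]; ring

lemma hasDerivAt_psiVac (t x : ℝ) :
    HasDerivAt (psiVac t) (-(Complex.I / 2) * slope t * x * psiVac t x) x := by
  have h1 : HasDerivAt (fun y : ℝ => (y : ℂ)) 1 x := Complex.ofRealCLM.hasDerivAt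
  have h2 := (((h1.pow 2).const_mul (-(4 * width t)⁻¹)).cexp).const_mul
    ((((2 * Real.pi) ^ (-(1 / 4) : ℝ) : ℝ) : ℂ) * (width t) ^ (-(1 / 2) : ℂ))
  have h3 : psiVac t = fun y : ℝ => (((2 * Real.pi) ^ (-(1 / 4) : ℝ) : ℝ) : ℂ) *
      (width t) ^ (-(1 / 2) : ℂ) * Complex.exp (-(4 * width t)⁻¹ * (y : ℂ) ^ 2) :=
    funext (psiVac_eq t)
  rw [h3]
  refine h2.congr_deriv ?_
  rw [mul_inv, inv_width]
  simp only [Pi.pow_apply]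
  push_cast
  ring

/-- The polynomials `Hₙ` with `ψₙ = (n!)^(-1/2) Hₙ ψ₀`. -/
def herm (t : ℝ) : ℕ → ℂ → ℂ
  | 0, _ => 1
  | 1, x => slope t * x
  | n + 2, x => slope t * x * herm t (n + 1) x + twist t * (n + 1) * herm t n x

/-- One recursion covers every index: at $n=0$ the truncated `n - 1` is harmless because its
coefficient vanishes. -/
lemma herm_succ (t : ℝ) (n : ℕ) (x : ℂ) :
    herm t (n + 1) x = slope t * x * herm t n x + twist t * n * herm t (n - 1) x := by
  cases n with
  | zero => simp [herm]
  | succ n => simp [herm]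

lemma hasDerivAt_herm (t : ℝ) (n : ℕ) (x : ℂ) :
    HasDerivAt (herm t n) (n * slope t * herm t (n - 1) x) x := by
  induction n using Nat.strong_induction_on with
  | _ n ih =>
    match n with
    | 0 => simpa [funext_iff, herm] using hasDerivAt_const x (1 : ℂ)
    | 1 =>
      have : herm t 1 = fun x => slope t * x := rfl
      rw [this]
      simpa [herm] using (hasDerivAt_id x).const_mul (slope t)
    | n + 2 =>
      have h1 := ih (n + 1) (by omega)
      have h0 := ih n (by omega)
      have h : herm t (n + 2) = fun x => slope t * x * herm t (n + 1) x +
        twist t * (n + 1) * herm t n x := rfl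
      rw [h]
      refine ((((hasDerivAt_id x).const_mul (slope t)).mul h1).add
        (h0.const_mul (twist t * (n + 1)))).congr_deriv ?_
      simp only [Nat.add_sub_cancel, id, show n + 2 - 1 = n + 1 by omega]
      -- The two terms carrying $n+1$ recombine by the recursion into $(n+1)\cdot$`slope`$\cdot
      -- H_{n+1}$.
      rw [herm_succ t n x]
      push_cast
      ring

lemma coef_pos (n : ℕ) : 0 < coef n := by
  unfold coef; positivity

lemma coef_succ (n : ℕ) : coef n / Real.sqrt (n + 1) = coef (n + 1) := by
  unfold coef
  rw [Nat.factorial_succ]; push_cast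
  rw [Real.sqrt_mul (by positivity), mul_inv, div_eq_mul_inv, mul_comm]

lemma sqrt_mul_coef_succ (n : ℕ) : Real.sqrt (n + 1) * coef (n + 1) = coef n := by
  rw [← coef_succ, mul_div_cancel₀]
  positivity

lemma sqrt_mul_coef_pred (n : ℕ) : Real.sqrt n * coef (n - 1) = n * coef n := by
  cases n with
  | zero => simp
  | succ n =>
    rw [Nat.add_sub_cancel, ← sqrt_mul_coef_succ n, ← mul_assoc]
    push_cast
    rw [Real.mul_self_sqrt (by positivity)]

lemma coef_mul_coef (n : ℕ) : coef n * coef n = ((Nat.factorial n : ℝ))⁻¹ := by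
  unfold coef
  rw [← mul_inv, Real.mul_self_sqrt (by positivity)]

lemma hasDerivAt_herm_mul_psiVac (t : ℝ) (n : ℕ) (x : ℝ) :
    HasDerivAt (fun y : ℝ => herm t n y * psiVac t y)
      ((n * slope t * herm t (n - 1) x - Complex.I / 2 * slope t * x * herm t n x) *
        psiVac t x) x := by
  refine ((hasDerivAt_herm t n x).comp_ofReal.mul (hasDerivAt_psiVac t x)).congr_deriv ?_
  ring

lemma psi_eq (t : ℝ) (n : ℕ) : psi t n = fun x : ℝ => coef n * (herm t n x * psiVac t x) := by
  induction n with
  | zero => funext x; simp [psi, coef, herm]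
  | succ n ih =>
    funext x
    change raise t (psi t n) x / _ = _
    rw [ih]
    simp only [raise]
    rw [((hasDerivAt_herm_mul_psiVac t n x).const_mul (coef n : ℂ)).deriv, ← coef_succ n,
      herm_succ, ← raise_mul_slope]
    push_cast
    have h : (Complex.I + t) * slope t = twist t := raise_mul_slope t
    have h2 := slope_add_twist t
    rw [← h] at h2
    field_simp
    linear_combination (-(2 * x * herm t n x * coef n * psiVac t x)) * h2

lemma mul_psi (t : ℝ) (n : ℕ) (x : ℝ) : slope t * x * psi t n x =
    Real.sqrt (n + 1) * psi t (n + 1) x - twist t * Real.sqrt n * psi t (n - 1) x := by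
  rw [psi_eq, psi_eq, psi_eq]
  simp only
  have h1 : (Real.sqrt (n + 1) : ℂ) * coef (n + 1) = coef n := by
    rw [← Complex.ofReal_mul, sqrt_mul_coef_succ]
  have h2 : (Real.sqrt n : ℂ) * coef (n - 1) = n * coef n := by
    rw [← Complex.ofReal_mul, sqrt_mul_coef_pred]; push_cast; rfl
  rw [herm_succ]
  linear_combination (-(slope t * x * herm t n x + twist t * n * herm t (n - 1) x) * psiVac t x) * h1
    + twist t * herm t (n - 1) x * psiVac t x * h2

/-- The derivative of `ψₙ` in terms of its neighbours. -/
def psiDeriv (t : ℝ) (n : ℕ) (x : ℝ) : ℂ :=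
  -(Complex.I / 2) * (Real.sqrt n * psi t (n - 1) x + Real.sqrt (n + 1) * psi t (n + 1) x)

/-- This is $a+a^+=2i\partial_x$: both $t$ and $x$ drop out, so the matrix of $\partial_x$ in the
basis is constant in time. The time independence of $S$ comes from here. -/
lemma hasDerivAt_psi (t : ℝ) (n : ℕ) (x : ℝ) : HasDerivAt (psi t n) (psiDeriv t n x) x := by
  have h := (hasDerivAt_herm_mul_psiVac t n x).const_mul (coef n : ℂ)
  rw [← psi_eq] at h
  refine h.congr_deriv ?_
  have h2 : (Real.sqrt n : ℂ) * coef (n - 1) = n * coef n := by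
    rw [← Complex.ofReal_mul, sqrt_mul_coef_pred]; push_cast; rfl
  have h3 := mul_psi t n x
  rw [psiDeriv]
  have h4 : Real.sqrt n * psi t (n - 1) x = n * coef n * herm t (n - 1) x * psiVac t x := by
    rw [psi_eq]; linear_combination herm t (n - 1) x * psiVac t x * h2
  have h5 : psi t n x = coef n * (herm t n x * psiVac t x) := by rw [psi_eq]
  have h6 := slope_add_twist t
  linear_combination (Complex.I / 2) * slope t * x * h5 - (Complex.I / 2) * h3
    - (slope t) * h4 + (Real.sqrt n * psi t (n - 1) x) * h6

lemma gaussDecay_psi (t : ℝ) (n : ℕ) : GaussDecay (psi t n) := by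
  have h0 : GaussDecay (psiVac t) := by
    have hre : (-(4 * width t)⁻¹).re < 0 := by
      rw [Complex.neg_re, neg_lt_zero, Complex.inv_re]
      have : (4 * width t).re = 4 := by simp [width_re]
      rw [this]
      have : 0 < Complex.normSq (4 * width t) := by
        rw [Complex.normSq_pos]; exact mul_ne_zero (by norm_num) (width_ne_zero t)
      positivity
    have := (GaussDecay.exp_quadratic hre 0 0).const_mul
      ((((2 * Real.pi) ^ (-(1 / 4) : ℝ) : ℝ) : ℂ) * (width t) ^ (-(1 / 2) : ℂ))
    simp only [zero_mul, add_zero] at this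
    rwa [funext (psiVac_eq t)]
  rw [psi_eq]
  refine GaussDecay.const_mul _ ?_
  induction n using Nat.strong_induction_on with
  | _ n ih =>
    match n with
    | 0 => simpa [herm] using h0
    | n + 1 =>
      simp only [herm_succ]
      have h1 := ((ih n (by omega)).id_mul).const_mul (slope t)
      have h2 := (ih (n - 1) (by omega)).const_mul (twist t * n)
      convert h1.add h2 using 2
      ring

lemma gaussDecay_psiDeriv (t : ℝ) (n : ℕ) : GaussDecay (psiDeriv t n) :=
  (((gaussDecay_psi t (n - 1)).const_mul _).add ((gaussDecay_psi t (n + 1)).const_mul _)).const_mul _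

lemma raise_psi (t : ℝ) (n : ℕ) (x : ℝ) : (Real.sqrt (n + 1) : ℂ) * psi t (n + 1) x =
    (Complex.I + t) * psiDeriv t n x - Complex.I / 2 * (x * psi t n x) := by
  have h : (Real.sqrt (n + 1) : ℂ) ≠ 0 := by
    rw [Complex.ofReal_ne_zero]; positivity
  change _ * (((Complex.I + (t : ℂ)) * deriv (psi t n) x - Complex.I * (x : ℂ) / 2 * psi t n x) / _)
    = _
  rw [(hasDerivAt_psi t n x).deriv, mul_div_cancel₀ _ h]
  ring

/-- The annihilation operator is obtained from the creation operator by subtracting it from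
$2i\partial_x$. -/
lemma lower_psi (t : ℝ) (n : ℕ) (x : ℝ) : (Real.sqrt n : ℂ) * psi t (n - 1) x =
    (Complex.I - t) * psiDeriv t n x + Complex.I / 2 * (x * psi t n x) := by
  have h := raise_psi t n x
  rw [psiDeriv] at h ⊢
  linear_combination -h + (Real.sqrt n * psi t (n - 1) x + Real.sqrt (n + 1) * psi t (n + 1) x) * Complex.I_sq

/-! ### Orthonormality of the free-particle basis. -/

lemma hasDerivAt_conj {f : ℝ → ℂ} {f' : ℂ} {x : ℝ} (h : HasDerivAt f f' x) :
    HasDerivAt (fun y => (starRingEnd ℂ) (f y)) ((starRingEnd ℂ) f') x := by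
  simpa using h.star

/-- Adjointness $\langle\psi_m|a^+\psi_n\rangle=\langle a\psi_m|\psi_n\rangle$, by one integration
by parts. -/
lemma sqrt_mul_integral_psi (t : ℝ) (m n : ℕ) :
    (Real.sqrt (n + 1) : ℂ) * ∫ x, (starRingEnd ℂ) (psi t m x) * psi t (n + 1) x =
      Real.sqrt m * ∫ x, (starRingEnd ℂ) (psi t (m - 1) x) * psi t n x := by
  have gm := (gaussDecay_psi t m).conj
  have gn := gaussDecay_psi t n
  have dm := (gaussDecay_psiDeriv t m).conj
  have dn := gaussDecay_psiDeriv t n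
  have hibp := integral_mul_deriv_gaussDecay (fun x => hasDerivAt_conj (hasDerivAt_psi t m x))
    (hasDerivAt_psi t n) (gm.mul dn) (dm.mul gn) (gm.mul gn)
  have hl : (Real.sqrt (n + 1) : ℂ) * ∫ x, (starRingEnd ℂ) (psi t m x) * psi t (n + 1) x =
      (Complex.I + t) * (∫ x, (starRingEnd ℂ) (psi t m x) * psiDeriv t n x) -
      Complex.I / 2 * ∫ x, (starRingEnd ℂ) (psi t m x) * (x * psi t n x) := by
    rw [← integral_const_mul, ← integral_const_mul, ← integral_const_mul, ← integral_sub
      ((gm.mul dn).integrable.const_mul _) ((gm.mul gn.id_mul).integrable.const_mul _)]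
    refine integral_congr_ae (ae_of_all _ fun x => ?_)
    linear_combination (starRingEnd ℂ) (psi t m x) * raise_psi t n x
  have hr : (Real.sqrt m : ℂ) * ∫ x, (starRingEnd ℂ) (psi t (m - 1) x) * psi t n x =
      (-Complex.I - t) * (∫ x, (starRingEnd ℂ) (psiDeriv t m x) * psi t n x) -
      Complex.I / 2 * ∫ x, (starRingEnd ℂ) (psi t m x) * (x * psi t n x) := by
    rw [← integral_const_mul, ← integral_const_mul, ← integral_const_mul, ← integral_sub
      ((dm.mul gn).integrable.const_mul _) ((gm.mul gn.id_mul).integrable.const_mul _)]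
    refine integral_congr_ae (ae_of_all _ fun x => ?_)
    have h := congrArg (starRingEnd ℂ) (lower_psi t m x)
    simp only [map_mul, map_add, map_sub, Complex.conj_ofReal, Complex.conj_I, map_div₀,
      map_ofNat] at h
    linear_combination psi t n x * h
  rw [hl, hr, hibp]
  ring

lemma norm_psiVac_sq (t x : ℝ) : ‖psiVac t x‖ ^ 2 =
    (Real.sqrt (2 * Real.pi * (1 + t ^ 2)))⁻¹ * Real.exp (-(1 / (2 * (1 + t ^ 2))) * x ^ 2) := by
  have hw : ‖width t‖ ^ 2 = 1 + t ^ 2 := by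
    rw [← Complex.normSq_eq_norm_sq, width, Complex.normSq_apply]; simp; ring
  have hw0 : 0 < ‖width t‖ := norm_pos_iff.2 (width_ne_zero t)
  have hw' : ‖width t‖ = Real.sqrt (1 + t ^ 2) := by
    rw [← hw, Real.sqrt_sq hw0.le]
  rw [psiVac_eq, norm_mul, norm_mul, mul_pow, mul_pow]
  have h1 : ‖(((2 * Real.pi) ^ (-(1 / 4) : ℝ) : ℝ) : ℂ)‖ ^ 2 = (Real.sqrt (2 * Real.pi))⁻¹ := by
    rw [Complex.norm_real, Real.norm_eq_abs, sq_abs, ← Real.rpow_natCast, ← Real.rpow_mul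
      (by positivity), Real.sqrt_eq_rpow, ← Real.rpow_neg (by positivity)]
    norm_num
  have h2 : ‖width t ^ (-(1 / 2) : ℂ)‖ ^ 2 = (Real.sqrt (1 + t ^ 2))⁻¹ := by
    have : (-(1 / 2) : ℂ) = ((-(1 / 2) : ℝ) : ℂ) := by push_cast; rfl
    rw [this, Complex.norm_cpow_real, ← hw', ← Real.rpow_natCast, ← Real.rpow_mul hw0.le,
      ← Real.rpow_neg_one]
    norm_num
  have h3 : ‖Complex.exp (-(4 * width t)⁻¹ * (x : ℂ) ^ 2)‖ ^ 2 =
      Real.exp (-(1 / (2 * (1 + t ^ 2))) * x ^ 2) := by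
    rw [Complex.norm_exp, ← Real.exp_nat_mul, ← Complex.ofReal_pow, Complex.re_mul_ofReal,
      Complex.neg_re, Complex.inv_re, Complex.normSq_eq_norm_sq, norm_mul, mul_pow, hw]
    congr 1
    have : (4 * width t).re = 4 := by simp [width_re]
    rw [this]
    norm_num
    have : (1 + t ^ 2) ≠ 0 := by positivity
    field_simp
    ring
  rw [h1, h2, h3, Real.sqrt_mul (x := 2 * Real.pi) (by positivity), mul_inv]

lemma integral_norm_psiVac_sq (t : ℝ) : ∫ x, ‖psiVac t x‖ ^ 2 = 1 := by
  simp only [norm_psiVac_sq]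
  rw [integral_const_mul, integral_gaussian]
  have h : Real.pi / (1 / (2 * (1 + t ^ 2))) = 2 * Real.pi * (1 + t ^ 2) := by field_simp
  rw [h]
  exact inv_mul_cancel₀ (by positivity)

lemma integral_psi_mul_psi (t : ℝ) (m n : ℕ) :
    ∫ x, (starRingEnd ℂ) (psi t m x) * psi t n x = if m = n then 1 else 0 := by
  induction n generalizing m with
  | zero =>
    cases m with
    | zero =>
      rw [if_pos rfl, ← Complex.ofReal_one, ← integral_norm_psiVac_sq t, ← integral_complex_ofReal]
      refine integral_congr_ae (ae_of_all _ fun x => ?_)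
      simp only [psi]
      rw [Complex.conj_mul']; push_cast; rfl
    | succ m =>
      rw [if_neg (by omega)]
      -- The vacuum is annihilated: the right-hand side carries $\sqrt 0$. Conjugation then
      -- exchanges the two indices.
      have h := sqrt_mul_integral_psi t 0 m
      simp only [Nat.cast_zero, Real.sqrt_zero, Complex.ofReal_zero, zero_mul] at h
      have h' : (Real.sqrt (m + 1) : ℂ) ≠ 0 := by rw [Complex.ofReal_ne_zero]; positivity
      have h2 := (mul_eq_zero.1 h).resolve_left h'
      have h3 := congrArg (starRingEnd ℂ) h2
      rw [← integral_conj, map_zero] at h3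
      rw [← h3]
      refine integral_congr_ae (ae_of_all _ fun x => ?_)
      simp [mul_comm]
  | succ n ih =>
    have h := sqrt_mul_integral_psi t m n
    have h' : (Real.sqrt (n + 1) : ℂ) ≠ 0 := by rw [Complex.ofReal_ne_zero]; positivity
    rw [ih] at h
    refine mul_left_cancel₀ h' (h.trans ?_)
    cases m with
    | zero => simp
    | succ m => by_cases hm : m = n <;> simp [hm]

/-! ### The generating function -/

/-- The logarithmic derivative of the exponential is `slope` times $x+(i+t)z$, so differentiation in
$z$ reproduces the recursion of `herm` at the shifted point. At $z=0$ the Taylor coefficients are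
read off. -/
lemma iteratedDeriv_exp_quadratic (t : ℝ) (x : ℂ) (n : ℕ) :
    iteratedDeriv n (fun z : ℂ => Complex.exp (slope t * x * z + twist t / 2 * z ^ 2)) =
      fun z => herm t n (x + (Complex.I + t) * z) *
        Complex.exp (slope t * x * z + twist t / 2 * z ^ 2) := by
  induction n with
  | zero => simp [herm]
  | succ n ih =>
    rw [iteratedDeriv_succ, ih]
    funext z
    have h1 : HasDerivAt (fun z : ℂ => x + (Complex.I + t) * z) (Complex.I + t) z := by
      simpa using ((hasDerivAt_id z).const_mul (Complex.I + (t : ℂ))).const_add x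
    have h2 := (hasDerivAt_herm t n (x + (Complex.I + t) * z)).comp z h1
    have h3 : HasDerivAt (fun z : ℂ => slope t * x * z + twist t / 2 * z ^ 2)
        (slope t * x + twist t * z) z := by
      refine (((hasDerivAt_id z).const_mul (slope t * x)).add
        (((hasDerivAt_id z).pow 2).const_mul (twist t / 2))).congr_deriv ?_
      simp; ring
    refine (h2.mul h3.cexp).deriv.trans ?_
    rw [herm_succ, ← raise_mul_slope]
    simp only [Function.comp]
    ring

lemma hasSum_psi (z : ℂ) (t x : ℝ) : HasSum (fun n : ℕ => (coef n : ℂ) * z ^ n * psi t n x)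
    (psiVac t x * Complex.exp (slope t * x * z + twist t / 2 * z ^ 2)) := by
  have hd : Differentiable ℂ
      (fun z : ℂ => Complex.exp (slope t * x * z + twist t / 2 * z ^ 2)) := by fun_prop
  have h := (Complex.hasSum_taylorSeries_of_entire hd 0 z).mul_left (psiVac t x)
  refine h.congr_fun ?_
  intro n
  rw [iteratedDeriv_exp_quadratic, psi_eq]
  have hc : (coef n : ℂ) * coef n = ((Nat.factorial n : ℂ))⁻¹ := by
    rw [← Complex.ofReal_mul, coef_mul_coef]; push_cast; rfl
  simp only [← hc, smul_eq_mul]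
  simp
  ring

lemma psiZ_eq (z : ℂ) (t x : ℝ) : psiZ z t x =
    Phi z * (psiVac t x * Complex.exp (slope t * x * z + twist t / 2 * z ^ 2)) := by
  rw [psiZ, (hasSum_psi z t x).tsum_eq]

lemma hasSum_psiZ (z : ℂ) (t x : ℝ) :
    HasSum (fun n : ℕ => (Phi z : ℂ) * (coef n : ℂ) * z ^ n * psi t n x) (psiZ z t x) := by
  rw [psiZ_eq]
  simpa [mul_assoc] using (hasSum_psi z t x).mul_left (Phi z : ℂ)

/-! ### The Darboux transforms of the basis and their Gram matrix -/

lemma GaussDecay.of_norm_le_add {f g k : ℝ → ℂ} (hf : Continuous f) (hg : GaussDecay g)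
    (hk : GaussDecay k) (h : ∀ x, ‖f x‖ ≤ ‖g x‖ + ‖k x‖) : GaussDecay f := by
  obtain ⟨cf, C, δ, hδ, h1⟩ := hg
  obtain ⟨cg, D, ε, hε, h2⟩ := hk
  have hC : 0 ≤ C := by simpa using (norm_nonneg _).trans (h1 0)
  have hD : 0 ≤ D := by simpa using (norm_nonneg _).trans (h2 0)
  refine ⟨hf, C + D, min δ ε, lt_min hδ hε, fun x => (h x).trans ?_⟩
  rw [add_mul]
  refine add_le_add ((h1 x).trans ?_) ((h2 x).trans ?_)
  · gcongr; exact min_le_left _ _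
  · gcongr; exact min_le_right _ _

lemma hasSum_of_eq {f g : ℕ → ℂ} {b c : ℂ} (h : HasSum f b) (hf : ∀ n, g n = f n) (hb : c = b) :
    HasSum g c := by
  rw [hb, funext hf]; exact h

/-- The superpotential `a tanh (a x)`. -/
def superpot (a x : ℝ) : ℂ := ((a * Real.tanh (a * x) : ℝ) : ℂ)

lemma hasDerivAt_superpot (a x : ℝ) :
    HasDerivAt (superpot a) ((a ^ 2 / Real.cosh (a * x) ^ 2 : ℝ) : ℂ) x := by
  have h0 : HasDerivAt (fun y : ℝ => a * y) a x := by
    simpa using (hasDerivAt_id x).const_mul a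
  have h1 : HasDerivAt (fun y : ℝ => a * (Real.sinh (a * y) / Real.cosh (a * y)))
      (a ^ 2 / Real.cosh (a * x) ^ 2) x := by
    refine ((h0.sinh.div h0.cosh (Real.cosh_pos _).ne').const_mul a).congr_deriv ?_
    have := Real.cosh_sq (a * x)
    have hc := (Real.cosh_pos (a * x)).ne'
    field_simp
    rw [this]; ring
  have h2 : superpot a = fun y : ℝ => ((a * (Real.sinh (a * y) / Real.cosh (a * y)) : ℝ) : ℂ) := by
    funext y; rw [superpot, Real.tanh_eq_sinh_div_cosh]
  rw [h2]
  exact h1.ofReal_comp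

lemma continuous_superpot (a : ℝ) : Continuous (superpot a) :=
  continuous_iff_continuousAt.2 fun x => (hasDerivAt_superpot a x).continuousAt

lemma norm_superpot_le (a x : ℝ) : ‖superpot a x‖ ≤ |a| := by
  rw [superpot, Complex.norm_real, Real.norm_eq_abs, abs_mul]
  exact mul_le_of_le_one_right (abs_nonneg _) (Real.abs_tanh_lt_one _).le

lemma superpot_sq (a x : ℝ) : ((a ^ 2 / Real.cosh (a * x) ^ 2 : ℝ) : ℂ) + superpot a x ^ 2 =
    (a : ℂ) ^ 2 := by
  rw [superpot, Real.tanh_eq_sinh_div_cosh, ← Complex.ofReal_pow, ← Complex.ofReal_pow,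
    ← Complex.ofReal_add]
  congr 1
  have := Real.cosh_sq (a * x)
  have hc := (Real.cosh_pos (a * x)).ne'
  field_simp
  rw [this]; ring

lemma phi_eq (a : ℝ) (n : ℕ) (t x : ℝ) :
    phi a n t x = -superpot a x * psi t n x + psiDeriv t n x := by
  rw [phi, darboux, (hasDerivAt_psi t n x).deriv, superpot]

lemma gaussDecay_phi (a : ℝ) (n : ℕ) (t : ℝ) : GaussDecay (phi a n t) := by
  have h := ((gaussDecay_psi t n).bdd_mul (continuous_superpot a) (norm_superpot_le a)).neg.add
    (gaussDecay_psiDeriv t n)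
  rw [funext (phi_eq a n t)]
  simpa using h

/-- This is $L^+L=-\partial_x^2+a^2$ in weak form. With the superpotential $w=a\tanh(ax)$ and
$w^2+w'=a^2$, the difference of the integrands is the total derivative $-(w\,\bar\psi_n\psi_k)'$. -/
lemma integral_phi_mul_phi (a t : ℝ) (n k : ℕ) :
    ∫ x, (starRingEnd ℂ) (phi a n t x) * phi a k t x =
      (∫ x, (starRingEnd ℂ) (psiDeriv t n x) * psiDeriv t k x) +
        (a : ℂ) ^ 2 * ∫ x, (starRingEnd ℂ) (psi t n x) * psi t k x := by
  have gn := (gaussDecay_psi t n).conj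
  have gk := gaussDecay_psi t k
  have dn := (gaussDecay_psiDeriv t n).conj
  have dk := gaussDecay_psiDeriv t k
  have hp := gn.mul gk
  have hd := (dn.mul gk).add (gn.mul dk)
  have cw' : Continuous fun x : ℝ => ((a ^ 2 / Real.cosh (a * x) ^ 2 : ℝ) : ℂ) :=
    Complex.continuous_ofReal.comp (continuous_const.div ((Real.continuous_cosh.comp
      (continuous_const.mul continuous_id)).pow 2) fun x => by
        have := Real.cosh_pos (a * x); positivity)
  have bw' : ∀ x : ℝ, ‖((a ^ 2 / Real.cosh (a * x) ^ 2 : ℝ) : ℂ)‖ ≤ a ^ 2 := fun x => by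
    rw [Complex.norm_real, Real.norm_eq_abs, abs_of_nonneg (by positivity)]
    refine div_le_self (sq_nonneg a) ?_
    nlinarith [Real.one_le_cosh (a * x)]
  have hibp := integral_mul_deriv_gaussDecay (hasDerivAt_superpot a)
    (fun x => (hasDerivAt_conj (hasDerivAt_psi t n x)).mul (hasDerivAt_psi t k x))
    (hd.bdd_mul (continuous_superpot a) (norm_superpot_le a)) (hp.bdd_mul cw' bw')
    (hp.bdd_mul (continuous_superpot a) (norm_superpot_le a))
  have i1 := (hd.bdd_mul (continuous_superpot a) (norm_superpot_le a)).integrable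
  have i2 := (hp.bdd_mul cw' bw').integrable
  have hid : ∀ x, (starRingEnd ℂ) (phi a n t x) * phi a k t x =
      ((starRingEnd ℂ) (psiDeriv t n x) * psiDeriv t k x +
        (a : ℂ) ^ 2 * ((starRingEnd ℂ) (psi t n x) * psi t k x)) -
      (((a ^ 2 / Real.cosh (a * x) ^ 2 : ℝ) : ℂ) * ((starRingEnd ℂ) (psi t n x) * psi t k x) +
      superpot a x * ((starRingEnd ℂ) (psiDeriv t n x) * psi t k x +
        (starRingEnd ℂ) (psi t n x) * psiDeriv t k x)) := fun x => by
    have hc : (starRingEnd ℂ) (superpot a x) = superpot a x := by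
      rw [superpot, Complex.conj_ofReal]
    rw [phi_eq, phi_eq, map_add, map_mul, map_neg, hc, ← superpot_sq a x]
    ring
  have i12 : Integrable fun x => ((a ^ 2 / Real.cosh (a * x) ^ 2 : ℝ) : ℂ) *
      ((starRingEnd ℂ) (psi t n x) * psi t k x) + superpot a x *
      ((starRingEnd ℂ) (psiDeriv t n x) * psi t k x +
        (starRingEnd ℂ) (psi t n x) * psiDeriv t k x) := i2.add i1
  simp only [hid]
  rw [integral_sub ((dn.mul dk).add ((gn.mul gk).const_mul _)).integrable i12,
    integral_add (dn.mul dk).integrable ((gn.mul gk).const_mul _).integrable,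
    integral_add i2 i1, hibp, integral_const_mul]
  simp only [Pi.mul_apply]
  ring

/-! ### The model: oscillator functions in a weighted space -/

/-- The real Hermite functions `iⁿ ψₙ(·, 0)`. -/
def osc (n : ℕ) (x : ℝ) : ℂ := Complex.I ^ n * psi 0 n x

/-- The weight `(x² / 4 + a²)^(1/2)`. -/
def weight (a x : ℝ) : ℝ := Real.sqrt (x ^ 2 / 4 + a ^ 2)

/-- The coherent states `Φ ∑ aₙ zⁿ iⁿ ψₙ(·, 0)`. -/
def packet (z : ℂ) (x : ℝ) : ℂ := psiZ (Complex.I * z) 0 x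

lemma gaussDecay_osc (n : ℕ) : GaussDecay (osc n) := (gaussDecay_psi 0 n).const_mul _

lemma continuous_weight (a : ℝ) : Continuous (weight a) := by
  unfold weight; fun_prop

lemma weight_sq (a x : ℝ) : weight a x ^ 2 = x ^ 2 / 4 + a ^ 2 := by
  rw [weight, Real.sq_sqrt (by positivity)]

lemma weight_nonneg (a x : ℝ) : 0 ≤ weight a x := Real.sqrt_nonneg _

lemma weight_le (a x : ℝ) : weight a x ≤ |x| + |a| := by
  refine Real.sqrt_le_iff.2 ⟨by positivity, ?_⟩
  nlinarith [sq_abs x, sq_abs a, abs_nonneg x, abs_nonneg a, mul_nonneg (abs_nonneg x) (abs_nonneg a)]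

lemma GaussDecay.weight_mul {f : ℝ → ℂ} (hf : GaussDecay f) (a : ℝ) :
    GaussDecay fun x => (weight a x : ℂ) * f x := by
  refine GaussDecay.of_norm_le_add
    ((Complex.continuous_ofReal.comp (continuous_weight a)).mul hf.1) hf.id_mul
    (hf.const_mul a) fun x => ?_
  simp only [norm_mul, Complex.norm_real, Real.norm_eq_abs]
  rw [← add_mul, abs_of_nonneg (weight_nonneg a x)]
  exact mul_le_mul_of_nonneg_right (weight_le a x) (norm_nonneg _)

lemma integral_osc_mul_osc (n k : ℕ) :
    ∫ x, (starRingEnd ℂ) (osc n x) * osc k x = if n = k then 1 else 0 := by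
  have h : ∀ x, (starRingEnd ℂ) (osc n x) * osc k x =
      (starRingEnd ℂ) (Complex.I ^ n) * Complex.I ^ k *
        ((starRingEnd ℂ) (psi 0 n x) * psi 0 k x) := fun x => by
    simp only [osc, map_mul]; ring
  simp only [h]
  rw [integral_const_mul, integral_psi_mul_psi]
  by_cases hnk : n = k
  · subst hnk
    rw [if_pos rfl, mul_one, Complex.conj_mul']
    simp
  · simp [hnk]

lemma twist_zero : twist 0 = 1 := by simp [twist, width]

lemma slope_zero : slope 0 = -Complex.I := by simp [slope, width]

/-- The phases $i^n$ make both off-diagonal signs positive, so position acts on `osc` by the Jacobi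
matrix that $2i\partial_x$ has on $\psi_n$. -/
lemma mul_osc (n : ℕ) (x : ℝ) : (x : ℂ) * osc n x =
    Real.sqrt n * osc (n - 1) x + Real.sqrt (n + 1) * osc (n + 1) x := by
  have h := mul_psi 0 n x
  rw [twist_zero, slope_zero] at h
  unfold osc
  cases n with
  | zero =>
    simp only [Nat.cast_zero, Real.sqrt_zero, Complex.ofReal_zero, zero_mul, mul_zero,
      sub_zero] at h ⊢
    rw [zero_add, pow_succ]
    simp only [zero_add] at h ⊢
    linear_combination (Complex.I) * h + (x * psi 0 0 x) * Complex.I_sq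
  | succ n =>
    rw [Nat.add_sub_cancel] at *
    rw [pow_succ (n := n + 1), pow_succ]
    linear_combination (Complex.I ^ n * Complex.I * Complex.I) * h
      + (Complex.I ^ n * Complex.I * x * psi 0 (n + 1) x - Complex.I ^ n * Real.sqrt (n + 1 : ℕ) * psi 0 n x) * Complex.I_sq

lemma Phi_I_mul (z : ℂ) : Phi (Complex.I * z) = Phi z := by
  simp [Phi]

lemma hasSum_packet (z : ℂ) (x : ℝ) :
    HasSum (fun n : ℕ => (Phi z : ℂ) * (coef n : ℂ) * z ^ n * osc n x) (packet z x) := by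
  have h := hasSum_psiZ (Complex.I * z) 0 x
  rw [Phi_I_mul] at h
  refine hasSum_of_eq h (fun n => ?_) rfl
  rw [osc, mul_pow]; ring

/-! ### Orthonormal families and Jacobi matrices -/

/-- The combination `√n vₙ₋₁ + √(n+1) vₙ₊₁`. -/
def jacobi (v : ℕ → L2) (n : ℕ) : L2 :=
  (Real.sqrt n : ℂ) • v (n - 1) + (Real.sqrt (n + 1) : ℂ) • v (n + 1)

/-- Only orthonormality enters, which allows the basis at time $t$ to be replaced by the fixed
functions `osc`. -/
lemma inner_jacobi {v w : ℕ → L2} (hv : Orthonormal ℂ v) (hw : Orthonormal ℂ w) (n k : ℕ) :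
    inner ℂ (jacobi v n) (jacobi v k) = inner ℂ (jacobi w n) (jacobi w k) := by
  rw [orthonormal_iff_ite] at hv hw
  simp only [jacobi, inner_add_left, inner_add_right, inner_smul_left, inner_smul_right, hv, hw]

lemma norm_jacobi_le {v : ℕ → L2} (hv : Orthonormal ℂ v) (n : ℕ) :
    ‖jacobi v n‖ ≤ 2 * (n + 1) := by
  refine (norm_add_le _ _).trans ?_
  rw [norm_smul, norm_smul, hv.1, hv.1, Complex.norm_real, Complex.norm_real, mul_one, mul_one,
    Real.norm_eq_abs, Real.norm_eq_abs, abs_of_nonneg (Real.sqrt_nonneg _),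
    abs_of_nonneg (Real.sqrt_nonneg _)]
  have hn : (0 : ℝ) ≤ n := Nat.cast_nonneg n
  have h1 : Real.sqrt n ≤ n + 1 := Real.sqrt_le_iff.2 ⟨by positivity, by nlinarith⟩
  have h2 : Real.sqrt (n + 1) ≤ n + 1 := Real.sqrt_le_iff.2 ⟨by positivity, by nlinarith⟩
  linarith

lemma orthonormal_psi (t : ℝ) : Orthonormal ℂ fun n => toL2 (psi t n) := by
  rw [orthonormal_iff_ite]
  intro m n
  rw [inner_toL2 (gaussDecay_psi t m).memLp (gaussDecay_psi t n).memLp, integral_psi_mul_psi]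

lemma orthonormal_osc : Orthonormal ℂ fun n => toL2 (osc n) := by
  rw [orthonormal_iff_ite]
  intro m n
  rw [inner_toL2 (gaussDecay_osc m).memLp (gaussDecay_osc n).memLp, integral_osc_mul_osc]

lemma toL2_psiDeriv (t : ℝ) (n : ℕ) :
    toL2 (psiDeriv t n) = (-(Complex.I / 2)) • jacobi (fun n => toL2 (psi t n)) n := by
  have g1 := (gaussDecay_psi t (n - 1)).memLp
  have g2 := (gaussDecay_psi t (n + 1)).memLp
  rw [jacobi, ← toL2_smul _ g1, ← toL2_smul _ g2, ← toL2_add (g1.const_mul _) (g2.const_mul _),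
    ← toL2_smul (f := fun x => (Real.sqrt n : ℂ) * psi t (n - 1) x +
      (Real.sqrt (n + 1) : ℂ) * psi t (n + 1) x) _ ((g1.const_mul _).add (g2.const_mul _))]
  rfl

lemma toL2_mul_osc (n : ℕ) :
    toL2 (fun x => (x : ℂ) * osc n x) = jacobi (fun n => toL2 (osc n)) n := by
  have g1 := (gaussDecay_osc (n - 1)).memLp
  have g2 := (gaussDecay_osc (n + 1)).memLp
  rw [jacobi, ← toL2_smul _ g1, ← toL2_smul _ g2, ← toL2_add (g1.const_mul _) (g2.const_mul _)]
  congr 1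
  funext x
  exact mul_osc n x

lemma gram_eq_jacobi (a t : ℝ) (n k : ℕ) : gram a t n k =
    1 / 4 * inner ℂ (jacobi (fun n => toL2 (osc n)) n) (jacobi (fun n => toL2 (osc n)) k) +
      (a : ℂ) ^ 2 * if n = k then 1 else 0 := by
  rw [gram, inner_toL2 (gaussDecay_phi a n t).memLp (gaussDecay_phi a k t).memLp,
    integral_phi_mul_phi, integral_psi_mul_psi, ← inner_toL2 (gaussDecay_psiDeriv t n).memLp
      (gaussDecay_psiDeriv t k).memLp, toL2_psiDeriv, toL2_psiDeriv, inner_smul_left,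
    inner_smul_right, inner_jacobi (orthonormal_psi t) orthonormal_osc]
  congr 1
  rw [← mul_assoc]
  congr 1
  simp only [map_neg, map_div₀, Complex.conj_I, map_ofNat]
  linear_combination (-1 / 4 : ℂ) * Complex.I_sq

lemma integral_weight_sq_osc (a : ℝ) (n k : ℕ) :
    ∫ x, (starRingEnd ℂ) (osc n x) * ((weight a x : ℂ) ^ 2 * osc k x) =
    1 / 4 * inner ℂ (jacobi (fun n => toL2 (osc n)) n) (jacobi (fun n => toL2 (osc n)) k) +
      (a : ℂ) ^ 2 * if n = k then 1 else 0 := by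
  have gn := gaussDecay_osc n
  have gk := gaussDecay_osc k
  rw [← toL2_mul_osc, ← toL2_mul_osc, inner_toL2 gn.id_mul.memLp gk.id_mul.memLp,
    ← integral_osc_mul_osc n k, ← integral_const_mul, ← integral_const_mul, ← integral_add
      ((gn.id_mul.conj.mul gk.id_mul).const_mul _).integrable
      ((gn.conj.mul gk).const_mul _).integrable]
  refine integral_congr_ae (ae_of_all _ fun x => ?_)
  simp only [map_mul, Complex.conj_ofReal]
  rw [← Complex.ofReal_pow, weight_sq]
  push_cast
  ring

/-- The weighted oscillator functions. -/
def wosc (a : ℝ) (n : ℕ) : L2 := toL2 fun x => (weight a x : ℂ) * osc n x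

lemma inner_wosc (a t : ℝ) (n k : ℕ) : inner ℂ (wosc a n) (wosc a k) = gram a t n k := by
  rw [gram_eq_jacobi, ← integral_weight_sq_osc, wosc, wosc, inner_toL2
    ((gaussDecay_osc n).weight_mul a).memLp ((gaussDecay_osc k).weight_mul a).memLp]
  refine integral_congr_ae (ae_of_all _ fun x => ?_)
  simp only [map_mul, Complex.conj_ofReal]
  ring

lemma norm_sq_eq_gram (a t : ℝ) (n : ℕ) : ((‖toL2 (phi a n t)‖ : ℂ)) ^ 2 = gram a t n n := by
  rw [gram, inner_self_eq_norm_sq_to_K]; rfl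

lemma norm_wosc (a t : ℝ) (n : ℕ) : ‖wosc a n‖ = ‖toL2 (phi a n t)‖ := by
  have h := norm_sq_eq_gram a t n
  rw [← inner_wosc, inner_self_eq_norm_sq_to_K] at h
  have h' : ‖toL2 (phi a n t)‖ ^ 2 = ‖wosc a n‖ ^ 2 := by
    exact Complex.ofReal_injective (by push_cast; rw [h]; rfl)
  exact ((sq_eq_sq₀ (norm_nonneg _) (norm_nonneg _)).1 h').symm

/-- Linear growth in $n$ is all that is needed for the series with coefficients $z^n/\sqrt{n!}$ to
converge absolutely in norm. -/
lemma norm_phi_le (a t : ℝ) (n : ℕ) : ‖toL2 (phi a n t)‖ ≤ n + 1 + |a| := by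
  have h := norm_sq_eq_gram a t n
  rw [gram_eq_jacobi, if_pos rfl, inner_self_eq_norm_sq_to_K] at h
  have h' : ‖toL2 (phi a n t)‖ ^ 2 =
      1 / 4 * ‖jacobi (fun n => toL2 (osc n)) n‖ ^ 2 + a ^ 2 := by
    have h2 : ((‖toL2 (phi a n t)‖ ^ 2 : ℝ) : ℂ) =
      ((1 / 4 * ‖jacobi (fun n => toL2 (osc n)) n‖ ^ 2 + a ^ 2 : ℝ) : ℂ) := by
        push_cast; rw [h]; simp
    exact_mod_cast h2
  have hj := norm_jacobi_le orthonormal_osc n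
  have hj0 := norm_nonneg (jacobi (fun n => toL2 (osc n)) n)
  have hn : (0 : ℝ) ≤ n := Nat.cast_nonneg n
  refine abs_le_of_sq_le_sq' ?_ (by positivity) |>.2
  rw [h']
  nlinarith [sq_abs a, abs_nonneg a, mul_nonneg hn (abs_nonneg a)]

/-! ### The coherent states as series in `L²` -/

/-- The term is split as $(r^n2^n/\sqrt{n!})\cdot((n+1+|C|)2^{-n})$ and bounded by the sum of the
squares, an exponential series plus a polynomial times a geometric one. -/
lemma summable_coef_mul (r C : ℝ) (hr : 0 ≤ r) :
    Summable fun n : ℕ => coef n * r ^ n * (n + 1 + |C|) := by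
  have h1 : Summable fun n : ℕ => (4 * r ^ 2) ^ n / (n.factorial : ℝ) :=
    Real.summable_pow_div_factorial _
  have hq : ‖(1 / 4 : ℝ)‖ < 1 := by norm_num
  have h2 : Summable fun n : ℕ => (n : ℝ) ^ 2 * (1 / 4 : ℝ) ^ n :=
    summable_pow_mul_geometric_of_norm_lt_one 2 hq
  have h3 : Summable fun n : ℕ => (n : ℝ) ^ 1 * (1 / 4 : ℝ) ^ n :=
    summable_pow_mul_geometric_of_norm_lt_one 1 hq
  have h4 : Summable fun n : ℕ => (1 / 4 : ℝ) ^ n := summable_geometric_of_norm_lt_one hq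
  have h5 := (h1.add ((h2.add (h3.mul_left (2 * (1 + |C|)))).add (h4.mul_left ((1 + |C|) ^ 2))))
  refine Summable.of_nonneg_of_le (fun n => ?_) (fun n => ?_) h5
  · have := coef_pos n; positivity
  · have e1 : (4 * r ^ 2) ^ n / (n.factorial : ℝ) = (coef n * r ^ n * 2 ^ n) ^ 2 := by
      rw [mul_pow, mul_pow, mul_pow (coef n), sq (coef n), coef_mul_coef, ← pow_mul, ← pow_mul,
        ← pow_mul, mul_comm n 2, pow_mul 2 2]
      norm_num
      rw [div_eq_mul_inv]; ring
    have e2 : (n : ℝ) ^ 2 * (1 / 4 : ℝ) ^ n + 2 * (1 + |C|) * ((n : ℝ) ^ 1 * (1 / 4 : ℝ) ^ n) +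
        (1 + |C|) ^ 2 * (1 / 4 : ℝ) ^ n = ((n + 1 + |C|) * (1 / 2) ^ n) ^ 2 := by
      have : ((1 / 2 : ℝ) ^ n) ^ 2 = (1 / 4) ^ n := by rw [← pow_mul, mul_comm, pow_mul]; norm_num
      rw [mul_pow, this]; ring
    rw [e1, e2]
    have e3 : coef n * r ^ n * (n + 1 + |C|) =
        (coef n * r ^ n * 2 ^ n) * ((n + 1 + |C|) * (1 / 2) ^ n) := by
      have : (2 : ℝ) ^ n * (1 / 2) ^ n = 1 := by rw [← mul_pow]; norm_num
      linear_combination -(coef n * r ^ n * (n + 1 + |C|)) * this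
    rw [e3]
    nlinarith [sq_nonneg (coef n * r ^ n * 2 ^ n - (n + 1 + |C|) * (1 / 2) ^ n),
      sq_nonneg (coef n * r ^ n * 2 ^ n + (n + 1 + |C|) * (1 / 2) ^ n)]

lemma hasSum_toL2_coef {f : ℕ → ℝ → ℂ} {F : ℝ → ℂ} {z : ℂ} {C : ℝ}
    (hf : ∀ n, MemLp (f n) 2 volume) (hC : ∀ n : ℕ, ‖toL2 (f n)‖ ≤ n + 1 + |C|)
    (hF : ∀ x, HasSum (fun n => (Phi z : ℂ) * (coef n : ℂ) * z ^ n * f n x) (F x)) :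
    MemLp F 2 volume ∧
      HasSum (fun n => ((Phi z : ℂ) * (coef n : ℂ) * z ^ n) • toL2 (f n)) (toL2 F) := by
  have h := hasSum_toL2 (f := fun n x => (Phi z : ℂ) * (coef n : ℂ) * z ^ n * f n x)
    (fun n => (hf n).const_mul _) ?_ hF
  · simpa only [toL2_smul _ (hf _)] using h
  · simp only [toL2_smul _ (hf _)]
    refine Summable.of_nonneg_of_le (fun n => norm_nonneg _) (fun n => ?_)
      ((summable_coef_mul ‖z‖ C (norm_nonneg _)).mul_left (Phi z))
    have hP : 0 < Phi z := Real.exp_pos _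
    have hc := coef_pos n
    rw [norm_smul, norm_mul, norm_mul, norm_pow, Complex.norm_real, Complex.norm_real,
      Real.norm_eq_abs, Real.norm_eq_abs, abs_of_pos hP, abs_of_pos hc, ← mul_assoc,
      ← mul_assoc]
    exact mul_le_mul_of_nonneg_left (hC n) (by positivity)

lemma hasDerivAt_psiZ (z : ℂ) (t x : ℝ) : HasDerivAt (psiZ z t)
    ((-(Complex.I / 2) * slope t * x + slope t * z) * psiZ z t x) x := by
  have h1 : HasDerivAt (fun y : ℝ => slope t * (y : ℂ) * z + twist t / 2 * z ^ 2)
      (slope t * z) x := by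
    have : HasDerivAt (fun y : ℝ => (y : ℂ)) 1 x := Complex.ofRealCLM.hasDerivAt
    simpa using ((this.const_mul (slope t)).mul_const z).add_const (twist t / 2 * z ^ 2)
  have h2 := ((hasDerivAt_psiVac t x).mul h1.cexp).const_mul (Phi z : ℂ)
  rw [funext (psiZ_eq z t)]
  refine h2.congr_deriv ?_
  ring

lemma phiZ_eq (a : ℝ) (z : ℂ) (t x : ℝ) : phiZ a z t x =
    (-superpot a x + (-(Complex.I / 2) * slope t * x + slope t * z)) * psiZ z t x := by
  rw [phiZ, darboux, (hasDerivAt_psiZ z t x).deriv, superpot]; ring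

lemma hasSum_phiZ (a : ℝ) (z : ℂ) (t x : ℝ) :
    HasSum (fun n : ℕ => (Phi z : ℂ) * (coef n : ℂ) * z ^ n * phi a n t x) (phiZ a z t x) := by
  have h := hasSum_psiZ z t x
  -- This is $a\psi_z=z\psi_z$ written as a shifted series. It replaces termwise differentiation:
  -- $\psi_n'$ is expressed through $x\psi_n$ and $\sqrt n\,\psi_{n-1}$.
  have hl : HasSum (fun n : ℕ => (Phi z : ℂ) * (coef n : ℂ) * z ^ n *
      (Real.sqrt n * psi t (n - 1) x)) (z * psiZ z t x) := by
    rw [← hasSum_nat_add_iff' 1]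
    simp only [Finset.range_one, Finset.sum_singleton, Nat.cast_zero, Real.sqrt_zero,
      Complex.ofReal_zero, zero_mul, mul_zero, sub_zero, Nat.add_sub_cancel]
    refine hasSum_of_eq (h.mul_left z) (fun n => ?_) rfl
    have : (Real.sqrt (n + 1) : ℂ) * coef (n + 1) = coef n := by
      rw [← Complex.ofReal_mul, sqrt_mul_coef_succ]
    push_cast
    rw [pow_succ]
    linear_combination (Phi z * z ^ n * z * psi t n x) * this
  have h2 := (h.mul_left (-superpot a x - (Complex.I / 2) * slope t * x)).add
    (hl.mul_left (slope t))
  refine hasSum_of_eq h2 (fun n => ?_) ?_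
  · have h3 := mul_psi t n x
    have h6 := slope_add_twist t
    rw [phi_eq, psiDeriv]
    linear_combination (Phi z * coef n * z ^ n) * ((Complex.I / 2) * h3
      - (Real.sqrt n * psi t (n - 1) x) * h6)
  · rw [phiZ_eq]; ring

lemma toL2_phiZ (a : ℝ) (z : ℂ) (t : ℝ) : MemLp (phiZ a z t) 2 volume ∧
    HasSum (fun n : ℕ => ((Phi z : ℂ) * (coef n : ℂ) * z ^ n) • toL2 (phi a n t))
      (toL2 (phiZ a z t)) :=
  hasSum_toL2_coef (fun n => (gaussDecay_phi a n t).memLp) (norm_phi_le a t) (hasSum_phiZ a z t)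

/-- The weighted coherent states. -/
def wpacket (a : ℝ) (z : ℂ) : L2 := toL2 fun x => (weight a x : ℂ) * packet z x

lemma hasSum_wpacket (a : ℝ) (z : ℂ) :
    MemLp (fun x => (weight a x : ℂ) * packet z x) 2 volume ∧
    HasSum (fun n : ℕ => ((Phi z : ℂ) * (coef n : ℂ) * z ^ n) • wosc a n) (wpacket a z) := by
  refine hasSum_toL2_coef (C := a) (fun n => ((gaussDecay_osc n).weight_mul a).memLp)
    (fun n => (norm_wosc a 0 n).le.trans (norm_phi_le a 0 n)) fun x => ?_
  exact hasSum_of_eq ((hasSum_packet z x).mul_left (weight a x : ℂ)) (fun n => by ring) rfl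

/-! ### Transplantation to the model -/

/-- Equal Gram matrices give equal norms to finite combinations with the same coefficients, so the
map $u_n\mapsto v_n$ is well defined on the span and extends by density. -/
lemma exists_isometry {E F : Type*} [NormedAddCommGroup E] [InnerProductSpace ℂ E]
    [NormedAddCommGroup F] [InnerProductSpace ℂ F] [CompleteSpace F] (u : ℕ → E) (v : ℕ → F)
    (h : ∀ n k, inner ℂ (v n) (v k) = inner ℂ (u n) (u k)) :
    ∃ W : (Submodule.span ℂ (Set.range u)).topologicalClosure →L[ℂ] F,
      (∀ n (hn : u n ∈ (Submodule.span ℂ (Set.range u)).topologicalClosure),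
        W ⟨u n, hn⟩ = v n) ∧ ∀ f g, inner ℂ (W f) (W g) = inner ℂ f g := by
  set K := (Submodule.span ℂ (Set.range u)).topologicalClosure with hK
  have hu : ∀ n, u n ∈ K := fun n =>
    Submodule.le_topologicalClosure _ (Submodule.subset_span ⟨n, rfl⟩)
  let e : (ℕ →₀ ℂ) →ₗ[ℂ] K := Finsupp.linearCombination ℂ fun n => (⟨u n, hu n⟩ : K)
  let T : (ℕ →₀ ℂ) →ₗ[ℂ] F := Finsupp.linearCombination ℂ v
  have hin : ∀ c d, inner ℂ (T c) (T d) = inner ℂ (e c) (e d) := fun c d => by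
    simp only [T, e, Finsupp.linearCombination_apply, Finsupp.sum, sum_inner, inner_sum,
      inner_smul_left, inner_smul_right, h, Submodule.coe_inner]
  have hnorm : ∀ c, ‖T c‖ = ‖e c‖ := fun c => by
    rw [@norm_eq_sqrt_re_inner ℂ, @norm_eq_sqrt_re_inner ℂ, hin]
  have hdense : DenseRange e := by
    intro x
    rw [closure_subtype]
    have hx : (x : E) ∈ closure (Submodule.span ℂ (Set.range u) : Set E) := x.2
    refine closure_mono ?_ hx
    intro y hy
    rw [SetLike.mem_coe, Finsupp.mem_span_range_iff_exists_finsupp] at hy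
    obtain ⟨c, rfl⟩ := hy
    refine ⟨e c, ⟨c, rfl⟩, ?_⟩
    simp [e, Finsupp.linearCombination_apply, Finsupp.sum]
  have hb : ∃ C, ∀ c, ‖T c‖ ≤ C * ‖e c‖ := ⟨1, fun c => by rw [hnorm, one_mul]⟩
  have hW : ∀ c, T.extendOfNorm e (e c) = T c := LinearMap.extendOfNorm_eq hdense hb
  refine ⟨T.extendOfNorm e, fun n hn => ?_, fun f g => ?_⟩
  · have := hW (Finsupp.single n 1)
    simpa [e, T] using this
  · refine hdense.induction_on₂ (p := fun f g =>
      inner ℂ (T.extendOfNorm e f) (T.extendOfNorm e g) = inner ℂ f g) ?_ ?_ f g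
    · exact isClosed_eq (by fun_prop) (by fun_prop)
    · intro c d
      rw [hW, hW, hin]

lemma phiZ_mem (a : ℝ) (z : ℂ) (t : ℝ) : toL2 (phiZ a z t) ∈ solitonSpace a t := by
  refine (Submodule.isClosed_topologicalClosure _).mem_of_tendsto
    (toL2_phiZ a z t).2.tendsto_sum_nat (Eventually.of_forall fun N => ?_)
  refine Submodule.sum_mem _ fun n _ => Submodule.smul_mem _ _ ?_
  exact Submodule.le_topologicalClosure _ (Submodule.subset_span ⟨n, rfl⟩)

lemma exists_model (a t : ℝ) : ∃ W : solitonSpace a t →L[ℂ] L2,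
    (∀ f g, inner ℂ (W f) (W g) = inner ℂ (f : L2) (g : L2)) ∧
    ∀ f z, inner ℂ (W f) (wpacket a z) = inner ℂ (f : L2) (toL2 (phiZ a z t)) := by
  obtain ⟨W, h1, h2⟩ := exists_isometry (fun n => toL2 (phi a n t)) (wosc a)
    (fun n k => inner_wosc a t n k)
  refine ⟨W, h2, fun f z => ?_⟩
  have hs := (hasSum_wpacket a z).2.mapL (innerSL ℂ (W f))
  have hs' := (toL2_phiZ a z t).2.mapL (innerSL ℂ (f : L2))
  refine hs.unique (hs'.congr_fun ?_)
  intro n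
  have hn : toL2 (phi a n t) ∈ (Submodule.span ℂ
    (Set.range fun n : ℕ => toL2 (phi a n t))).topologicalClosure :=
    Submodule.le_topologicalClosure _ (Submodule.subset_span ⟨n, rfl⟩)
  have h3 := h2 f ⟨_, hn⟩
  rw [h1] at h3
  simp only [innerSL_apply_apply, inner_smul_right, h3]
  rfl

/-! ### Cosine transforms -/

lemma integral_even_mul_exp {k : ℝ → ℝ} (hk : Integrable k) (he : ∀ t, k (-t) = k t) (x : ℝ) :
    ∫ t, (k t : ℂ) * Complex.exp (Complex.I * (t : ℂ) * (x : ℂ)) =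
      ((∫ t, k t * Real.cos (t * x) : ℝ) : ℂ) := by
  have hc : Integrable fun t => k t * Real.cos (t * x) :=
    hk.mul_bdd (c := 1) (by fun_prop) (ae_of_all _ fun t => by
      simpa using Real.abs_cos_le_one (t * x))
  have hs : Integrable fun t => k t * Real.sin (t * x) :=
    hk.mul_bdd (c := 1) (by fun_prop) (ae_of_all _ fun t => by
      simpa using Real.abs_sin_le_one (t * x))
  have h0 : ∫ t, k t * Real.sin (t * x) = 0 := by
    have h := integral_neg_eq_self (fun t => k t * Real.sin (t * x)) volume
    simp only [he, neg_mul, Real.sin_neg, mul_neg, integral_neg] at h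
    linarith
  have hid : ∀ t : ℝ, (k t : ℂ) * Complex.exp (Complex.I * (t : ℂ) * (x : ℂ)) =
      ((k t * Real.cos (t * x) : ℝ) : ℂ) + Complex.I * ((k t * Real.sin (t * x) : ℝ) : ℂ) :=
    fun t => by
      rw [mul_assoc, mul_comm Complex.I, ← Complex.ofReal_mul, Complex.exp_mul_I]
      push_cast; ring
  simp only [hid]
  rw [integral_add hc.ofReal (hs.ofReal.const_mul _), integral_const_mul, integral_complex_ofReal,
    integral_complex_ofReal, h0]
  simp

/-- Integration by parts for the cosine transform of an even function with a kink. -/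
lemma sq_add_sq_mul_integral_cos {g g' g'' : ℝ → ℝ} (h1 : ∀ t, HasDerivAt g (g' t) t)
    (h2 : ∀ t, HasDerivAt g' (g'' t) t) (hc : Continuous g'') (hs : HasCompactSupport g)
    (he : ∀ t, g (-t) = g t) (a x : ℝ) :
    (a ^ 2 + x ^ 2) * ∫ t, g t * Real.exp (-a * |t|) * Real.cos (t * x) =
      2 * a * g 0 - 2 * ∫ t in Set.Ioi (0 : ℝ),
        (g'' t - 2 * a * g' t) * Real.exp (-a * t) * Real.cos (t * x) := by
  have cg : Continuous g := continuous_iff_continuousAt.2 fun t => (h1 t).continuousAt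
  have cg' : Continuous g' := continuous_iff_continuousAt.2 fun t => (h2 t).continuousAt
  have hs' : HasCompactSupport g' := by
    have : g' = deriv g := funext fun t => (h1 t).deriv.symm
    rw [this]; exact hs.deriv
  have hs'' : HasCompactSupport g'' := by
    have : g'' = deriv g' := funext fun t => (h2 t).deriv.symm
    rw [this]; exact hs'.deriv
  -- Evenness removes the slope of $g$ at the origin, so the boundary term comes only from the kink
  -- of $e^{-a|t|}$.
  have hg0 : g' 0 = 0 := by
    have h3 : HasDerivAt (fun t => g (-t)) (-g' 0) 0 := by
      have h4 : HasDerivAt g (g' 0) (-0) := by simpa using h1 0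
      simpa [Function.comp_def] using h4.comp 0 (hasDerivAt_neg (0 : ℝ))
    have := h3.unique (by simpa only [he] using h1 0)
    linarith
  have habs : ∀ t, g |t| = g t := fun t => by
    rcases abs_choice t with h | h <;> rw [h]
    exact he t
  have hcos : ∀ t, Real.cos (|t| * x) = Real.cos (t * x) := fun t => by
    rcases abs_choice t with h | h <;> rw [h]
    rw [neg_mul, Real.cos_neg]
  have hhalf : ∫ t, g t * Real.exp (-a * |t|) * Real.cos (t * x) =
      2 * ∫ t in Set.Ioi (0 : ℝ), g t * Real.exp (-a * t) * Real.cos (t * x) := by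
    rw [← integral_comp_abs (f := fun t => g t * Real.exp (-a * t) * Real.cos (t * x))]
    simp only [habs, hcos]
  have i1 : Integrable fun t => g t * Real.exp (-a * t) * Real.cos (t * x) :=
    Continuous.integrable_of_hasCompactSupport (by fun_prop) (hs.mul_right.mul_right)
  have i2 : Integrable fun t => (g'' t - 2 * a * g' t) * Real.exp (-a * t) * Real.cos (t * x) :=
    Continuous.integrable_of_hasCompactSupport (by fun_prop)
      (((hs''.sub (hs'.mul_left (f := fun _ => 2 * a))).mul_right).mul_right)
  -- An antiderivative collecting both integrations by parts; at $t=0$ its value is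
  -- $-a\,g(0)+g'(0)$, and it vanishes for large $t$.
  have hd : ∀ t, HasDerivAt (fun t => Real.exp (-a * t) *
      (g t * (x * Real.sin (t * x) - a * Real.cos (t * x)) + g' t * Real.cos (t * x)))
      ((a ^ 2 + x ^ 2) * (g t * Real.exp (-a * t) * Real.cos (t * x)) +
        (g'' t - 2 * a * g' t) * Real.exp (-a * t) * Real.cos (t * x)) t := fun t => by
    have e1 : HasDerivAt (fun t => Real.exp (-a * t)) (Real.exp (-a * t) * -a) t := by
      simpa using ((hasDerivAt_id t).const_mul (-a)).exp
    have e0 : HasDerivAt (fun t => t * x) x t := by simpa using (hasDerivAt_id t).mul_const x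
    refine (e1.mul (((h1 t).mul ((e0.sin.const_mul x).sub (e0.cos.const_mul a))).add
      ((h2 t).mul e0.cos))).congr_deriv ?_
    simp only [Pi.mul_apply, Pi.add_apply, Pi.sub_apply]
    ring
  have htop : Tendsto (fun t => Real.exp (-a * t) *
      (g t * (x * Real.sin (t * x) - a * Real.cos (t * x)) + g' t * Real.cos (t * x)))
      atTop (𝓝 0) := by
    have hK : HasCompactSupport fun t => Real.exp (-a * t) *
      (g t * (x * Real.sin (t * x) - a * Real.cos (t * x)) + g' t * Real.cos (t * x)) :=
      (hs.mul_right.add hs'.mul_right).mul_left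
    exact hK.is_zero_at_infty.mono_left atTop_le_cocompact
  have hI := integral_Ioi_of_hasDerivAt_of_tendsto (a := 0) (by
      have : Continuous fun t => Real.exp (-a * t) *
        (g t * (x * Real.sin (t * x) - a * Real.cos (t * x)) + g' t * Real.cos (t * x)) := by
          fun_prop
      exact this.continuousWithinAt) (fun t _ => hd t)
    ((i1.const_mul _).add i2).integrableOn htop
  rw [integral_add (i1.const_mul _).integrableOn i2.integrableOn, integral_const_mul] at hI
  simp [hg0] at hI
  rw [hhalf]
  simp only [neg_mul]
  linear_combination 2 * hI

lemma norm_integral_Ioi_exp_le {f : ℝ → ℝ} {B a : ℝ} (ha : 0 < a) (hB : ∀ t, |f t| ≤ B) (x : ℝ) :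
    |∫ t in Set.Ioi (0 : ℝ), f t * Real.exp (-a * t) * Real.cos (t * x)| ≤ B / a := by
  have hi : IntegrableOn (fun t => B * Real.exp (-a * t)) (Set.Ioi 0) :=
    (exp_neg_integrableOn_Ioi 0 ha).const_mul B
  refine (norm_integral_le_of_norm_le
    (f := fun t => f t * Real.exp (-a * t) * Real.cos (t * x)) hi
    (ae_of_all _ fun t => ?_)).trans_eq ?_
  · rw [Real.norm_eq_abs, abs_mul, abs_mul, abs_of_pos (Real.exp_pos _)]
    have := Real.abs_cos_le_one (t * x)
    have hB0 : 0 ≤ B := (abs_nonneg _).trans (hB t)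
    have := mul_le_mul (mul_le_mul_of_nonneg_right (hB t) (Real.exp_pos (-a * t)).le) this
      (abs_nonneg _) (by positivity)
    simpa using this
  · rw [integral_const_mul, integral_exp_mul_Ioi (by linarith)]
    simp [div_eq_mul_inv]

/-! ### The approximating densities -/

namespace IsCutoff

variable {κ : ℝ → ℝ} (hκ : IsCutoff κ)
include hκ

lemma hasDerivAt (t : ℝ) : HasDerivAt κ (deriv κ t) t :=
  ((hκ.smooth.differentiable (by simp)) t).hasDerivAt

lemma smooth_deriv : ContDiff ℝ ∞ (deriv κ) := (contDiff_infty_iff_deriv.1 hκ.smooth).2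

lemma hasDerivAt_deriv (t : ℝ) : HasDerivAt (deriv κ) (deriv (deriv κ) t) t :=
  ((hκ.smooth_deriv.differentiable (by simp)) t).hasDerivAt

lemma continuous_deriv2 : Continuous (deriv (deriv κ)) := hκ.smooth_deriv.continuous_deriv (by simp)

lemma scaled {T : ℝ} (hT : 0 < T) : IsCutoff fun t => κ (t / T) where
  smooth := hκ.smooth.comp (contDiff_id.div_const T)
  compact := by
    have := hκ.compact.comp_homeomorph (Homeomorph.mulRight₀ T⁻¹ (inv_ne_zero hT.ne'))
    exact this
  even t := by rw [neg_div, hκ.even]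
  one := by simp [hκ.one]

end IsCutoff

lemma continuous_rho (a : ℝ) : Continuous (rho a) := by
  unfold rho; fun_prop

lemma rho_neg (a t : ℝ) : rho a (-t) = rho a t := by simp [rho]

lemma rho_eq (a t : ℝ) :
    rho a t = Real.exp (t ^ 2 / 8) / (2 * Real.pi * a) * Real.exp (-a * |t|) := by
  rw [rho, sub_eq_add_neg, Real.exp_add]; ring_nf

section

variable {a : ℝ} {κ : ℝ → ℝ} {T : ℝ}

lemma integrable_cutoff_rho (hκ : IsCutoff κ) (hT : 0 < T) :
    Integrable fun t => κ (t / T) * rho a t :=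
  Continuous.integrable_of_hasCompactSupport
    ((hκ.scaled hT).smooth.continuous.mul (continuous_rho a)) (hκ.scaled hT).compact.mul_right

lemma nuDensity_eq_exp (hκ : IsCutoff κ) (hT : 0 < T) (x : ℝ) : (nuDensity a κ T x : ℂ) =
    ∫ t, ((κ (t / T) * rho a t : ℝ) : ℂ) * Complex.exp (Complex.I * (t : ℂ) * (x : ℂ)) := by
  rw [integral_even_mul_exp (integrable_cutoff_rho hκ hT) (fun t => ?_), nuDensity]
  rw [rho_neg, (hκ.scaled hT).even]

lemma continuous_nuDensity (hκ : IsCutoff κ) (hT : 0 < T) : Continuous (nuDensity a κ T) := by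
  refine continuous_of_dominated (bound := fun t => |κ (t / T) * rho a t|) (fun x => ?_)
    (fun x => ae_of_all _ fun t => ?_) (integrable_cutoff_rho hκ hT).abs
    (ae_of_all _ fun t => by fun_prop)
  · exact (((hκ.scaled hT).smooth.continuous.mul (continuous_rho a)).mul
      (by fun_prop)).aestronglyMeasurable
  · rw [Real.norm_eq_abs, abs_mul]
    exact mul_le_of_le_one_right (abs_nonneg _) (Real.abs_cos_le_one _)

/-- The approximating densities decay quadratically. -/
lemma exists_nuDensity_le (ha : 0 < a) (hκ : IsCutoff κ) (hT : 0 < T) :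
    ∃ C, 0 ≤ C ∧ ∀ x, |nuDensity a κ T x| ≤ C * (1 + x ^ 2)⁻¹ := by
  -- The smooth even factor of the symbol. What remains is $e^{-a|t|}$, whose kink at the origin
  -- limits the decay obtained here to second order.
  set g : ℝ → ℝ := fun t => κ (t / T) * (Real.exp (t ^ 2 / 8) / (2 * Real.pi * a)) with hg
  have hsm : ContDiff ℝ ∞ g := by
    refine (hκ.scaled hT).smooth.mul ?_
    exact ((Real.contDiff_exp.comp ((contDiff_id.pow 2).div_const 8))).div_const _
  have hsm' : ContDiff ℝ ∞ (deriv g) := (contDiff_infty_iff_deriv.1 hsm).2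
  have hs : HasCompactSupport g := (hκ.scaled hT).compact.mul_right
  have hs' := hs.deriv
  have hs'' := hs'.deriv
  have cg'' : Continuous (deriv (deriv g)) := hsm'.continuous_deriv (by simp)
  obtain ⟨B, hB⟩ := (hs''.sub (hs'.mul_left (f := fun _ => 2 * a))).exists_bound_of_continuous
    (f := fun t => deriv (deriv g) t - 2 * a * deriv g t)
    (cg''.sub (continuous_const.mul hsm'.continuous))
  have key := fun x => sq_add_sq_mul_integral_cos
    (fun t => ((hsm.differentiable (by simp)) t).hasDerivAt)
    (fun t => ((hsm'.differentiable (by simp)) t).hasDerivAt) cg'' hs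
    (fun t => by simp only [hg]; rw [neg_div, hκ.even, neg_sq]) a x
  have hB0 : 0 ≤ B := (norm_nonneg _).trans (hB 0)
  set C1 := 2 * a * |g 0| + 2 * (B / a) with hC1
  have hC10 : 0 ≤ C1 := by positivity
  refine ⟨C1 * (1 + 1 / a ^ 2), by positivity, fun x => ?_⟩
  have h1 : nuDensity a κ T x = ∫ t, g t * Real.exp (-a * |t|) * Real.cos (t * x) := by
    rw [nuDensity]
    congr 1
    funext t
    rw [rho_eq, hg]; ring
  have h2 : (a ^ 2 + x ^ 2) * |nuDensity a κ T x| ≤ C1 := by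
    rw [← abs_of_nonneg (show 0 ≤ a ^ 2 + x ^ 2 by positivity), ← abs_mul, h1, key x]
    refine (abs_sub _ _).trans ?_
    rw [abs_mul (2 * a), abs_of_nonneg (show 0 ≤ 2 * a by positivity), abs_mul 2,
      abs_two]
    have := norm_integral_Ioi_exp_le ha (f := fun t => deriv (deriv g) t - 2 * a * deriv g t)
      hB x
    rw [hC1]
    gcongr
  rw [← div_eq_mul_inv, le_div_iff₀ (by positivity)]
  have h3 : 1 + x ^ 2 ≤ (1 + 1 / a ^ 2) * (a ^ 2 + x ^ 2) := by
    have : (1 + 1 / a ^ 2) * (a ^ 2 + x ^ 2) = a ^ 2 + x ^ 2 + 1 + x ^ 2 / a ^ 2 := by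
      field_simp; ring
    rw [this]
    have : 0 ≤ x ^ 2 / a ^ 2 := by positivity
    nlinarith [sq_nonneg a]
  calc |nuDensity a κ T x| * (1 + x ^ 2)
      ≤ |nuDensity a κ T x| * ((1 + 1 / a ^ 2) * (a ^ 2 + x ^ 2)) := by gcongr
    _ = ((a ^ 2 + x ^ 2) * |nuDensity a κ T x|) * (1 + 1 / a ^ 2) := by ring
    _ ≤ _ := by gcongr

lemma exists_nuDensity_bound (ha : 0 < a) (hκ : IsCutoff κ) (hT : 0 < T) :
    ∃ C, ∀ x, |nuDensity a κ T x| ≤ C := by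
  obtain ⟨C, hC, h⟩ := exists_nuDensity_le ha hκ hT
  refine ⟨C, fun x => (h x).trans (mul_le_of_le_one_right hC (inv_le_one_of_one_le₀ ?_))⟩
  nlinarith [sq_nonneg x]

lemma integrable_mul_nuDensity (ha : 0 < a) (hκ : IsCutoff κ) (hT : 0 < T) {F : ℝ → ℂ}
    (hF : Integrable F) : Integrable fun x : ℝ => F x * (nuDensity a κ T x : ℂ) := by
  obtain ⟨C, hC⟩ := exists_nuDensity_bound ha hκ hT
  refine hF.mul_bdd (c := C) ?_ (ae_of_all _ fun x => ?_)
  · exact (Complex.continuous_ofReal.comp (continuous_nuDensity hκ hT)).aestronglyMeasurable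
  · rw [Complex.norm_real]; exact hC x

/-- Fubini: the cutoff symbol is integrable, so pairing with the density passes to the Fourier side.
-/
lemma integral_mul_nuDensity (hκ : IsCutoff κ) (hT : 0 < T) {F : ℝ → ℂ} (hF : Integrable F) :
    ∫ x, F x * (nuDensity a κ T x : ℂ) =
      ∫ t, ((κ (t / T) * rho a t : ℝ) : ℂ) * fourierInt F t := by
  simp only [nuDensity_eq_exp hκ hT, fourierInt, ← integral_const_mul]
  rw [integral_integral_swap]
  · refine integral_congr_ae (ae_of_all _ fun t => integral_congr_ae (ae_of_all _ fun x => ?_))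
    simp only; ring
  · have h := (hF.mul_prod (integrable_cutoff_rho (a := a) hκ hT).ofReal)
    refine (h.mul_bdd (c := 1) (g := fun p : ℝ × ℝ =>
      Complex.exp (Complex.I * (p.2 : ℂ) * (p.1 : ℂ))) ?_ (ae_of_all _ fun p => ?_)).congr
      (ae_of_all _ fun p => ?_)
    · exact Continuous.aestronglyMeasurable (by fun_prop)
    · rw [Complex.norm_exp]; simp
    · simp only [Function.uncurry, RCLike.ofReal, Complex.coe_algebraMap]
      ring

lemma tendsto_cutoff (hκ : IsCutoff κ) (t : ℝ) :
    Tendsto (fun T : ℝ => κ (t / T)) atTop (𝓝 1) := by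
  have h : Tendsto (fun T : ℝ => t / T) atTop (𝓝 0) := tendsto_const_nhds.div_atTop tendsto_id
  have := (hκ.smooth.continuous.tendsto 0).comp h
  rwa [hκ.one] at this

lemma hasNuIntegral (ha : 0 < a) {F : ℝ → ℂ} (hF : Integrable F)
    (hF' : Integrable fun t : ℝ => fourierInt F t * (rho a t : ℂ)) :
    HasNuIntegral a F (∫ t : ℝ, fourierInt F t * (rho a t : ℂ)) := by
  intro κ hκ
  refine ⟨fun T hT => integrable_mul_nuDensity ha hκ hT hF, ?_⟩
  obtain ⟨B, hB⟩ := hκ.compact.exists_bound_of_continuous hκ.smooth.continuous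
  have h : Tendsto (fun T : ℝ => ∫ t, (κ (t / T) : ℂ) * (fourierInt F t * (rho a t : ℂ))) atTop
      (𝓝 (∫ t : ℝ, fourierInt F t * (rho a t : ℂ))) := by
    refine tendsto_integral_filter_of_dominated_convergence
      (fun t => B * ‖fourierInt F t * (rho a t : ℂ)‖) ?_ ?_ (hF'.norm.const_mul B) ?_
    · filter_upwards [eventually_gt_atTop 0] with T hT
      exact (Complex.continuous_ofReal.comp
        (hκ.scaled hT).smooth.continuous).aestronglyMeasurable.mul hF'.1
    · refine Eventually.of_forall fun T => ae_of_all _ fun t => ?_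
      rw [norm_mul, Complex.norm_real]
      exact mul_le_mul_of_nonneg_right (hB _) (norm_nonneg _)
    · refine ae_of_all _ fun t => ?_
      have := ((Complex.continuous_ofReal.tendsto 1).comp (tendsto_cutoff hκ t)).mul_const
        (fourierInt F t * (rho a t : ℂ))
      simpa using this
  refine h.congr' ?_
  filter_upwards [eventually_gt_atTop 0] with T hT
  rw [integral_mul_nuDensity hκ hT hF]
  refine integral_congr_ae (ae_of_all _ fun t => ?_)
  push_cast; ring

/-! ### The effective multiplier -/

/-- The Gaussian profile of the coherent states. -/
def profile (s x : ℝ) : ℝ := Real.sqrt (2 * Real.pi) * Real.exp (-2 * (x - s / 2) ^ 2)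

lemma integrable_profile (s : ℝ) : Integrable (profile s) := by
  have := (integrable_exp_neg_mul_sq (b := 2) (by norm_num)).comp_sub_right (s / 2)
  exact this.const_mul _

/-- The factor $e^{-t^2/8}$ is the exact reciprocal of the Gaussian growth in `rho`; this
cancellation dictates the choice of the measure. -/
lemma fourierInt_profile (s t : ℝ) : fourierInt (fun x => (profile s x : ℂ)) t =
    ((Real.pi * Real.exp (-(t ^ 2) / 8) : ℝ) : ℂ) *
      Complex.exp (Complex.I * (t : ℂ) * ((s / 2 : ℝ) : ℂ)) := by
  have h : ∀ x : ℝ, Complex.exp (Complex.I * (t : ℂ) * (x : ℂ)) * (profile s x : ℂ) =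
      (Real.sqrt (2 * Real.pi) : ℂ) * Complex.exp ((-2 : ℂ) * (x : ℂ) ^ 2 +
        (2 * s + Complex.I * t) * x + (-(s : ℂ) ^ 2 / 2)) := fun x => by
    rw [profile]
    push_cast
    rw [mul_left_comm, ← Complex.exp_add]
    congr 2
    ring
  rw [fourierInt]
  simp only [h]
  rw [integral_const_mul, integral_cexp_quadratic (by simp)]
  have h1 : ((Real.pi : ℂ) / -(-2)) ^ (1 / 2 : ℂ) = (Real.sqrt (Real.pi / 2) : ℂ) := by
    rw [Real.sqrt_eq_rpow, Complex.ofReal_cpow (by positivity)]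
    push_cast
    norm_num
  rw [h1, ← mul_assoc, ← Complex.ofReal_mul, ← Real.sqrt_mul (by positivity)]
  have h2 : 2 * Real.pi * (Real.pi / 2) = Real.pi ^ 2 := by ring
  rw [h2, Real.sqrt_sq Real.pi_pos.le]
  push_cast
  rw [mul_assoc, ← Complex.exp_add]
  congr 2
  linear_combination ((t : ℂ) ^ 2 / 8) * Complex.I_sq

/-- The multiplier `q² ∫ ν_T(x) profile(s, x) dx`. -/
def multiplier (a : ℝ) (κ : ℝ → ℝ) (T s : ℝ) : ℝ :=
  weight a s ^ 2 * ∫ t, κ (t / T) / (2 * a) * Real.exp (-a * |t|) * Real.cos (t * (s / 2))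

lemma weight_sq_mul_integral_profile (ha : 0 < a) (hκ : IsCutoff κ) (hT : 0 < T) (s : ℝ) :
    ((weight a s ^ 2 : ℝ) : ℂ) * ∫ x, (profile s x : ℂ) * (nuDensity a κ T x : ℂ) =
      multiplier a κ T s := by
  have hF : Integrable fun x => (profile s x : ℂ) := (integrable_profile s).ofReal
  rw [integral_mul_nuDensity hκ hT hF, multiplier, Complex.ofReal_mul,
    ← integral_even_mul_exp (k := fun t => κ (t / T) / (2 * a) * Real.exp (-a * |t|))]
  · congr 1
    refine integral_congr_ae (ae_of_all _ fun t => ?_)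
    simp only
    rw [fourierInt_profile, ← mul_assoc, ← Complex.ofReal_mul]
    congr 2
    rw [rho_eq]
    have h0 : Real.exp (t ^ 2 / 8) * Real.exp (-t ^ 2 / 8) = 1 := by
      rw [← Real.exp_add, ← Real.exp_zero]; congr 1; ring
    have h1 : Real.pi * (2 * Real.pi * a)⁻¹ = (2 * a)⁻¹ := by field_simp
    rw [div_eq_mul_inv _ (2 * Real.pi * a), div_eq_mul_inv _ (2 * a), ← h1]
    linear_combination κ (t / T) * Real.exp (-a * |t|) * (Real.pi * (2 * Real.pi * a)⁻¹) * h0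
  · simp only [div_eq_mul_inv (b := 2 * a)]
    refine Continuous.integrable_of_hasCompactSupport ?_
      (hκ.scaled hT).compact.mul_right.mul_right
    exact ((hκ.scaled hT).smooth.continuous.mul continuous_const).mul (by fun_prop)
  · intro t
    rw [(hκ.scaled hT).even, abs_neg]

/-- In `sq_add_sq_mul_integral_cos` at frequency $s/2$ the prefactor is exactly the squared weight.
The boundary term is $2a\,\kappa(0)/(2a)=1$, and the remainder contains only derivatives of
$\kappa(t/T)$, each with a factor $1/T$. Uniformity in $s$ follows from $|\cos|\le1$. -/
lemma exists_multiplier_sub_one_le (ha : 0 < a) (hκ : IsCutoff κ) :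
    ∃ C, ∀ T, 1 ≤ T → ∀ s, |multiplier a κ T s - 1| ≤ C / T := by
  have hs' := hκ.compact.deriv
  have hs'' := hs'.deriv
  obtain ⟨B1, hB1⟩ := hs'.exists_bound_of_continuous hκ.smooth_deriv.continuous
  obtain ⟨B2, hB2⟩ := hs''.exists_bound_of_continuous hκ.continuous_deriv2
  have hB10 : 0 ≤ B1 := (norm_nonneg _).trans (hB1 0)
  have hB20 : 0 ≤ B2 := (norm_nonneg _).trans (hB2 0)
  refine ⟨2 * ((B2 / (2 * a) + 2 * a * (B1 / (2 * a))) / a), fun T hT s => ?_⟩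
  have hT0 : 0 < T := by linarith
  have hdiv : ∀ t : ℝ, HasDerivAt (fun t => t / T) (1 / T) t := fun t =>
    (hasDerivAt_id t).div_const T
  have key := sq_add_sq_mul_integral_cos (g := fun t => κ (t / T) / (2 * a))
    (g' := fun t => deriv κ (t / T) * (1 / T) / (2 * a))
    (g'' := fun t => deriv (deriv κ) (t / T) * (1 / T) * (1 / T) / (2 * a))
    (fun t => ((hκ.hasDerivAt (t / T)).comp t (hdiv t)).div_const (2 * a))
    (fun t => (((hκ.hasDerivAt_deriv (t / T)).comp t (hdiv t)).mul_const (1 / T)).div_const (2 * a))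
    (by have := hκ.continuous_deriv2; fun_prop)
    (by
      simp only [div_eq_mul_inv (b := 2 * a)]
      exact (hκ.scaled hT0).compact.mul_right)
    (fun t => by rw [(hκ.scaled hT0).even]) a (s / 2)
  have hw : weight a s ^ 2 = a ^ 2 + (s / 2) ^ 2 := by rw [weight_sq]; ring
  rw [multiplier, hw, key, zero_div, hκ.one]
  have e : 2 * a * (1 / (2 * a)) = 1 := by field_simp
  rw [e, sub_sub_cancel_left, abs_neg, abs_mul, abs_two, mul_div_assoc, div_right_comm]
  refine mul_le_mul_of_nonneg_left ?_ (by norm_num)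
  refine norm_integral_Ioi_exp_le ha (fun t => ?_) (s / 2)
  refine (abs_sub _ _).trans ?_
  -- The second derivative contributes $1/T^2$, reduced to $1/T$ by $T\ge1$.
  have hTi : 1 / T ≤ 1 := by rw [div_le_one hT0]; exact hT
  have hTp : 0 < 1 / T := by positivity
  have b1 := hB1 (t / T)
  have b2 := hB2 (t / T)
  rw [Real.norm_eq_abs] at b1 b2
  have e1 : |deriv (deriv κ) (t / T) * (1 / T) * (1 / T) / (2 * a)| ≤ B2 / (2 * a) * (1 / T) := by
    rw [abs_div, abs_mul _ (1 / T), abs_mul _ (1 / T), abs_of_pos hTp,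
      abs_of_pos (show 0 < 2 * a by positivity)]
    calc |deriv (deriv κ) (t / T)| * (1 / T) * (1 / T) / (2 * a)
        ≤ B2 * (1 / T) * 1 / (2 * a) := by gcongr
      _ = _ := by ring
  have e2 : |2 * a * (deriv κ (t / T) * (1 / T) / (2 * a))| ≤
      2 * a * (B1 / (2 * a)) * (1 / T) := by
    rw [abs_mul (2 * a), abs_div _ (2 * a), abs_mul _ (1 / T), abs_of_pos hTp,
      abs_of_pos (show 0 < 2 * a by positivity)]
    calc 2 * a * (|deriv κ (t / T)| * (1 / T) / (2 * a))
        ≤ 2 * a * (B1 * (1 / T) / (2 * a)) := by gcongr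
      _ = _ := by ring
  refine (add_le_add e1 e2).trans_eq ?_
  ring

end

/-! ### The Plancherel identity -/

section

open FourierTransform SchwartzMap

lemma continuous_fourier_of_integrable {U : ℝ → ℂ} (hU : Integrable U) : Continuous (𝓕 U) :=
  VectorFourier.fourierIntegral_continuous Real.continuous_fourierChar
    (L := innerₗ ℝ) continuous_inner hU

lemma integral_fourier_mul_flip {f g : ℝ → ℂ} (hf : Integrable f) (hg : Integrable g) :
    ∫ ξ, 𝓕 f ξ * g ξ = ∫ x, f x * 𝓕 g x := by
  simpa using! VectorFourier.integral_bilin_fourierIntegral_eq_flip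
    (ContinuousLinearMap.mul ℂ ℂ) (L := innerₗ ℝ)
    Real.continuous_fourierChar continuous_inner hf hg

/-- On `L¹ ∩ L²` the Fourier transform of `L²` is the Fourier integral. -/
lemma coeFn_fourier_toLp {U : ℝ → ℂ} (h1 : Integrable U) (h2 : MemLp U 2 volume) :
    ((𝓕 (h2.toLp U : L2) : L2) : ℝ → ℂ) =ᵐ[volume] 𝓕 U := by
  refine ae_eq_of_integral_contDiff_smul_eq ((Lp.memLp _).locallyIntegrable (by norm_num))
    (continuous_fourier_of_integrable h1).locallyIntegrable fun g hg hs => ?_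
  have hg₁ : HasCompactSupport (Complex.ofRealCLM ∘ g) := hs.comp_left rfl
  have hg₂ : ContDiff ℝ ∞ (Complex.ofRealCLM ∘ g) := by fun_prop
  set G : 𝓢(ℝ, ℂ) := hg₁.toSchwartzMap hg₂ with hG
  -- Both candidates are compared as tempered distributions, where the Fourier transform is moved
  -- onto the test function.
  have e1 : ∫ x, g x • (𝓕 (h2.toLp U : L2) : L2) x =
      Lp.toTemperedDistribution (𝓕 (h2.toLp U : L2)) G := by
    rw [Lp.toTemperedDistribution_apply]
    rfl
  rw [e1, ← Lp.fourier_toTemperedDistribution_eq, TemperedDistribution.fourier_apply,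
    Lp.toTemperedDistribution_apply]
  have e2 : ∫ x, (𝓕 G) x • (h2.toLp U : L2) x = ∫ x, 𝓕 (G : ℝ → ℂ) x * U x := by
    refine integral_congr_ae ?_
    filter_upwards [h2.coeFn_toLp] with x hx
    rw [hx, smul_eq_mul]; rfl
  rw [e2, integral_fourier_mul_flip G.integrable h1]
  rfl

lemma integral_conj_fourier_mul_fourier {U V : ℝ → ℂ} (hU : Integrable U)
    (hU2 : MemLp U 2 volume) (hV : Integrable V) (hV2 : MemLp V 2 volume) :
    ∫ ξ, (starRingEnd ℂ) (𝓕 U ξ) * 𝓕 V ξ = ∫ x, (starRingEnd ℂ) (U x) * V x := by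
  have h := Lp.inner_fourier_eq (hU2.toLp U : L2) (hV2.toLp V)
  rw [inner_eq_integral, ← toL2_eq hU2, ← toL2_eq hV2, inner_toL2 hU2 hV2] at h
  rw [← h]
  refine integral_congr_ae ?_
  rw [toL2_eq hU2, toL2_eq hV2]
  filter_upwards [coeFn_fourier_toLp hU hU2, coeFn_fourier_toLp hV hV2] with x h1 h2
  rw [h1, h2]

lemma memLp_fourier {U : ℝ → ℂ} (hU : Integrable U) (hU2 : MemLp U 2 volume) :
    MemLp (𝓕 U) 2 volume :=
  (Lp.memLp _).ae_eq (coeFn_fourier_toLp hU hU2)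

lemma fourierInt_eq (U : ℝ → ℂ) (y : ℝ) : fourierInt U y = 𝓕 U (y * (-(2 * Real.pi)⁻¹)) := by
  rw [Real.fourier_real_eq_integral_exp_smul, fourierInt]
  refine integral_congr_ae (ae_of_all _ fun x => ?_)
  simp only [smul_eq_mul]
  congr 2
  push_cast
  have : (Real.pi : ℂ) ≠ 0 := by exact_mod_cast Real.pi_ne_zero
  field_simp

lemma continuous_fourierInt {U : ℝ → ℂ} (hU : Integrable U) : Continuous (fourierInt U) := by
  rw [funext (fourierInt_eq U)]
  exact (continuous_fourier_of_integrable hU).comp (by fun_prop)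

/-- Plancherel for the normalization $\int e^{iyx}$; the constant $2\pi$ is the Jacobian of the
change of frequency. -/
lemma integral_conj_fourierInt_mul {U V : ℝ → ℂ} (hU : Integrable U)
    (hU2 : MemLp U 2 volume) (hV : Integrable V) (hV2 : MemLp V 2 volume) :
    ∫ y, (starRingEnd ℂ) (fourierInt U y) * fourierInt V y =
      ((2 * Real.pi : ℝ) : ℂ) * ∫ x, (starRingEnd ℂ) (U x) * V x := by
  simp only [fourierInt_eq]
  rw [Measure.integral_comp_mul_right
    (fun ξ => (starRingEnd ℂ) (𝓕 U ξ) * 𝓕 V ξ), integral_conj_fourier_mul_fourier hU hU2 hV hV2]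
  rw [inv_neg, inv_inv, abs_neg, abs_of_pos (by positivity)]
  simp

lemma memLp_fourierInt {U : ℝ → ℂ} (hU : Integrable U) (hU2 : MemLp U 2 volume) :
    MemLp (fourierInt U) 2 volume := by
  rw [memLp_two_iff_integrable_sq_norm (continuous_fourierInt hU).aestronglyMeasurable]
  simp only [fourierInt_eq]
  have h := (memLp_two_iff_integrable_sq_norm
    (continuous_fourier_of_integrable hU).aestronglyMeasurable).1 (memLp_fourier hU hU2)
  exact h.comp_mul_right' (by simp [Real.pi_ne_zero])

end

/-! ### Integration over the plane -/

lemma integrable_shear {k : ℝ → ℂ} (hk : Integrable k) :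
    Integrable (fun p : ℝ × ℝ => k p.2 * (Real.exp (-(p.1 - p.2 / 2) ^ 2) : ℂ))
      (volume.prod volume) := by
  have hmeas : AEStronglyMeasurable
      (fun p : ℝ × ℝ => k p.2 * (Real.exp (-(p.1 - p.2 / 2) ^ 2) : ℂ)) (volume.prod volume) := by
    refine (hk.1.comp_snd).mul (Continuous.aestronglyMeasurable ?_)
    fun_prop
  have hg : ∀ s : ℝ, Integrable fun x : ℝ => Real.exp (-(x - s / 2) ^ 2) := fun s => by
    have := (integrable_exp_neg_mul_sq (b := 1) (by norm_num)).comp_sub_right (s / 2)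
    simpa using this
  rw [integrable_prod_iff' hmeas]
  refine ⟨ae_of_all _ fun s => (hg s).ofReal.const_mul (k s), ?_⟩
  have : ∀ s, ∫ x, ‖k s * (Real.exp (-(x - s / 2) ^ 2) : ℂ)‖ =
      ‖k s‖ * ∫ x : ℝ, Real.exp (-x ^ 2) := fun s => by
    rw [← integral_sub_right_eq_self (fun x : ℝ => Real.exp (-x ^ 2)) (s / 2),
      ← integral_const_mul]
    refine integral_congr_ae (ae_of_all _ fun x => ?_)
    simp only
    rw [norm_mul, Complex.norm_real, Real.norm_eq_abs, abs_of_pos (Real.exp_pos _)]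
  simp only [this]
  exact hk.norm.mul_const _

section

variable {a : ℝ} {κ : ℝ → ℝ} {T : ℝ}

/-- With $u=x-s/2$ the squared weight is $(x-u)^2+a^2\le(a^2+2)(1+x^2)(1+u^2)$. The quadratic decay
of the density cancels $1+x^2$, and half of the Gaussian in $u$ absorbs $1+u^2$. This is where the
absolute convergence over the plane comes from. -/
lemma exists_weighted_profile_le (ha : 0 < a) (hκ : IsCutoff κ) (hT : 0 < T) :
    ∃ C, ∀ x s, |weight a s ^ 2 * profile s x * nuDensity a κ T x| ≤
      C * Real.exp (-(x - s / 2) ^ 2) := by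
  obtain ⟨C, hC, h⟩ := exists_nuDensity_le ha hκ hT
  refine ⟨(a ^ 2 + 2) * Real.sqrt (2 * Real.pi) * C, fun x s => ?_⟩
  set u := x - s / 2 with hu
  have h1 : weight a s ^ 2 ≤ (a ^ 2 + 2) * ((1 + x ^ 2) * (1 + u ^ 2)) := by
    rw [weight_sq]
    have : s = 2 * (x - u) := by rw [hu]; ring
    rw [this]
    nlinarith [sq_nonneg (x + u), mul_nonneg (sq_nonneg x) (sq_nonneg u), sq_nonneg x, sq_nonneg u,
      mul_nonneg (sq_nonneg a) (sq_nonneg x), mul_nonneg (sq_nonneg a) (sq_nonneg u),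
      mul_nonneg (sq_nonneg a) (mul_nonneg (sq_nonneg x) (sq_nonneg u))]
  have h2 : (1 + u ^ 2) * Real.exp (-2 * u ^ 2) ≤ Real.exp (-u ^ 2) := by
    have : Real.exp (-u ^ 2) = Real.exp (u ^ 2) * Real.exp (-2 * u ^ 2) := by
      rw [← Real.exp_add]; ring_nf
    rw [this]
    have := Real.add_one_le_exp (u ^ 2)
    gcongr
    linarith
  have h3 := h x
  rw [abs_mul, abs_of_nonneg (by unfold profile; positivity), profile]
  calc weight a s ^ 2 * (Real.sqrt (2 * Real.pi) * Real.exp (-2 * u ^ 2)) * |nuDensity a κ T x|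
      ≤ ((a ^ 2 + 2) * ((1 + x ^ 2) * (1 + u ^ 2))) *
        (Real.sqrt (2 * Real.pi) * Real.exp (-2 * u ^ 2)) * (C * (1 + x ^ 2)⁻¹) := by gcongr
    _ = (a ^ 2 + 2) * Real.sqrt (2 * Real.pi) * C * ((1 + u ^ 2) * Real.exp (-2 * u ^ 2)) *
        ((1 + x ^ 2) * (1 + x ^ 2)⁻¹) := by ring
    _ = (a ^ 2 + 2) * Real.sqrt (2 * Real.pi) * C * ((1 + u ^ 2) * Real.exp (-2 * u ^ 2)) := by
        rw [mul_inv_cancel₀ (by positivity), mul_one]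
    _ ≤ _ := by gcongr

lemma integrable_weighted_profile (ha : 0 < a) (hκ : IsCutoff κ) (hT : 0 < T) {k : ℝ → ℂ}
    (hk : Integrable k) :
    Integrable (fun p : ℝ × ℝ => k p.2 *
      ((weight a p.2 ^ 2 * profile p.2 p.1 * nuDensity a κ T p.1 : ℝ) : ℂ))
      (volume.prod volume) := by
  obtain ⟨C, hC⟩ := exists_weighted_profile_le ha hκ hT
  refine ((integrable_shear hk).const_mul (C : ℂ)).mono ?_ (ae_of_all _ fun p => ?_)
  · refine (hk.1.comp_snd).mul (Continuous.aestronglyMeasurable ?_)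
    have h1 := continuous_weight a
    have h2 := continuous_nuDensity (a := a) hκ hT
    unfold profile
    fun_prop
  · have h0 := hC p.1 p.2
    have hC0 : C * Real.exp (-(p.1 - p.2 / 2) ^ 2) =
        ‖(C : ℂ) * (Real.exp (-(p.1 - p.2 / 2) ^ 2) : ℂ)‖ := by
      rw [← Complex.ofReal_mul, Complex.norm_real, Real.norm_eq_abs, abs_of_nonneg]
      exact (abs_nonneg _).trans h0
    rw [mul_left_comm, norm_mul, norm_mul (k p.2), ← hC0, Complex.norm_real, Real.norm_eq_abs]
    gcongr

/-- The windowed amplitude whose Fourier integral is `⟨w, q e_z⟩`. -/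
def window (a : ℝ) (w : L2) (x s : ℝ) : ℂ :=
  (starRingEnd ℂ) (w s) * ((weight a s : ℂ) * (Real.exp (-(s / 2 - x) ^ 2) : ℂ))

lemma gaussDecay_window_factor (a x : ℝ) :
    GaussDecay fun s => (weight a s : ℂ) * (Real.exp (-(s / 2 - x) ^ 2) : ℂ) := by
  refine GaussDecay.weight_mul ?_ a
  have h := GaussDecay.exp_quadratic (b := -1 / 4) (by norm_num) x (-(x : ℂ) ^ 2)
  convert h using 2 with s
  push_cast
  congr 1
  ring

lemma integrable_window (a : ℝ) (w : L2) (x : ℝ) : Integrable (window a w x) :=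
  integrable_mul_of_memLp (memLp_conj (Lp.memLp w)) (gaussDecay_window_factor a x).memLp

lemma memLp_window (a : ℝ) (w : L2) (x : ℝ) : MemLp (window a w x) 2 volume := by
  obtain ⟨hc, C, δ, hδ, h⟩ := gaussDecay_window_factor a x
  have hC : 0 ≤ C := by simpa using (norm_nonneg _).trans (h 0)
  have := memLp_bdd_mul (memLp_conj (Lp.memLp w)) hc.aestronglyMeasurable (C := C) fun s =>
    (h s).trans (mul_le_of_le_one_right hC (Real.exp_le_one_iff.2 (by nlinarith [sq_nonneg s])))
  convert this using 2 with s
  rw [window, mul_comm]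

/-- The normalization constant `(2π)^(-1/4)`. -/
def vacNorm : ℝ := (2 * Real.pi) ^ (-(1 / 4) : ℝ)

lemma vacNorm_sq : vacNorm ^ 2 * (2 * Real.pi) = Real.sqrt (2 * Real.pi) := by
  have h : (0 : ℝ) < 2 * Real.pi := by positivity
  rw [vacNorm, ← Real.rpow_natCast, ← Real.rpow_mul h.le, Real.sqrt_eq_rpow]
  nth_rewrite 2 [← Real.rpow_one (2 * Real.pi)]
  rw [← Real.rpow_add h]
  norm_num

/-- The state is a Gaussian in $s$ centred at $2x$ and modulated with frequency $y$, so inner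
products with it are windowed Fourier integrals in $y$. The phase $e^{-ixy}$ cancels in products
with a conjugate. -/
lemma packet_eq (x y s : ℝ) : packet (⟨x, y⟩ : ℂ) s =
    (vacNorm : ℂ) * Complex.exp (-(Complex.I * x * y)) *
      (Complex.exp (Complex.I * y * s) * (Real.exp (-(s / 2 - x) ^ 2) : ℂ)) := by
  have hz : (⟨x, y⟩ : ℂ) = x + y * Complex.I := Complex.mk_eq_add_mul_I x y
  have hn : ‖(⟨x, y⟩ : ℂ)‖ ^ 2 = x ^ 2 + y ^ 2 := by
    rw [← Complex.normSq_eq_norm_sq, Complex.normSq_apply]; ring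
  have hw : width 0 = 1 := by simp [width]
  rw [packet, psiZ_eq, Phi_I_mul, Phi, hn, psiVac_eq, hw, twist_zero, slope_zero, hz, vacNorm]
  simp only [Complex.one_cpow, mul_one]
  push_cast
  have e : ∀ c A B D : ℂ, Complex.exp A * (c * Complex.exp B * Complex.exp D) =
      c * Complex.exp (A + B + D) := fun c A B D => by rw [Complex.exp_add, Complex.exp_add]; ring
  have e' : ∀ c A B D : ℂ, c * Complex.exp A * (Complex.exp B * Complex.exp D) =
      c * Complex.exp (A + B + D) := fun c A B D => by rw [Complex.exp_add, Complex.exp_add]; ring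
  rw [e, e']
  congr 2
  linear_combination (-(s : ℂ) * (x + y * Complex.I) + (x ^ 2 + 2 * x * y * Complex.I + y ^ 2 * (Complex.I ^ 2 - 1)) / 2) * Complex.I_sq

lemma inner_wpacket (w : L2) (x y : ℝ) : inner ℂ w (wpacket a (⟨x, y⟩ : ℂ)) =
    (vacNorm : ℂ) * Complex.exp (-(Complex.I * x * y)) * fourierInt (window a w x) y := by
  rw [wpacket, inner_toL2_right _ (hasSum_wpacket a _).1, fourierInt, ← integral_const_mul]
  refine integral_congr_ae (ae_of_all _ fun s => ?_)
  simp only [packet_eq, window]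
  ring

lemma inner_mul_inner_wpacket (w₁ w₂ : L2) (x y : ℝ) :
    inner ℂ w₁ (wpacket a (⟨x, y⟩ : ℂ)) * inner ℂ (wpacket a (⟨x, y⟩ : ℂ)) w₂ =
    ((vacNorm ^ 2 : ℝ) : ℂ) *
      ((starRingEnd ℂ) (fourierInt (window a w₂ x) y) * fourierInt (window a w₁ x) y) := by
  rw [← inner_conj_symm (wpacket a (⟨x, y⟩ : ℂ)) w₂, inner_wpacket, inner_wpacket]
  have h : Complex.exp (-(Complex.I * x * y)) *
      (starRingEnd ℂ) (Complex.exp (-(Complex.I * x * y))) = 1 := by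
    rw [← Complex.exp_conj, ← Complex.exp_add, ← Complex.exp_zero]
    congr 1
    simp
  simp only [map_mul, Complex.conj_ofReal]
  push_cast
  linear_combination ((vacNorm : ℂ) ^ 2 * ((starRingEnd ℂ) (fourierInt (window a w₂ x) y) *
    fourierInt (window a w₁ x) y)) * h

lemma integrable_inner_mul_inner_wpacket (w₁ w₂ : L2) (x : ℝ) :
    Integrable fun y : ℝ => inner ℂ w₁ (wpacket a (⟨x, y⟩ : ℂ)) *
      inner ℂ (wpacket a (⟨x, y⟩ : ℂ)) w₂ := by
  simp only [inner_mul_inner_wpacket]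
  exact (integrable_mul_of_memLp
    (memLp_conj (memLp_fourierInt (integrable_window a w₂ x) (memLp_window a w₂ x)))
    (memLp_fourierInt (integrable_window a w₁ x) (memLp_window a w₁ x))).const_mul _

/-- Plancherel in $y$ at fixed $x$. The constant $2\pi\cdot(2\pi)^{-1/2}$ becomes the factor
$\sqrt{2\pi}$ of `profile`, and the square of the window its Gaussian. -/
lemma integral_inner_mul_inner_wpacket (w₁ w₂ : L2) (x : ℝ) :
    ∫ y : ℝ, inner ℂ w₁ (wpacket a (⟨x, y⟩ : ℂ)) * inner ℂ (wpacket a (⟨x, y⟩ : ℂ)) w₂ =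
      ∫ s, (starRingEnd ℂ) (w₁ s) * w₂ s * ((weight a s ^ 2 * profile s x : ℝ) : ℂ) := by
  simp only [inner_mul_inner_wpacket]
  rw [integral_const_mul, integral_conj_fourierInt_mul (integrable_window a w₂ x)
    (memLp_window a w₂ x) (integrable_window a w₁ x) (memLp_window a w₁ x), ← mul_assoc,
    ← Complex.ofReal_mul, vacNorm_sq, ← integral_const_mul]
  refine integral_congr_ae (ae_of_all _ fun s => ?_)
  have h : Real.exp (-(s / 2 - x) ^ 2) * Real.exp (-(s / 2 - x) ^ 2) =
      Real.exp (-2 * (x - s / 2) ^ 2) := by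
    rw [← Real.exp_add]; ring_nf
  simp only [window, profile, ← h, map_mul, Complex.conj_ofReal, Complex.conj_conj]
  push_cast
  ring

end

/-! ### Integrability over the plane and removal of the cutoff. -/

section

variable {a : ℝ} {κ : ℝ → ℝ} {T : ℝ}

/-- A pointwise limit of continuous partial sums; measurability in $z$ suffices. -/
lemma measurable_inner_wpacket (w : L2) : Measurable fun z : ℂ => inner ℂ w (wpacket a z) := by
  have h : ∀ z : ℂ, HasSum (fun n : ℕ => (Phi z : ℂ) * (coef n : ℂ) * z ^ n * inner ℂ w (wosc a n))
      (inner ℂ w (wpacket a z)) := fun z => by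
    have := (hasSum_wpacket a z).2.mapL (innerSL ℂ w)
    simpa only [innerSL_apply_apply, inner_smul_right] using this
  have hP : Continuous fun z : ℂ => Phi z := by unfold Phi; fun_prop
  refine measurable_of_tendsto_metrizable (f := fun N z => ∑ n ∈ Finset.range N,
    (Phi z : ℂ) * (coef n : ℂ) * z ^ n * inner ℂ w (wosc a n)) (fun N => ?_)
    (tendsto_pi_nhds.2 fun z => (h z).tendsto_sum_nat)
  exact Continuous.measurable (by fun_prop)

/-- The integrand of the resolution of the identity, in real coordinates. -/
def planeIntegrand (a : ℝ) (κ : ℝ → ℝ) (T : ℝ) (w₁ w₂ : L2) (p : ℝ × ℝ) : ℂ :=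
  inner ℂ w₁ (wpacket a (⟨p.1, p.2⟩ : ℂ)) * inner ℂ (wpacket a (⟨p.1, p.2⟩ : ℂ)) w₂ *
    (nuDensity a κ T p.1 : ℂ)

lemma measurable_planeIntegrand (hκ : IsCutoff κ) (hT : 0 < T) (w₁ w₂ : L2) :
    Measurable (planeIntegrand a κ T w₁ w₂) := by
  have hm : Measurable fun p : ℝ × ℝ => (⟨p.1, p.2⟩ : ℂ) :=
    Complex.measurableEquivRealProd.symm.measurable
  have h1 := (measurable_inner_wpacket (a := a) w₁).comp hm
  have h2 := Complex.continuous_conj.measurable.comp ((measurable_inner_wpacket (a := a) w₂).comp hm)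
  have h3 : Measurable fun p : ℝ × ℝ => (nuDensity a κ T p.1 : ℂ) :=
    (Complex.continuous_ofReal.comp ((continuous_nuDensity hκ hT).comp continuous_fst)).measurable
  convert (h1.mul h2).mul h3 using 1
  funext p
  simp only [planeIntegrand, Pi.mul_apply, Function.comp]
  rw [inner_conj_symm]

/-- On the diagonal the integrand is a nonnegative function of $y$ times the signed density, so its
$L^1$ norm in $y$ is the modulus of its $y$-integral. That integral is known by Plancherel and is
integrable in $x$ by Fubini. -/
lemma integrable_planeIntegrand_self (ha : 0 < a) (hκ : IsCutoff κ) (hT : 0 < T) (w : L2) :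
    Integrable (planeIntegrand a κ T w w) (volume.prod volume) := by
  rw [integrable_prod_iff (measurable_planeIntegrand hκ hT w w).aestronglyMeasurable]
  refine ⟨ae_of_all _ fun x =>
    (integrable_inner_mul_inner_wpacket (a := a) w w x).mul_const (nuDensity a κ T x : ℂ), ?_⟩
  have hk : Integrable fun s => (starRingEnd ℂ) (w s) * w s :=
    integrable_mul_of_memLp (memLp_conj (Lp.memLp w)) (Lp.memLp w)
  have h := (integrable_weighted_profile ha hκ hT hk).integral_prod_left.norm
  refine h.congr (ae_of_all _ fun x => ?_)
  have e1 : ∀ y : ℝ, ‖planeIntegrand a κ T w w (x, y)‖ =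
      ‖inner ℂ w (wpacket a (⟨x, y⟩ : ℂ))‖ ^ 2 * |nuDensity a κ T x| := fun y => by
    rw [planeIntegrand, norm_mul, norm_mul, ← inner_conj_symm (wpacket a _) w, Complex.norm_conj,
      Complex.norm_real, Real.norm_eq_abs, sq]
  have e2 : ((∫ y : ℝ, ‖inner ℂ w (wpacket a (⟨x, y⟩ : ℂ))‖ ^ 2 : ℝ) : ℂ) =
      ∫ s, (starRingEnd ℂ) (w s) * w s * ((weight a s ^ 2 * profile s x : ℝ) : ℂ) := by
    rw [← integral_inner_mul_inner_wpacket, ← integral_complex_ofReal]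
    refine integral_congr_ae (ae_of_all _ fun y => ?_)
    simp only
    rw [← inner_conj_symm (wpacket a _) w, Complex.mul_conj']
    push_cast; rfl
  simp only [e1]
  rw [integral_mul_const]
  have e3 : ∫ s, (starRingEnd ℂ) (w s) * w s *
      ((weight a s ^ 2 * profile s x * nuDensity a κ T x : ℝ) : ℂ) =
      ((∫ y : ℝ, ‖inner ℂ w (wpacket a (⟨x, y⟩ : ℂ))‖ ^ 2 : ℝ) : ℂ) * nuDensity a κ T x := by
    rw [e2, ← integral_mul_const]
    refine integral_congr_ae (ae_of_all _ fun s => ?_)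
    push_cast; ring
  rw [e3, norm_mul, Complex.norm_real, Complex.norm_real, Real.norm_eq_abs, Real.norm_eq_abs,
    abs_of_nonneg (integral_nonneg fun y => by positivity)]

lemma integrable_planeIntegrand (ha : 0 < a) (hκ : IsCutoff κ) (hT : 0 < T) (w₁ w₂ : L2) :
    Integrable (planeIntegrand a κ T w₁ w₂) (volume.prod volume) := by
  refine ((integrable_planeIntegrand_self ha hκ hT w₁).norm.add
    (integrable_planeIntegrand_self ha hκ hT w₂).norm).mono'
    (measurable_planeIntegrand hκ hT w₁ w₂).aestronglyMeasurable (ae_of_all _ fun p => ?_)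
  simp only [planeIntegrand, Pi.add_apply, norm_mul]
  rw [← add_mul, ← inner_conj_symm _ w₂, ← inner_conj_symm _ w₁, Complex.norm_conj,
    Complex.norm_conj]
  refine mul_le_mul_of_nonneg_right ?_ (norm_nonneg _)
  -- Reduction to the diagonal through $|uv|\le|u|^2+|v|^2$.
  nlinarith [sq_nonneg (‖inner ℂ w₁ (wpacket a (⟨p.1, p.2⟩ : ℂ))‖ -
    ‖inner ℂ w₂ (wpacket a (⟨p.1, p.2⟩ : ℂ))‖), sq_nonneg ‖inner ℂ w₁ (wpacket a (⟨p.1, p.2⟩ : ℂ))‖,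
    sq_nonneg ‖inner ℂ w₂ (wpacket a (⟨p.1, p.2⟩ : ℂ))‖]

lemma multiplier_eq_integral (ha : 0 < a) (hκ : IsCutoff κ) (hT : 0 < T) (s : ℝ) :
    (multiplier a κ T s : ℂ) =
      ∫ x, ((weight a s ^ 2 * profile s x * nuDensity a κ T x : ℝ) : ℂ) := by
  rw [← weight_sq_mul_integral_profile ha hκ hT, ← integral_const_mul]
  refine integral_congr_ae (ae_of_all _ fun x => ?_)
  push_cast; ring

lemma integral_planeIntegrand (ha : 0 < a) (hκ : IsCutoff κ) (hT : 0 < T) (w₁ w₂ : L2) :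
    ∫ p, planeIntegrand a κ T w₁ w₂ p ∂(volume.prod volume) =
      ∫ s, (starRingEnd ℂ) (w₁ s) * w₂ s * (multiplier a κ T s : ℂ) := by
  have hk : Integrable fun s => (starRingEnd ℂ) (w₁ s) * w₂ s :=
    integrable_mul_of_memLp (memLp_conj (Lp.memLp w₁)) (Lp.memLp w₂)
  have hI := integrable_weighted_profile ha hκ hT hk
  rw [integral_prod _ (integrable_planeIntegrand ha hκ hT w₁ w₂)]
  have e1 : ∀ x, ∫ y, planeIntegrand a κ T w₁ w₂ (x, y) = ∫ s, (starRingEnd ℂ) (w₁ s) * w₂ s *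
      ((weight a s ^ 2 * profile s x * nuDensity a κ T x : ℝ) : ℂ) := fun x => by
    simp only [planeIntegrand]
    rw [integral_mul_const, integral_inner_mul_inner_wpacket, ← integral_mul_const]
    refine integral_congr_ae (ae_of_all _ fun s => ?_)
    push_cast; ring
  simp only [e1]
  rw [integral_integral_swap hI]
  refine integral_congr_ae (ae_of_all _ fun s => ?_)
  simp only
  rw [integral_const_mul, multiplier_eq_integral ha hκ hT]

lemma integrable_mul_multiplier (ha : 0 < a) (hκ : IsCutoff κ) (hT : 0 < T) {k : ℝ → ℂ}
    (hk : Integrable k) : Integrable fun s => k s * (multiplier a κ T s : ℂ) := by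
  refine (integrable_weighted_profile ha hκ hT hk).integral_prod_right.congr
    (ae_of_all _ fun s => ?_)
  simp only
  rw [integral_const_mul, multiplier_eq_integral ha hκ hT]

/-- The uniform estimate on the multiplier gives both the majorant $(C+1)|k|$ and the pointwise
limit. -/
lemma tendsto_integral_multiplier (ha : 0 < a) (hκ : IsCutoff κ) {k : ℝ → ℂ}
    (hk : Integrable k) :
    Tendsto (fun T => ∫ s, k s * (multiplier a κ T s : ℂ)) atTop (𝓝 (∫ s, k s)) := by
  obtain ⟨C, hC⟩ := exists_multiplier_sub_one_le ha hκ
  have hC0 : 0 ≤ C := by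
    have := (abs_nonneg _).trans (hC 1 le_rfl 0)
    simpa using this
  refine tendsto_integral_filter_of_dominated_convergence (fun s => ‖k s‖ * (C + 1)) ?_ ?_
    (hk.norm.mul_const _) (ae_of_all _ fun s => ?_)
  · filter_upwards [eventually_gt_atTop 0] with T hT
    exact (integrable_mul_multiplier ha hκ hT hk).1
  · filter_upwards [eventually_ge_atTop 1] with T hT
    refine ae_of_all _ fun s => ?_
    rw [norm_mul, Complex.norm_real, Real.norm_eq_abs]
    refine mul_le_mul_of_nonneg_left ?_ (norm_nonneg _)
    have h1 := hC T hT s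
    have h2 : C / T ≤ C := div_le_self hC0 hT
    have h3 := abs_add_le (multiplier a κ T s - 1) 1
    rw [sub_add_cancel, abs_one] at h3
    linarith
  · have h : Tendsto (fun T => multiplier a κ T s) atTop (𝓝 1) := by
      rw [tendsto_iff_dist_tendsto_zero]
      have h0 : Tendsto (fun T : ℝ => C / T) atTop (𝓝 0) :=
        tendsto_const_nhds.div_atTop tendsto_id
      refine squeeze_zero' (Eventually.of_forall fun T => dist_nonneg) ?_ h0
      filter_upwards [eventually_ge_atTop 1] with T hT
      rw [Real.dist_eq]; exact hC T hT s
    have := ((Complex.continuous_ofReal.tendsto 1).comp h).const_mul (k s)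
    simpa using this

/-- The resolution of the identity in the model space. -/
lemma hasMuIntegral_wpacket (ha : 0 < a) (w₁ w₂ : L2) :
    HasMuIntegral a (fun z => inner ℂ w₁ (wpacket a z) * inner ℂ (wpacket a z) w₂)
      (inner ℂ w₁ w₂) := by
  intro κ hκ
  have hmp := Complex.volume_preserving_equiv_real_prod
  have hF : ∀ T, (fun z : ℂ => inner ℂ w₁ (wpacket a z) * inner ℂ (wpacket a z) w₂ *
      (nuDensity a κ T z.re : ℂ)) =
      planeIntegrand a κ T w₁ w₂ ∘ Complex.measurableEquivRealProd := fun T => by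
    funext z
    simp [planeIntegrand, Complex.measurableEquivRealProd_apply]
  have hk : Integrable fun s => (starRingEnd ℂ) (w₁ s) * w₂ s :=
    integrable_mul_of_memLp (memLp_conj (Lp.memLp w₁)) (Lp.memLp w₂)
  refine ⟨fun T hT => ?_, ?_⟩
  · rw [hF, hmp.integrable_comp_emb Complex.measurableEquivRealProd.measurableEmbedding]
    exact integrable_planeIntegrand ha hκ hT w₁ w₂
  · have h := tendsto_integral_multiplier ha hκ hk
    rw [← inner_eq_integral] at h
    refine h.congr' ?_
    filter_upwards [eventually_gt_atTop 0] with T hT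
    rw [← integral_planeIntegrand ha hκ hT, hF]
    exact (hmp.integral_comp' (planeIntegrand a κ T w₁ w₂)).symm

lemma hasMuIntegral_phiZ (ha : 0 < a) (t : ℝ) {f g : L2} (hf : f ∈ solitonSpace a t)
    (hg : g ∈ solitonSpace a t) :
    HasMuIntegral a (fun z => inner ℂ f (toL2 (phiZ a z t)) * inner ℂ (toL2 (phiZ a z t)) g)
      (inner ℂ f g) := by
  obtain ⟨W, h1, h2⟩ := exists_model a t
  have h := hasMuIntegral_wpacket ha (W ⟨f, hf⟩) (W ⟨g, hg⟩)
  rw [h1] at h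
  convert h using 2 with z
  rw [h2, ← inner_conj_symm _ (W _), h2, inner_conj_symm]

end

/-! ### Fourier transforms and weak derivatives -/

section

open FourierTransform SchwartzMap

/-- A Fourier-side relation $\hat F_1=2\pi i\xi\hat F$ says that $F_1$ is the weak derivative of
$F$. The test function is written as the Fourier transform of a Schwartz function and the
multiplication formula is used twice. -/
lemma integral_mul_eq_neg_of_fourier {F₁ F : ℝ → ℂ} (h1 : Integrable F₁) (h2 : Integrable F)
    (h : ∀ ξ : ℝ, 𝓕 F₁ ξ = 2 * Real.pi * Complex.I * ξ * 𝓕 F ξ) {η : ℝ → ℂ}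
    (hη : ContDiff ℝ ∞ η) (hs : HasCompactSupport η) :
    ∫ x, F₁ x * η x = -∫ x, F x * deriv η x := by
  set E : 𝓢(ℝ, ℂ) := hs.toSchwartzMap hη with hE
  have hη' : ContDiff ℝ ∞ (deriv η) := (contDiff_infty_iff_deriv.1 hη).2
  set E' : 𝓢(ℝ, ℂ) := hs.deriv.toSchwartzMap hη' with hE'
  set g : 𝓢(ℝ, ℂ) := 𝓕⁻ E with hg
  set g' : 𝓢(ℝ, ℂ) := 𝓕⁻ E' with hg'
  have e1 : 𝓕 (g : ℝ → ℂ) = η := by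
    rw [← SchwartzMap.fourier_coe, hg, fourier_fourierInv_eq]; rfl
  have e2 : 𝓕 (g' : ℝ → ℂ) = deriv η := by
    rw [← SchwartzMap.fourier_coe, hg', fourier_fourierInv_eq]; rfl
  have e3 : ∀ ξ : ℝ, g' ξ = -(2 * Real.pi * Complex.I * ξ * g ξ) := fun ξ => by
    have k1 : g' ξ = 𝓕 (deriv η) (-ξ) := by
      rw [hg', SchwartzMap.fourierInv_coe, Real.fourierInv_eq_fourier_neg]; rfl
    have k2 : g ξ = 𝓕 η (-ξ) := by
      rw [hg, SchwartzMap.fourierInv_coe, Real.fourierInv_eq_fourier_neg]; rfl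
    rw [k1, k2, Real.fourier_deriv (f := η) E.integrable (hη.differentiable (by simp)) E'.integrable]
    simp
  have a1 := integral_fourier_mul_flip h1 g.integrable
  have a2 := integral_fourier_mul_flip h2 g'.integrable
  rw [e1] at a1
  rw [e2] at a2
  rw [← a1, ← a2, ← integral_neg]
  refine integral_congr_ae (ae_of_all _ fun ξ => ?_)
  simp only
  rw [h, e3]
  ring

end

lemma ae_eq_zero_of_fourier {F : ℝ → ℂ} (h1 : Integrable F)
    (h : ∀ ξ : ℝ, FourierTransform.fourier F ξ = 0) : F =ᵐ[volume] 0 := by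
  refine ae_eq_zero_of_integral_contDiff_smul_eq_zero h1.locallyIntegrable fun g hg hs => ?_
  have hs' : HasCompactSupport (Complex.ofRealCLM ∘ g) := hs.comp_left rfl
  have hg' : ContDiff ℝ ∞ (Complex.ofRealCLM ∘ g) := by fun_prop
  have h0 : ∀ ξ : ℝ, FourierTransform.fourier (fun _ : ℝ => (0 : ℂ)) ξ = (0 : ℂ) := fun ξ => by
    rw [Real.fourier_real_eq]; simp
  -- The case in which the primitive is zero: the pairing with every test function vanishes.
  have := integral_mul_eq_neg_of_fourier h1 (F := fun _ => 0) (by simp)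
    (fun ξ => by rw [h, h0, mul_zero]) hg' hs'
  simp only [zero_mul, integral_zero, neg_zero] at this
  rw [← this]
  refine integral_congr_ae (ae_of_all _ fun x => ?_)
  simp [mul_comm]

/-- A locally integrable function of vanishing weak derivative is constant. -/
lemma ae_eq_const_of_integral_deriv {F : ℝ → ℂ} (hF : LocallyIntegrable F)
    (h : ∀ v : ℝ → ℝ, ContDiff ℝ ∞ v → HasCompactSupport v → ∫ x, deriv v x • F x = 0) :
    ∃ c : ℂ, ∀ᵐ x, F x = c := by
  let b : ContDiffBump (0 : ℝ) := default
  set φ : ℝ → ℝ := b.normed volume with hφ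
  have φs : ContDiff ℝ ∞ φ := b.contDiff_normed
  have φc : HasCompactSupport φ := b.hasCompactSupport_normed
  have φ1 : ∫ x, φ x = 1 := b.integral_normed
  have hint : ∀ g : ℝ → ℝ, ContDiff ℝ ∞ g → HasCompactSupport g →
      Integrable fun x => g x • F x := fun g hg hs =>
    hF.integrable_smul_left_of_hasCompactSupport hg.continuous hs
  refine ⟨∫ x, φ x • F x, ?_⟩
  refine ae_eq_of_integral_contDiff_smul_eq hF (locallyIntegrable_const _) fun g hg hs => ?_
  have gi : Integrable g := hg.continuous.integrable_of_hasCompactSupport hs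
  have φi : Integrable φ := φs.continuous.integrable_of_hasCompactSupport φc
  set m := ∫ x, g x with hm
  -- Subtracting the mean along a fixed bump makes $k$ the derivative of a compactly supported
  -- function; this is du Bois-Reymond's argument.
  set k : ℝ → ℝ := fun x => g x - m * φ x with hk
  have ks : ContDiff ℝ ∞ k := hg.sub (contDiff_const.mul φs)
  have kc : HasCompactSupport k := hs.sub (φc.mul_left (f := fun _ => m))
  have ki : Integrable k := gi.sub (φi.const_mul m)
  have k0 : ∫ x, k x = 0 := by
    rw [integral_sub gi (φi.const_mul m), integral_const_mul, φ1]; simp [hm]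
  obtain ⟨R, hR⟩ := kc.isCompact.isBounded.subset_closedBall 0
  have hz : ∀ x, R < |x| → k x = 0 := fun x hx => by
    by_contra hne
    have := hR (subset_tsupport _ hne)
    rw [Metric.mem_closedBall, dist_zero_right, Real.norm_eq_abs] at this
    linarith
  set v : ℝ → ℝ := fun x => ∫ t in Set.Iic x, k t with hv
  have hv' : ∀ x, v x = v 0 + ∫ t in (0 : ℝ)..x, k t := fun x => by
    rw [intervalIntegral.integral_Iic_sub_Iic ki.integrableOn ki.integrableOn |>.symm]
    simp [hv]
  have vd : ∀ x, HasDerivAt v (k x) x := fun x => by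
    rw [funext hv']
    exact (intervalIntegral.integral_hasDerivAt_right (ki.intervalIntegrable)
      (ks.continuous.stronglyMeasurableAtFilter _ _) ks.continuous.continuousAt).const_add _
  have vd' : deriv v = k := funext fun x => (vd x).deriv
  have vs : ContDiff ℝ ∞ v := by
    rw [contDiff_infty_iff_deriv, vd']
    exact ⟨fun x => (vd x).differentiableAt, ks⟩
  have vc : HasCompactSupport v := by
    refine HasCompactSupport.of_support_subset_isCompact (isCompact_closedBall (0 : ℝ) |R|) ?_
    intro x hx
    by_contra hne
    rw [Metric.mem_closedBall, dist_zero_right, Real.norm_eq_abs, not_le] at hne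
    refine hx ?_
    rcases lt_or_ge x 0 with h0 | h0
    · refine setIntegral_eq_zero_of_forall_eq_zero fun t ht => hz t ?_
      rw [Set.mem_Iic] at ht
      rw [abs_of_neg h0] at hne
      rw [abs_of_neg (by linarith)]
      linarith [le_abs_self R]
    -- To the right of the support the primitive vanishes because $k$ has mean zero.
    · have : v x + ∫ t in Set.Ioi x, k t = 0 := by
        rw [← k0]; exact intervalIntegral.integral_Iic_add_Ioi ki.integrableOn ki.integrableOn
      rw [setIntegral_eq_zero_of_forall_eq_zero (t := Set.Ioi x) fun t ht => hz t ?_] at this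
      · simpa using this
      · rw [Set.mem_Ioi] at ht
        rw [abs_of_nonneg h0] at hne
        rw [abs_of_nonneg (by linarith)]
        linarith [le_abs_self R]
  have key := h v vs vc
  rw [vd'] at key
  have e : ∀ x, k x • F x = g x • F x - m • (φ x • F x) := fun x => by
    rw [hk, sub_smul, mul_smul]
  simp only [e] at key
  have hmi : Integrable fun x => m • (φ x • F x) := (hint φ φs φc).smul m
  rw [integral_sub (hint g hg hs) hmi, integral_smul, sub_eq_zero] at key
  rw [key, integral_smul_const]

/-! ### Completeness -/

lemma psiVac_ne_zero (t x : ℝ) : psiVac t x ≠ 0 := by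
  have h1 : (0 : ℝ) < (2 * Real.pi) ^ (-(1 / 4) : ℝ) := by positivity
  have h2 : (width t) ^ (-(1 / 2) : ℂ) ≠ 0 := by
    rw [Complex.cpow_ne_zero_iff]; exact Or.inl (width_ne_zero t)
  rw [psiVac_eq]
  exact mul_ne_zero (mul_ne_zero (Complex.ofReal_ne_zero.2 h1.ne') h2) (Complex.exp_ne_zero _)

lemma contDiff_psiVac (t : ℝ) : ContDiff ℝ ∞ (psiVac t) := by
  rw [funext (psiVac_eq t)]
  have : ContDiff ℝ ∞ fun x : ℝ => (x : ℂ) := Complex.ofRealCLM.contDiff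
  exact contDiff_const.mul (contDiff_const.mul (this.pow 2)).cexp

lemma slope_ne_zero (t : ℝ) : slope t ≠ 0 :=
  div_ne_zero (neg_ne_zero.2 Complex.I_ne_zero) (width_ne_zero t)

/-- The coherent state whose restriction to the real line is a plane wave times the vacuum. -/
lemma exists_psiZ_eq (t ξ : ℝ) : ∃ c : ℂ, c ≠ 0 ∧ ∃ z : ℂ,
    slope t * z = -(2 * Real.pi * Complex.I * ξ) ∧ ∀ x : ℝ, psiZ z t x =
      c * (psiVac t x * Complex.exp (((-2 * Real.pi * x * ξ : ℝ) : ℂ) * Complex.I)) := by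
  set z : ℂ := -(2 * Real.pi * Complex.I * ξ) / slope t with hz
  have hs : slope t * z = -(2 * Real.pi * Complex.I * ξ) := by
    rw [hz, mul_div_cancel₀ _ (slope_ne_zero t)]
  refine ⟨Phi z * Complex.exp (twist t / 2 * z ^ 2), mul_ne_zero ?_ (Complex.exp_ne_zero _), z, hs,
    fun x => ?_⟩
  · exact Complex.ofReal_ne_zero.2 (Real.exp_pos _).ne'
  · rw [psiZ_eq, Complex.exp_add]
    have : slope t * x * z = ((-2 * Real.pi * x * ξ : ℝ) : ℂ) * Complex.I := by
      push_cast
      linear_combination (x : ℂ) * hs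
    rw [this]; ring

lemma gaussDecay_psiVac (t : ℝ) : GaussDecay (psiVac t) := gaussDecay_psi t 0

lemma fourier_eq_integral (F : ℝ → ℂ) (ξ : ℝ) : FourierTransform.fourier F ξ =
    ∫ x : ℝ, F x * Complex.exp (((-2 * Real.pi * x * ξ : ℝ) : ℂ) * Complex.I) := by
  rw [Real.fourier_real_eq_integral_exp_smul]
  simp only [smul_eq_mul, mul_comm]

/-- A function orthogonal to all `osc` is orthogonal to all coherent states, among them every plane
wave times the vacuum. The Fourier transform of $\bar f\psi_0$ then vanishes, and $\psi_0$ has no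
zeros. -/
lemma orthogonal_osc (f : L2) (h : ∀ n, inner ℂ f (toL2 (osc n)) = 0) : f = 0 := by
  have hp : ∀ z, MemLp (packet z) 2 volume ∧ inner ℂ f (toL2 (packet z)) = 0 := fun z => by
    have h1 := hasSum_toL2_coef (C := 0) (fun n => (gaussDecay_osc n).memLp)
      (fun n => by rw [orthonormal_osc.1 n]; simp) (hasSum_packet z)
    refine ⟨h1.1, ?_⟩
    have h2 := h1.2.mapL (innerSL ℂ f)
    simp only [innerSL_apply_apply, inner_smul_right, h, mul_zero] at h2
    exact h2.unique hasSum_zero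
  set F : ℝ → ℂ := fun x => (starRingEnd ℂ) (f x) * psiVac 0 x with hF
  have hi : Integrable F :=
    integrable_mul_of_memLp (memLp_conj (Lp.memLp f)) (gaussDecay_psiVac 0).memLp
  have h0 : F =ᵐ[volume] 0 := by
    refine ae_eq_zero_of_fourier hi fun ξ => ?_
    obtain ⟨c, hc, z, -, hz⟩ := exists_psiZ_eq 0 ξ
    have hpk : packet (-Complex.I * z) = psiZ z 0 := by
      funext x
      rw [packet, ← mul_assoc, mul_neg, Complex.I_mul_I, neg_neg, one_mul]
    obtain ⟨k1, k2⟩ := hp (-Complex.I * z)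
    rw [hpk] at k1 k2
    rw [inner_toL2_right _ k1] at k2
    rw [fourier_eq_integral]
    refine (mul_eq_zero.1 ?_).resolve_left hc
    rw [← k2, ← integral_const_mul]
    refine integral_congr_ae (ae_of_all _ fun x => ?_)
    simp only [hF, hz]
    ring
  rw [Lp.eq_zero_iff_ae_eq_zero]
  filter_upwards [h0] with x hx
  have := (mul_eq_zero.1 hx).resolve_right (psiVac_ne_zero 0 x)
  simpa using this

/-- The Hermite functions as a Hilbert basis. -/
def oscBasis : HilbertBasis ℕ ℂ L2 :=
  HilbertBasis.mkOfOrthogonalEqBot orthonormal_osc (by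
    rw [Submodule.eq_bot_iff]
    intro f hf
    refine orthogonal_osc f fun n => ?_
    rw [Submodule.mem_orthogonal'] at hf
    exact hf _ (Submodule.subset_span ⟨n, rfl⟩))

lemma oscBasis_apply (n : ℕ) : oscBasis n = toL2 (osc n) := by
  simp [oscBasis]

/-! ### The orthogonal complement of the bound state -/

lemma memLp_boundState {a : ℝ} (ha : 0 < a) : MemLp (boundState a) 2 volume := by
  have hc : Continuous (boundState a) := by
    unfold boundState
    exact Complex.continuous_ofReal.comp (continuous_const.div (by fun_prop)
      fun x => (Real.cosh_pos _).ne')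
  rw [memLp_two_iff_integrable_sq_norm hc.aestronglyMeasurable]
  have h : Integrable fun x : ℝ => (a / 2) * (1 + (a * x) ^ 2)⁻¹ :=
    (integrable_inv_one_add_sq.comp_mul_left' ha.ne').const_mul _
  refine h.mono' (hc.norm.pow 2).aestronglyMeasurable (ae_of_all _ fun x => ?_)
  rw [boundState, Complex.norm_real, norm_pow, norm_norm, Real.norm_eq_abs, sq_abs, div_pow,
    Real.sq_sqrt (by positivity), div_eq_mul_inv]
  refine mul_le_mul_of_nonneg_left (inv_anti₀ (by positivity) ?_) (by positivity)
  rw [Real.cosh_sq]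
  have : (a * x) ^ 2 ≤ Real.sinh (a * x) ^ 2 := by
    rw [sq_le_sq]
    rw [Real.abs_sinh]
    exact Real.self_le_sinh_iff.2 (abs_nonneg _)
  linarith

lemma hasDerivAt_boundState (a x : ℝ) :
    HasDerivAt (boundState a) (-superpot a x * boundState a x) x := by
  have h0 : HasDerivAt (fun y : ℝ => a * y) a x := by
    simpa using (hasDerivAt_id x).const_mul a
  have h1 := ((hasDerivAt_const x (Real.sqrt (a / 2))).div h0.cosh (Real.cosh_pos _).ne').ofReal_comp
  refine h1.congr_deriv ?_
  rw [superpot, boundState, ← Complex.ofReal_neg, ← Complex.ofReal_mul, Real.tanh_eq_sinh_div_cosh]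
  congr 1
  have := (Real.cosh_pos (a * x)).ne'
  field_simp
  ring

/-- The bound state solves $b'=-a\tanh(ax)\,b$, that is $L^+b=0$; the integrand is the derivative of
$b\,\psi_n$. -/
lemma inner_boundState_phi {a : ℝ} (ha : 0 < a) (n : ℕ) (t : ℝ) :
    inner ℂ (toL2 (boundState a)) (toL2 (phi a n t)) = 0 := by
  rw [inner_toL2 (memLp_boundState ha) (gaussDecay_phi a n t).memLp]
  have cb : Continuous (boundState a) :=
    continuous_iff_continuousAt.2 fun x => (hasDerivAt_boundState a x).continuousAt
  have bb : ∀ x, ‖boundState a x‖ ≤ Real.sqrt (a / 2) := fun x => by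
    rw [boundState, Complex.norm_real, Real.norm_eq_abs, abs_of_nonneg
      (div_nonneg (Real.sqrt_nonneg _) (Real.cosh_pos _).le)]
    exact div_le_self (Real.sqrt_nonneg _) (Real.one_le_cosh _)
  have g1 := (gaussDecay_psiDeriv t n).bdd_mul cb bb
  have g2 := (gaussDecay_psi t n).bdd_mul cb bb
  have g3 : GaussDecay fun x => -superpot a x * boundState a x * psi t n x := by
    have := (g2.bdd_mul (continuous_superpot a) (norm_superpot_le a)).neg
    simpa [mul_assoc] using this
  have h := integral_mul_deriv_gaussDecay (hasDerivAt_boundState a) (hasDerivAt_psi t n) g1 g3 g2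
  have e : ∀ x, (starRingEnd ℂ) (boundState a x) * phi a n t x =
      boundState a x * psiDeriv t n x + -superpot a x * boundState a x * psi t n x := fun x => by
    have hc : (starRingEnd ℂ) (boundState a x) = boundState a x := by
      rw [boundState, Complex.conj_ofReal]
    rw [hc, phi_eq]; ring
  simp only [e]
  rw [integral_add g1.integrable g3.integrable, h, neg_add_cancel]

/-- Orthogonality gives $L^+f=0$ in the sense of distributions. Testing with the $\varphi_z$ that
come from plane waves times $\psi_0$ shows that $\bar f\,L\psi_0$ is the weak derivative of $\bar
f\psi_0$. -/
lemma integral_conj_mul_darboux {a t : ℝ} {f : L2}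
    (h : ∀ n, inner ℂ f (toL2 (phi a n t)) = 0) {u : ℝ → ℂ} (hu : ContDiff ℝ ∞ u)
    (hs : HasCompactSupport u) :
    ∫ x, (starRingEnd ℂ) (f x) * (-superpot a x * u x + deriv u x) = 0 := by
  have hp : ∀ z, ∫ x, (starRingEnd ℂ) (f x) * phiZ a z t x = 0 := fun z => by
    have h1 := toL2_phiZ a z t
    have h2 := h1.2.mapL (innerSL ℂ f)
    simp only [innerSL_apply_apply, inner_smul_right, h, mul_zero] at h2
    rw [← inner_toL2_right _ h1.1]
    exact h2.unique hasSum_zero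
  have gV := gaussDecay_psiVac t
  have gV' : GaussDecay fun x => -superpot a x * psiVac t x +
      -(Complex.I / 2) * slope t * x * psiVac t x := by
    have := (gV.bdd_mul (continuous_superpot a) (norm_superpot_le a)).neg.add
      (gV.id_mul.const_mul (-(Complex.I / 2) * slope t))
    convert this using 2 with x
    ring
  set F : ℝ → ℂ := fun x => (starRingEnd ℂ) (f x) * psiVac t x with hF
  set F₁ : ℝ → ℂ := fun x => (starRingEnd ℂ) (f x) * (-superpot a x * psiVac t x +
      -(Complex.I / 2) * slope t * x * psiVac t x) with hF₁
  have hi : Integrable F := integrable_mul_of_memLp (memLp_conj (Lp.memLp f)) gV.memLp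
  have hi₁ : Integrable F₁ := integrable_mul_of_memLp (memLp_conj (Lp.memLp f)) gV'.memLp
  have hexp : ∀ ξ : ℝ, Continuous fun x : ℝ =>
      Complex.exp (((-2 * Real.pi * x * ξ : ℝ) : ℂ) * Complex.I) := fun ξ => by fun_prop
  have nexp : ∀ ξ x : ℝ, ‖Complex.exp (((-2 * Real.pi * x * ξ : ℝ) : ℂ) * Complex.I)‖ ≤ 1 :=
    fun ξ x => (Complex.norm_exp_ofReal_mul_I _).le
  have hfou : ∀ ξ : ℝ, FourierTransform.fourier F₁ ξ =
      2 * Real.pi * Complex.I * ξ * FourierTransform.fourier F ξ := fun ξ => by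
    obtain ⟨c, hc, z, hsz, hz⟩ := exists_psiZ_eq t ξ
    have k := hp z
    have e : ∀ x, (starRingEnd ℂ) (f x) * phiZ a z t x =
        c * (F₁ x * Complex.exp (((-2 * Real.pi * x * ξ : ℝ) : ℂ) * Complex.I) -
          2 * Real.pi * Complex.I * ξ *
            (F x * Complex.exp (((-2 * Real.pi * x * ξ : ℝ) : ℂ) * Complex.I))) := fun x => by
      rw [phiZ_eq, hsz, hz]
      simp only [hF, hF₁]
      ring
    simp only [e] at k
    rw [integral_const_mul] at k
    have k2 := (mul_eq_zero.1 k).resolve_left hc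
    rw [integral_sub (hi₁.mul_bdd (c := 1) (hexp ξ).aestronglyMeasurable (ae_of_all _ (nexp ξ)))
      ((hi.mul_bdd (c := 1) (hexp ξ).aestronglyMeasurable (ae_of_all _ (nexp ξ))).const_mul _),
      integral_const_mul, sub_eq_zero] at k2
    rw [fourier_eq_integral, fourier_eq_integral, k2]
  -- Dividing by the zero-free vacuum turns an arbitrary test function into one for the weak
  -- relation between `F₁` and `F`.
  set η : ℝ → ℂ := fun x => u x / psiVac t x with hη
  have ηs : ContDiff ℝ ∞ η := by
    simp only [hη, div_eq_mul_inv]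
    exact hu.mul ((contDiff_psiVac t).inv (psiVac_ne_zero t))
  have ηc : HasCompactSupport η := by
    simp only [hη, div_eq_mul_inv]; exact hs.mul_right
  have huη : u = fun x => psiVac t x * η x := by
    funext x; rw [hη, mul_div_cancel₀ _ (psiVac_ne_zero t x)]
  have hdη : ∀ x, HasDerivAt η (deriv η x) x := fun x =>
    (ηs.differentiable (by simp) x).hasDerivAt
  have hdu : ∀ x, deriv u x = -(Complex.I / 2) * slope t * x * psiVac t x * η x +
      psiVac t x * deriv η x := fun x => by
    rw [huη]
    exact ((hasDerivAt_psiVac t x).mul (hdη x)).deriv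
  have key := integral_mul_eq_neg_of_fourier hi₁ hi hfou ηs ηc
  obtain ⟨B, hB⟩ := ηc.exists_bound_of_continuous ηs.continuous
  have ηs' : ContDiff ℝ ∞ (deriv η) := (contDiff_infty_iff_deriv.1 ηs).2
  obtain ⟨B', hB'⟩ := ηc.deriv.exists_bound_of_continuous ηs'.continuous
  rw [eq_neg_iff_add_eq_zero, ← integral_add
    (hi₁.mul_bdd ηs.continuous.aestronglyMeasurable (ae_of_all _ hB))
    (hi.mul_bdd ηs'.continuous.aestronglyMeasurable (ae_of_all _ hB'))] at key
  rw [← key]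
  refine integral_congr_ae (ae_of_all _ fun x => ?_)
  simp only [hF, hF₁]
  rw [hdu, huη]
  ring

/-- For $u=\cosh(ax)\,v$ one has $Lu=\cosh(ax)\,v'$, so $\cosh(ax)\bar f$ has vanishing weak
derivative and is constant. -/
lemma mem_span_boundState {a t : ℝ} (ha : 0 < a) {f : L2}
    (h : ∀ n, inner ℂ f (toL2 (phi a n t)) = 0) :
    f ∈ Submodule.span ℂ {toL2 (boundState a)} := by
  have hcosh : ContDiff ℝ ∞ fun x : ℝ => Real.cosh (a * x) :=
    Real.contDiff_cosh.comp (contDiff_const.mul contDiff_id)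
  have hli : LocallyIntegrable fun x : ℝ => (Real.cosh (a * x) : ℂ) * (starRingEnd ℂ) (f x) := by
    have h1 : LocallyIntegrable fun x : ℝ => (starRingEnd ℂ) (f x) :=
      (memLp_conj (Lp.memLp f)).locallyIntegrable (by norm_num)
    exact h1.continuous_mul (Complex.continuous_ofReal.comp hcosh.continuous)
  obtain ⟨c, hc⟩ := ae_eq_const_of_integral_deriv hli fun v hv hs => by
    have hu : ContDiff ℝ ∞ fun x : ℝ => ((Real.cosh (a * x) * v x : ℝ) : ℂ) :=
      Complex.ofRealCLM.contDiff.comp (hcosh.mul hv)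
    have hus : HasCompactSupport fun x : ℝ => ((Real.cosh (a * x) * v x : ℝ) : ℂ) :=
      (hs.mul_left (f := fun x => Real.cosh (a * x))).comp_left (g := fun y : ℝ => (y : ℂ)) rfl
    rw [← integral_conj_mul_darboux h hu hus]
    refine integral_congr_ae (ae_of_all _ fun x => ?_)
    have h0 : HasDerivAt (fun y : ℝ => a * y) a x := by
      simpa using (hasDerivAt_id x).const_mul a
    have hd := (h0.cosh.mul ((hv.differentiable (by simp) x).hasDerivAt)).ofReal_comp
    have hd' : deriv (fun x : ℝ => ((Real.cosh (a * x) * v x : ℝ) : ℂ)) x =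
      ((Real.sinh (a * x) * a * v x + Real.cosh (a * x) * deriv v x : ℝ) : ℂ) := hd.deriv
    simp only
    rw [hd', superpot, Real.tanh_eq_sinh_div_cosh]
    have hne : (Real.cosh (a * x) : ℂ) ≠ 0 := Complex.ofReal_ne_zero.2 (Real.cosh_pos _).ne'
    rw [Complex.real_smul]
    push_cast at hne ⊢
    field_simp
    ring
  rw [Submodule.mem_span_singleton]
  refine ⟨(starRingEnd ℂ) c / (Real.sqrt (a / 2) : ℂ), ?_⟩
  rw [← toL2_smul _ (memLp_boundState ha), ← toL2_coeFn f]
  refine toL2_congr ((memLp_boundState ha).const_mul _) ?_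
  filter_upwards [hc] with x hx
  have hne : (Real.cosh (a * x) : ℂ) ≠ 0 := Complex.ofReal_ne_zero.2 (Real.cosh_pos _).ne'
  have hsq : (Real.sqrt (a / 2) : ℂ) ≠ 0 := Complex.ofReal_ne_zero.2 (by positivity)
  have h2 := congrArg (starRingEnd ℂ) hx
  rw [map_mul, Complex.conj_conj, Complex.conj_ofReal] at h2
  rw [← h2, boundState, Complex.ofReal_div]
  field_simp

/-- The right-hand side contains no time, so all the spaces coincide. The second inclusion is
obtained by taking orthogonal complements. -/
lemma solitonSpace_eq {a : ℝ} (ha : 0 < a) (t : ℝ) :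
    solitonSpace a t = (Submodule.span ℂ {toL2 (boundState a)})ᗮ := by
  refine le_antisymm ?_ ?_
  · refine Submodule.topologicalClosure_minimal _ ?_ (Submodule.isClosed_orthogonal _)
    rw [Submodule.span_le]
    rintro _ ⟨n, rfl⟩
    rw [SetLike.mem_coe, Submodule.mem_orthogonal_singleton_iff_inner_right]
    exact inner_boundState_phi ha n t
  · have h : (Submodule.span ℂ (Set.range fun n : ℕ => toL2 (phi a n t)))ᗮ ≤
        Submodule.span ℂ {toL2 (boundState a)} := fun f hf => by
      rw [Submodule.mem_orthogonal'] at hf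
      exact mem_span_boundState ha fun n => hf _ (Submodule.subset_span ⟨n, rfl⟩)
    have h2 := Submodule.orthogonal_le h
    rwa [Submodule.orthogonal_orthogonal_eq_closure] at h2

/-! ### Multiplication operators -/

lemma exists_mul_operator {b : ℝ → ℂ} (hb : Continuous b) {C : ℝ} (hC : ∀ x, ‖b x‖ ≤ C) :
    ∃ M : L2 →L[ℂ] L2, ∀ f, MemLp f 2 volume → M (toL2 f) = toL2 fun x => b x * f x := by
  have hm : ∀ f : L2, MemLp (fun x => b x * f x) 2 volume := fun f =>
    memLp_bdd_mul (Lp.memLp f) hb.aestronglyMeasurable hC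
  let L : L2 →ₗ[ℂ] L2 :=
    { toFun := fun f => toL2 fun x => b x * f x
      map_add' := fun f g => by
        rw [← toL2_add (hm f) (hm g)]
        refine toL2_congr (hm _) ?_
        filter_upwards [Lp.coeFn_add f g] with x hx
        rw [hx, Pi.add_apply, mul_add]
      map_smul' := fun c f => by
        rw [RingHom.id_apply, ← toL2_smul c (hm f)]
        refine toL2_congr (hm _) ?_
        filter_upwards [Lp.coeFn_smul c f] with x hx
        rw [hx, Pi.smul_apply, smul_eq_mul, mul_left_comm] }
  refine ⟨L.mkContinuous C fun f => ?_, fun f hf => ?_⟩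
  · refine Lp.norm_le_mul_norm_of_ae_le_mul ?_
    filter_upwards [coeFn_toL2 (hm f)] with x hx
    change ‖(toL2 fun x => b x * f x) x‖ ≤ _
    rw [hx, norm_mul]
    exact mul_le_mul_of_nonneg_right (hC x) (norm_nonneg _)
  · refine toL2_congr (hm _) ?_
    filter_upwards [coeFn_toL2 hf] with x hx
    rw [hx]

/-! ### The inverse of the Gram matrix and its moments -/

section

variable {a : ℝ}

lemma le_weight (a x : ℝ) : a ≤ weight a x := by
  refine Real.le_sqrt_of_sq_le ?_
  nlinarith [sq_nonneg x]

lemma weight_pos (ha : 0 < a) (x : ℝ) : 0 < weight a x := ha.trans_le (le_weight a x)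

lemma weight_ne_zero (ha : 0 < a) (x : ℝ) : (weight a x : ℂ) ≠ 0 :=
  Complex.ofReal_ne_zero.2 (weight_pos ha x).ne'

lemma continuous_inv_weight (ha : 0 < a) : Continuous fun x => (weight a x : ℂ)⁻¹ :=
  (Complex.continuous_ofReal.comp (continuous_weight a)).inv₀ (weight_ne_zero ha)

lemma norm_inv_weight_le (ha : 0 < a) (x : ℝ) : ‖(weight a x : ℂ)⁻¹‖ ≤ a⁻¹ := by
  rw [norm_inv, Complex.norm_real, Real.norm_eq_abs, abs_of_pos (weight_pos ha x)]
  exact inv_anti₀ ha (le_weight a x)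

lemma gaussDecay_inv_weight_osc (ha : 0 < a) (n : ℕ) :
    GaussDecay fun x => (weight a x : ℂ)⁻¹ * osc n x :=
  (gaussDecay_osc n).bdd_mul (continuous_inv_weight ha) (norm_inv_weight_le ha)

/-- The oscillator functions divided by the weight. -/
def winv (a : ℝ) (n : ℕ) : L2 := toL2 fun x => (weight a x : ℂ)⁻¹ * osc n x

/-- Biorthogonality: `winv` extracts from a weighted coherent state its single coefficient $\Phi
a_nz^n$, so the moments become matrix elements of the resolution of the identity. -/
lemma inner_winv_wosc (ha : 0 < a) (n k : ℕ) :
    inner ℂ (winv a n) (wosc a k) = if n = k then 1 else 0 := by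
  rw [winv, wosc, inner_toL2 (gaussDecay_inv_weight_osc ha n).memLp
    ((gaussDecay_osc k).weight_mul a).memLp, ← integral_osc_mul_osc]
  refine integral_congr_ae (ae_of_all _ fun x => ?_)
  simp only [map_mul, map_inv₀, Complex.conj_ofReal]
  field_simp [weight_ne_zero ha x]

lemma inner_winv_wpacket (ha : 0 < a) (n : ℕ) (z : ℂ) :
    inner ℂ (winv a n) (wpacket a z) = (Phi z : ℂ) * (coef n : ℂ) * z ^ n := by
  have h := (hasSum_wpacket a z).2.mapL (innerSL ℂ (winv a n))
  simp only [innerSL_apply_apply, inner_smul_right, inner_winv_wosc ha] at h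
  refine h.unique ?_
  have h2 := hasSum_ite_eq n ((Phi z : ℂ) * (coef n : ℂ) * z ^ n)
  refine hasSum_of_eq h2 (fun k => ?_) rfl
  by_cases hk : k = n
  · subst hk; simp
  · simp [hk, Ne.symm hk]

/-- The inverse of the Gram matrix: the matrix of multiplication by `(x² / 4 + a²)⁻¹`. -/
def gramInv (a : ℝ) (n k : ℕ) : ℂ := inner ℂ (winv a n) (winv a k)

lemma hasMuIntegral_moment (ha : 0 < a) (n k : ℕ) :
    HasMuIntegral a (fun z : ℂ => (coef n : ℂ) * (coef k : ℂ) *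
      (Phi z : ℂ) ^ 2 * z ^ n * (starRingEnd ℂ z) ^ k) (gramInv a n k) := by
  have h := hasMuIntegral_wpacket ha (winv a n) (winv a k)
  rw [gramInv]
  convert h using 2 with z
  rw [← inner_conj_symm (wpacket a z), inner_winv_wpacket ha, inner_winv_wpacket ha]
  simp only [map_mul, map_pow, Complex.conj_ofReal]
  ring

lemma gram_eq_integral (a t : ℝ) (n k : ℕ) : gram a t n k =
    ∫ x, (starRingEnd ℂ) (osc n x) * ((weight a x : ℂ) ^ 2 * osc k x) := by
  rw [gram_eq_jacobi, integral_weight_sq_osc]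

/-- In the Hermite basis $S$ is the matrix of the unbounded multiplication by $q^2$, while
$q^{-2}\le a^{-2}$ is bounded. The columns of $S$ are square-summable because $q^2e_k$ lies in
$L^2$. -/
lemma isInverseMatrix_gram (ha : 0 < a) (t : ℝ) : IsInverseMatrix (gram a t) (gramInv a) := by
  have cb : Continuous fun x => ((weight a x : ℂ)⁻¹) ^ 2 := (continuous_inv_weight ha).pow 2
  have bb : ∀ x, ‖((weight a x : ℂ)⁻¹) ^ 2‖ ≤ a⁻¹ ^ 2 := fun x => by
    rw [norm_pow]
    exact pow_le_pow_left₀ (norm_nonneg _) (norm_inv_weight_le ha x) 2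
  obtain ⟨M, hM⟩ := exists_mul_operator cb bb
  have gq : ∀ k, GaussDecay fun x => (weight a x : ℂ) ^ 2 * osc k x := fun k => by
    have := ((gaussDecay_osc k).weight_mul a).weight_mul a
    simpa only [← mul_assoc, ← sq] using this
  have gi : ∀ k, GaussDecay fun x => ((weight a x : ℂ)⁻¹) ^ 2 * osc k x := fun k =>
    (gaussDecay_osc k).bdd_mul cb bb
  have hMq : ∀ k, M (toL2 fun x => (weight a x : ℂ) ^ 2 * osc k x) = toL2 (osc k) := fun k => by
    rw [hM _ (gq k).memLp]
    congr 1
    funext x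
    field_simp [weight_ne_zero ha x]
  have hMo : ∀ k, M (toL2 (osc k)) = toL2 fun x => ((weight a x : ℂ)⁻¹) ^ 2 * osc k x := fun k =>
    hM _ (gaussDecay_osc k).memLp
  have hR : ∀ n k, gramInv a n k = inner ℂ (toL2 (osc n)) (M (toL2 (osc k))) := fun n k => by
    rw [gramInv, winv, winv, hMo, inner_toL2 (gaussDecay_inv_weight_osc ha n).memLp
      (gaussDecay_inv_weight_osc ha k).memLp, inner_toL2 (gaussDecay_osc n).memLp (gi k).memLp]
    refine integral_congr_ae (ae_of_all _ fun x => ?_)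
    simp only [map_mul, map_inv₀, Complex.conj_ofReal]
    ring
  have hunit : ∀ k, oscBasis.repr (toL2 (osc k)) = unitVec k := fun k => by
    rw [← oscBasis_apply, HilbertBasis.repr_self]; rfl
  have hunit' : ∀ k, oscBasis.repr.symm (unitVec k) = toL2 (osc k) := fun k => by
    rw [← hunit, LinearIsometryEquiv.symm_apply_apply]
  refine ⟨(oscBasis.repr.toContinuousLinearEquiv : L2 →L[ℂ] lp (fun _ : ℕ => ℂ) 2) ∘L M ∘L
    (oscBasis.repr.symm.toContinuousLinearEquiv : lp (fun _ : ℕ => ℂ) 2 →L[ℂ] L2),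
    fun n k => ?_, fun k => ⟨oscBasis.repr (toL2 fun x => (weight a x : ℂ) ^ 2 * osc k x),
      fun n => ?_, ?_⟩, fun n k => ?_⟩
  · change _ = oscBasis.repr (M (oscBasis.repr.symm (unitVec k))) n
    rw [hunit', HilbertBasis.repr_apply_apply, oscBasis_apply, hR]
  · rw [HilbertBasis.repr_apply_apply, oscBasis_apply, gram_eq_integral,
      inner_toL2 (gaussDecay_osc n).memLp (gq k).memLp]
  · change oscBasis.repr (M (oscBasis.repr.symm (oscBasis.repr _))) = _
    rw [LinearIsometryEquiv.symm_apply_apply, hMq, hunit]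
  -- Parseval for the pair $q^2e_n$ and $q^{-2}e_k$, whose inner product is $\langle
  -- e_n|e_k\rangle$.
  · have h := oscBasis.hasSum_inner_mul_inner
      (toL2 fun x => (weight a x : ℂ) ^ 2 * osc n x) (M (toL2 (osc k)))
    refine hasSum_of_eq h (fun j => ?_) ?_
    · rw [oscBasis_apply, hR, gram_eq_integral,
        inner_toL2 (gq n).memLp (gaussDecay_osc j).memLp]
      congr 1
      refine integral_congr_ae (ae_of_all _ fun x => ?_)
      simp only [map_mul, map_pow, Complex.conj_ofReal]
      ring
    · rw [hMo, inner_toL2 (gq n).memLp (gi k).memLp, ← integral_osc_mul_osc]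
      refine integral_congr_ae (ae_of_all _ fun x => ?_)
      simp only [map_mul, map_pow, Complex.conj_ofReal]
      field_simp [weight_ne_zero ha x]

end

/-! ### The coherent states as functions of position and time -/

/-- The exponent of the coherent states. -/
def expo (z : ℂ) (t x : ℝ) : ℂ :=
  -(1 / 2) * Complex.log (width t) - (x : ℂ) ^ 2 * (width t)⁻¹ / 4 -
    Complex.I * (width t)⁻¹ * x * z + (2 * (width t)⁻¹ - 1) / 2 * z ^ 2

/-- The logarithmic `x`-derivative of the coherent states. -/
def logDx (z : ℂ) (t x : ℝ) : ℂ := -((width t)⁻¹ * x / 2) - Complex.I * (width t)⁻¹ * z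

/-- The logarithmic `t`-derivative of the coherent states. -/
def logDt (z : ℂ) (t x : ℝ) : ℂ :=
  -(Complex.I / 2) * (width t)⁻¹ + Complex.I * (width t)⁻¹ ^ 2 * x ^ 2 / 4 -
    (width t)⁻¹ ^ 2 * x * z - Complex.I * (width t)⁻¹ ^ 2 * z ^ 2

lemma slope_eq (t : ℝ) : slope t = -Complex.I * (width t)⁻¹ := by rw [slope, div_eq_mul_inv]

lemma twist_eq (t : ℝ) : twist t = 2 * (width t)⁻¹ - 1 := by
  have h := mul_inv_cancel₀ (width_ne_zero t)
  have h2 : 1 - Complex.I * (t : ℂ) = 2 - width t := by rw [width]; ring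
  rw [twist, div_eq_mul_inv, h2]
  linear_combination -h

/-- All time dependence is collected in one exponent. The logarithm is smooth there since `width`
has real part $1$. -/
lemma psiZ_eq_exp (z : ℂ) (t x : ℝ) :
    psiZ z t x = ((Phi z * vacNorm : ℝ) : ℂ) * Complex.exp (expo z t x) := by
  rw [psiZ_eq, psiVac_eq, slope_eq, twist_eq, Complex.cpow_def_of_ne_zero (width_ne_zero t)]
  have e : ∀ p c A B D : ℂ, p * (c * Complex.exp A * Complex.exp B * Complex.exp D) =
      p * c * Complex.exp (A + B + D) := fun p c A B D => by
    rw [Complex.exp_add, Complex.exp_add]; ring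
  rw [e, vacNorm, expo, Complex.ofReal_mul, mul_inv]
  congr 2
  ring

lemma width_mem_slitPlane (t : ℝ) : width t ∈ Complex.slitPlane :=
  Or.inl (by rw [width_re]; norm_num)

lemma hasDerivAt_width (t : ℝ) : HasDerivAt width Complex.I t := by
  have h : HasDerivAt (fun y : ℝ => (y : ℂ)) 1 t := Complex.ofRealCLM.hasDerivAt
  have h2 := (h.const_mul Complex.I).const_add 1
  rw [mul_one] at h2
  exact h2

lemma hasDerivAt_inv_width (t : ℝ) :
    HasDerivAt (fun s => (width s)⁻¹) (-Complex.I * (width t)⁻¹ ^ 2) t := by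
  refine ((hasDerivAt_width t).inv (width_ne_zero t)).congr_deriv ?_
  rw [div_eq_mul_inv, inv_pow]

lemma hasDerivAt_expo_t (z : ℂ) (t x : ℝ) :
    HasDerivAt (fun s => expo z s x) (logDt z t x) t := by
  have h1 := (hasDerivAt_width t).clog_real (width_mem_slitPlane t)
  have h2 := hasDerivAt_inv_width t
  have h3 := (((h1.const_mul (-(1 / 2) : ℂ)).sub ((h2.const_mul ((x : ℂ) ^ 2)).div_const 4)).sub
    (((h2.const_mul Complex.I).mul_const (x : ℂ)).mul_const z)).add
    ((((h2.const_mul 2).sub_const 1).div_const 2).mul_const (z ^ 2))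
  refine h3.congr_deriv ?_
  rw [logDt]
  linear_combination ((width t)⁻¹ ^ 2 * x * z) * Complex.I_sq

lemma hasDerivAt_psiZ_t (z : ℂ) (t x : ℝ) :
    HasDerivAt (fun s => psiZ z s x) (logDt z t x * psiZ z t x) t := by
  simp only [psiZ_eq_exp]
  refine ((hasDerivAt_expo_t z t x).cexp.const_mul ((Phi z * vacNorm : ℝ) : ℂ)).congr_deriv ?_
  ring

lemma hasDerivAt_psiZ_x (z : ℂ) (t x : ℝ) :
    HasDerivAt (psiZ z t) (logDx z t x * psiZ z t x) x := by
  refine (hasDerivAt_psiZ z t x).congr_deriv ?_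
  rw [slope_eq, logDx]
  linear_combination ((width t)⁻¹ * x / 2 * psiZ z t x) * Complex.I_sq

lemma phiZ_eq_mul (a : ℝ) (z : ℂ) (t x : ℝ) :
    phiZ a z t x = (-superpot a x + logDx z t x) * psiZ z t x := by
  rw [phiZ_eq, slope_eq, logDx]
  linear_combination ((width t)⁻¹ * x / 2 * psiZ z t x) * Complex.I_sq

/-- The derivative `a² sech² (a x)` of the superpotential. -/
def superpotDeriv (a x : ℝ) : ℂ := ((a ^ 2 / Real.cosh (a * x) ^ 2 : ℝ) : ℂ)

lemma hasDerivAt_superpotDeriv (a x : ℝ) :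
    HasDerivAt (superpotDeriv a) (-2 * superpot a x * superpotDeriv a x) x := by
  have h0 : HasDerivAt (fun y : ℝ => a * y) a x := by
    simpa using (hasDerivAt_id x).const_mul a
  have hc := (Real.cosh_pos (a * x)).ne'
  have h1 := ((hasDerivAt_const x (a ^ 2)).div (h0.cosh.pow 2) (pow_ne_zero 2 hc)).ofReal_comp
  refine h1.congr_deriv ?_
  rw [superpot, superpotDeriv, Real.tanh_eq_sinh_div_cosh]
  have : (-2 : ℂ) = ((-2 : ℝ) : ℂ) := by push_cast; rfl
  rw [this, ← Complex.ofReal_mul, ← Complex.ofReal_mul]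
  congr 1
  simp only [Pi.pow_apply]
  field_simp
  ring

lemma hasDerivAt_logDx (z : ℂ) (t x : ℝ) : HasDerivAt (logDx z t) (-((width t)⁻¹ / 2)) x := by
  have h : HasDerivAt (fun y : ℝ => (y : ℂ)) 1 x := Complex.ofRealCLM.hasDerivAt
  have h2 := (((h.const_mul (width t)⁻¹).div_const 2).neg).sub_const (Complex.I * (width t)⁻¹ * z)
  refine h2.congr_deriv ?_
  rw [mul_one]

lemma hasDerivAt_logDx_t (z : ℂ) (t x : ℝ) : HasDerivAt (fun s => logDx z s x)
    (Complex.I * (width t)⁻¹ ^ 2 * x / 2 - (width t)⁻¹ ^ 2 * z) t := by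
  have h2 := hasDerivAt_inv_width t
  refine ((((h2.mul_const (x : ℂ)).div_const 2).neg).sub
    ((h2.const_mul Complex.I).mul_const z)).congr_deriv ?_
  linear_combination ((width t)⁻¹ ^ 2 * z) * Complex.I_sq

/-- The `x`-derivative of `φ_z`. -/
def phiZx (a : ℝ) (z : ℂ) (t x : ℝ) : ℂ :=
  (-superpotDeriv a x - (width t)⁻¹ / 2 + (-superpot a x + logDx z t x) * logDx z t x) * psiZ z t x

/-- The second `x`-derivative of `φ_z`. -/
def phiZxx (a : ℝ) (z : ℂ) (t x : ℝ) : ℂ :=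
  (2 * superpot a x * superpotDeriv a x +
    2 * (-superpotDeriv a x - (width t)⁻¹ / 2) * logDx z t x +
    (-superpot a x + logDx z t x) * (-((width t)⁻¹ / 2)) +
    (-superpot a x + logDx z t x) * logDx z t x ^ 2) * psiZ z t x

/-- The `t`-derivative of `φ_z`. -/
def phiZt (a : ℝ) (z : ℂ) (t x : ℝ) : ℂ :=
  (Complex.I * (width t)⁻¹ ^ 2 * x / 2 - (width t)⁻¹ ^ 2 * z +
    (-superpot a x + logDx z t x) * logDt z t x) * psiZ z t x

lemma hasDerivAt_phiZ (a : ℝ) (z : ℂ) (t x : ℝ) :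
    HasDerivAt (phiZ a z t) (phiZx a z t x) x := by
  rw [funext (phiZ_eq_mul a z t)]
  refine (((hasDerivAt_superpot a x).neg.add (hasDerivAt_logDx z t x)).mul
    (hasDerivAt_psiZ_x z t x)).congr_deriv ?_
  simp only [phiZx, superpotDeriv, Pi.add_apply, Pi.neg_apply]
  ring

lemma hasDerivAt_phiZx (a : ℝ) (z : ℂ) (t x : ℝ) :
    HasDerivAt (phiZx a z t) (phiZxx a z t x) x := by
  have h1 := (((hasDerivAt_superpotDeriv a x).neg.sub_const ((width t)⁻¹ / 2)).add
    (((hasDerivAt_superpot a x).neg.add (hasDerivAt_logDx z t x)).mul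
      (hasDerivAt_logDx z t x))).mul (hasDerivAt_psiZ_x z t x)
  refine h1.congr_deriv ?_
  simp only [phiZxx, superpotDeriv, Pi.add_apply, Pi.neg_apply, Pi.mul_apply]
  ring

lemma hasDerivAt_phiZ_t (a : ℝ) (z : ℂ) (t x : ℝ) :
    HasDerivAt (fun s => phiZ a z s x) (phiZt a z t x) t := by
  simp only [phiZ_eq_mul]
  refine (((hasDerivAt_logDx_t z t x).const_add (-superpot a x)).mul
    (hasDerivAt_psiZ_t z t x)).congr_deriv ?_
  simp only [phiZt]
  ring

lemma solitonPotential_eq (a x : ℝ) : (solitonPotential a x : ℂ) = -2 * superpotDeriv a x := by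
  rw [solitonPotential, superpotDeriv]; push_cast; ring

/-- The intertwining $h_1L=L(-\partial_x^2)$ in explicit form: after factoring out $\psi_z$, a
polynomial identity in the superpotential, its derivative, `(width t)⁻¹`, $x$ and $z$, needing only
$i^2=-1$. -/
lemma schrodinger_phiZ (a : ℝ) (z : ℂ) (t x : ℝ) : Complex.I * phiZt a z t x =
    -phiZxx a z t x + (solitonPotential a x : ℂ) * phiZ a z t x := by
  rw [solitonPotential_eq, phiZ_eq_mul, phiZt, phiZxx, logDt, logDx]
  linear_combination (psiZ z t x * ((width t)⁻¹ ^ 2 * x / 2 +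
    (-superpot a x + (-((width t)⁻¹ * x / 2) - Complex.I * (width t)⁻¹ * z)) *
      (-(width t)⁻¹ / 2 + (width t)⁻¹ ^ 2 * x ^ 2 / 4 - (width t)⁻¹ ^ 2 * z ^ 2
       + (width t)⁻¹ ^ 2 * z ^ 2))) * Complex.I_sq

lemma iteratedDeriv_two_phiZ (a : ℝ) (z : ℂ) (t x : ℝ) :
    iteratedDeriv 2 (phiZ a z t) x = phiZxx a z t x := by
  rw [iteratedDeriv_succ, iteratedDeriv_one, funext fun y => (hasDerivAt_phiZ a z t y).deriv]
  exact (hasDerivAt_phiZx a z t x).deriv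

lemma contDiff_superpot (a : ℝ) : ContDiff ℝ ∞ (superpot a) := by
  have h : ContDiff ℝ ∞ fun x : ℝ => a * x := contDiff_const.mul contDiff_id
  have h2 : superpot a = fun y : ℝ => ((a * (Real.sinh (a * y) / Real.cosh (a * y)) : ℝ) : ℂ) := by
    funext y; rw [superpot, Real.tanh_eq_sinh_div_cosh]
  rw [h2]
  exact Complex.ofRealCLM.contDiff.comp (contDiff_const.mul
    ((Real.contDiff_sinh.comp h).div (Real.contDiff_cosh.comp h) fun x => (Real.cosh_pos _).ne'))

lemma contDiff_phiZ (a : ℝ) (z : ℂ) : ContDiff ℝ ∞ fun p : ℝ × ℝ => phiZ a z p.2 p.1 := by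
  have hx : ContDiff ℝ ∞ fun p : ℝ × ℝ => (p.1 : ℂ) := Complex.ofRealCLM.contDiff.comp contDiff_fst
  have ht : ContDiff ℝ ∞ fun p : ℝ × ℝ => (p.2 : ℂ) := Complex.ofRealCLM.contDiff.comp contDiff_snd
  have hw : ContDiff ℝ ∞ fun p : ℝ × ℝ => width p.2 := contDiff_const.add (contDiff_const.mul ht)
  have hi : ContDiff ℝ ∞ fun p : ℝ × ℝ => (width p.2)⁻¹ := hw.inv fun p => width_ne_zero _
  have hl : ContDiff ℝ ∞ fun p : ℝ × ℝ => Complex.log (width p.2) := by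
    rw [contDiff_iff_contDiffAt]
    intro p
    exact ((Complex.contDiffAt_log (width_mem_slitPlane p.2)).restrict_scalars ℝ).comp p
      hw.contDiffAt
  have hs : ContDiff ℝ ∞ fun p : ℝ × ℝ => superpot a p.1 := (contDiff_superpot a).comp contDiff_fst
  have hE : ContDiff ℝ ∞ fun p : ℝ × ℝ => expo z p.2 p.1 := by
    unfold expo
    exact (((contDiff_const.mul hl).sub (((hx.pow 2).mul hi).div_const 4)).sub
      (((contDiff_const.mul hi).mul hx).mul contDiff_const)).add
      ((((contDiff_const.mul hi).sub contDiff_const).div_const 2).mul contDiff_const)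
  have hG : ContDiff ℝ ∞ fun p : ℝ × ℝ => logDx z p.2 p.1 := by
    unfold logDx
    exact (((hi.mul hx).div_const 2).neg).sub ((contDiff_const.mul hi).mul contDiff_const)
  simp only [phiZ_eq_mul, psiZ_eq_exp]
  exact (hs.neg.add hG).mul (contDiff_const.mul hE.cexp)

/-! ### Differentiation in `L²` -/

/-- Pointwise derivatives become an $L^2$ derivative under a square-integrable majorant near $t$:
the squared error of the difference quotient is dominated by $(2B)^2$. -/
lemma hasDerivAt_toL2 {u u' : ℝ → ℝ → ℂ} {t : ℝ} {B : ℝ → ℝ}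
    (hu : ∀ s x, HasDerivAt (fun s => u s x) (u' s x) s) (hm : ∀ s, MemLp (u s) 2 volume)
    (hm' : MemLp (u' t) 2 volume) (hB : MemLp B 2 volume)
    (hb : ∀ s ∈ Metric.ball t 1, ∀ x, ‖u' s x‖ ≤ B x) :
    HasDerivAt (fun s => toL2 (u s)) (toL2 (u' t)) t := by
  rw [hasDerivAt_iff_tendsto_slope_zero]
  set q : ℝ → ℝ → ℂ := fun h x => (h : ℂ)⁻¹ * (u (t + h) x + (-1) * u t x) + (-1) * u' t x with hq
  have hqm : ∀ h, MemLp (q h) 2 volume := fun h =>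
    (((hm _).add ((hm t).const_mul (-1))).const_mul _).add (hm'.const_mul (-1))
  have hqe : ∀ h : ℝ, h⁻¹ • (toL2 (u (t + h)) - toL2 (u t)) - toL2 (u' t) = toL2 (q h) :=
    fun h => by
      have m1 : MemLp (fun x => u (t + h) x + (-1) * u t x) 2 volume :=
        (hm _).add ((hm t).const_mul (-1))
      have m2 : MemLp (fun x => (h : ℂ)⁻¹ * (u (t + h) x + (-1) * u t x)) 2 volume :=
        m1.const_mul _
      have m3 : MemLp (fun x => (-1) * u t x) 2 volume := (hm t).const_mul (-1)
      have m4 : MemLp (fun x => (-1) * u' t x) 2 volume := hm'.const_mul (-1)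
      simp only [hq]
      rw [toL2_add m2 m4, toL2_smul _ m1, toL2_add (hm _) m3, toL2_smul _ (hm t),
        toL2_smul _ hm', neg_one_smul, neg_one_smul, ← sub_eq_add_neg, ← sub_eq_add_neg]
      congr 1
      rw [← Complex.ofReal_inv]
      rfl
  rw [tendsto_iff_norm_sub_tendsto_zero]
  simp only [hqe]
  have hsq : Tendsto (fun h => ‖toL2 (q h)‖ ^ 2) (𝓝[≠] 0) (𝓝 0) := by
    simp only [norm_sq_toL2 (hqm _)]
    have hball : ∀ᶠ h : ℝ in 𝓝[≠] 0, h ≠ 0 ∧ |h| < 1 := by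
      refine eventually_nhdsWithin_of_eventually_nhds ?_ |>.and ?_ |>.mono fun h hh => ⟨hh.2, hh.1⟩
      · have : Metric.ball (0 : ℝ) 1 ∈ 𝓝 (0 : ℝ) := Metric.ball_mem_nhds _ one_pos
        filter_upwards [this] with h hh
        simpa using hh
      · exact self_mem_nhdsWithin
    have hlim : Tendsto (fun h => ∫ x, ‖q h x‖ ^ 2) (𝓝[≠] 0) (𝓝 (∫ _ : ℝ, (0 : ℝ))) := by
      refine tendsto_integral_filter_of_dominated_convergence (fun x => (2 * B x) ^ 2)
        (Eventually.of_forall fun h => (hqm h).1.norm.pow 2) ?_ ?_ (ae_of_all _ fun x => ?_)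
      · filter_upwards [hball] with h hh
        refine ae_of_all _ fun x => ?_
        -- The mean value inequality in $s$ on the unit ball around $t$, at fixed $x$.
        have hconv : ‖u (t + h) x - u t x‖ ≤ B x * ‖(t + h) - t‖ :=
          (convex_ball t 1).norm_image_sub_le_of_norm_hasDerivWithin_le
            (fun s _ => (hu s x).hasDerivWithinAt) (fun s hs => hb s hs x)
            (Metric.mem_ball_self one_pos) (by simpa using hh.2)
        rw [add_sub_cancel_left, Real.norm_eq_abs] at hconv
        have h1 : ‖(h : ℂ)⁻¹ * (u (t + h) x + (-1) * u t x)‖ ≤ B x := by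
          rw [norm_mul, norm_inv, Complex.norm_real, Real.norm_eq_abs, neg_one_mul,
            ← sub_eq_add_neg, inv_mul_le_iff₀ (abs_pos.2 hh.1), mul_comm]
          exact hconv
        have h2 : ‖(-1) * u' t x‖ ≤ B x := by
          simpa using hb t (Metric.mem_ball_self one_pos) x
        rw [norm_pow, norm_norm]
        refine pow_le_pow_left₀ (norm_nonneg _) ?_ 2
        rw [two_mul]
        exact (norm_add_le _ _).trans (add_le_add h1 h2)
      · have := (hB.const_mul 2).integrable_sq
        exact this
      · have h1 := (hasDerivAt_iff_tendsto_slope_zero.1 (hu t x)).sub_const (u' t x)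
        rw [sub_self] at h1
        have h2 := (h1.norm.pow 2)
        rw [norm_zero, zero_pow two_ne_zero] at h2
        refine h2.congr fun h => ?_
        congr 2
        simp only [hq]
        rw [Complex.real_smul, Complex.ofReal_inv]
        ring
    rwa [integral_zero] at hlim
  have h3 := hsq.sqrt
  simpa [Real.sqrt_sq (norm_nonneg _)] using h3

/-! ### Bounds locally uniform in time -/

lemma norm_inv_width_le_one (t : ℝ) : ‖(width t)⁻¹‖ ≤ 1 := by
  rw [norm_inv]
  refine inv_le_one_of_one_le₀ ?_
  have := Complex.abs_re_le_norm (width t)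
  rwa [width_re, abs_one] at this

lemma inv_width_re (t : ℝ) : ((width t)⁻¹).re = (1 + t ^ 2)⁻¹ := by
  rw [Complex.inv_re, width_re, Complex.normSq_apply, width_re]
  simp [width, sq]

/-- Since $|1+it|\ge1$, the prefactor has modulus at most one and `(width t)⁻¹` is bounded by one;
only the Gaussian rate $(1+t^2)^{-1}/4$ deteriorates with time. -/
lemma expo_re_le {z : ℂ} {t δ : ℝ} (x : ℝ) (hδ : 4 * δ ≤ (1 + t ^ 2)⁻¹) :
    (expo z t x).re ≤ -δ * x ^ 2 + ‖z‖ * |x| + 3 / 2 * ‖z‖ ^ 2 := by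
  have hr := norm_inv_width_le_one t
  have h1 : 0 ≤ (Complex.log (width t)).re := by
    rw [Complex.log_re]
    refine Real.log_nonneg ?_
    have := Complex.abs_re_le_norm (width t)
    rwa [width_re, abs_one] at this
  have h2 : (-(1 / 2) * Complex.log (width t) - (x : ℂ) ^ 2 * (width t)⁻¹ / 4).re =
      -(1 / 2) * (Complex.log (width t)).re - x ^ 2 * (1 + t ^ 2)⁻¹ / 4 := by
    have e : -(1 / 2) * Complex.log (width t) - (x : ℂ) ^ 2 * (width t)⁻¹ / 4 =
      ((-(1 / 2) : ℝ) : ℂ) * Complex.log (width t) - ((x ^ 2 / 4 : ℝ) : ℂ) * (width t)⁻¹ := by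
      push_cast; ring
    rw [e, Complex.sub_re, Complex.re_ofReal_mul, Complex.re_ofReal_mul, inv_width_re]
    ring
  have h3 : ‖Complex.I * (width t)⁻¹ * x * z‖ ≤ ‖z‖ * |x| := by
    rw [norm_mul, norm_mul, norm_mul, Complex.norm_I, one_mul, Complex.norm_real, Real.norm_eq_abs]
    nlinarith [mul_nonneg (abs_nonneg x) (norm_nonneg z)]
  have h4 : ‖(2 * (width t)⁻¹ - 1) / 2 * z ^ 2‖ ≤ 3 / 2 * ‖z‖ ^ 2 := by
    rw [norm_mul, norm_div, norm_pow, Complex.norm_ofNat]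
    have : ‖2 * (width t)⁻¹ - 1‖ ≤ 3 := by
      refine (norm_sub_le _ _).trans ?_
      rw [norm_mul, Complex.norm_ofNat, norm_one]; linarith
    gcongr
  have h5 := (abs_le.1 ((Complex.abs_re_le_norm _).trans h3)).1
  have h6 := (abs_le.1 ((Complex.abs_re_le_norm _).trans h4)).2
  rw [expo, Complex.add_re, Complex.sub_re, h2]
  nlinarith [sq_nonneg x]

lemma norm_logDx_le (z : ℂ) (t x : ℝ) : ‖logDx z t x‖ ≤ |x| / 2 + ‖z‖ := by
  have hr := norm_inv_width_le_one t
  rw [logDx]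
  refine (norm_sub_le _ _).trans (add_le_add ?_ ?_)
  · rw [norm_neg, norm_div, norm_mul, Complex.norm_real, Real.norm_eq_abs, Complex.norm_ofNat]
    gcongr
    exact mul_le_of_le_one_left (abs_nonneg x) hr
  · rw [norm_mul, norm_mul, Complex.norm_I, one_mul]
    exact mul_le_of_le_one_left (norm_nonneg z) hr

lemma norm_logDt_le (z : ℂ) (t x : ℝ) :
    ‖logDt z t x‖ ≤ 1 / 2 + x ^ 2 / 4 + |x| * ‖z‖ + ‖z‖ ^ 2 := by
  have hr := norm_inv_width_le_one t
  have hr2 : ‖(width t)⁻¹‖ ^ 2 ≤ 1 := pow_le_one₀ (norm_nonneg _) hr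
  rw [logDt]
  refine (norm_sub_le _ _).trans (add_le_add ((norm_sub_le _ _).trans (add_le_add
    ((norm_add_le _ _).trans (add_le_add ?_ ?_)) ?_)) ?_)
  · rw [norm_mul, norm_neg, norm_div, Complex.norm_I, Complex.norm_ofNat]
    linarith
  · rw [norm_div, norm_mul, norm_mul, norm_pow, norm_pow, Complex.norm_I, one_mul,
      Complex.norm_real, Real.norm_eq_abs, sq_abs, Complex.norm_ofNat]
    gcongr
    exact mul_le_of_le_one_left (sq_nonneg x) hr2
  · rw [norm_mul, norm_mul, norm_pow, Complex.norm_real, Real.norm_eq_abs]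
    gcongr
    exact mul_le_of_le_one_left (abs_nonneg x) hr2
  · rw [norm_mul, norm_mul, norm_pow, norm_pow, Complex.norm_I, one_mul]
    exact mul_le_of_le_one_left (by positivity) hr2

lemma norm_phiZt_factor_le (a : ℝ) (z : ℂ) (s x : ℝ) :
    ‖Complex.I * (width s)⁻¹ ^ 2 * x / 2 - (width s)⁻¹ ^ 2 * z +
      (-superpot a x + logDx z s x) * logDt z s x‖ ≤
      ((1 / 2 + ‖z‖) + (|a| + 1 / 2 + ‖z‖) * (3 / 4 + ‖z‖ + ‖z‖ ^ 2)) *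
        ((1 + x ^ 2) * (1 + x ^ 2)) := by
  set m := ‖z‖ with hm
  have hm0 : 0 ≤ m := norm_nonneg z
  have hr2 : ‖(width s)⁻¹‖ ^ 2 ≤ 1 := pow_le_one₀ (norm_nonneg _) (norm_inv_width_le_one s)
  have k1 : ‖Complex.I * (width s)⁻¹ ^ 2 * x / 2 - (width s)⁻¹ ^ 2 * z‖ ≤ |x| / 2 + m := by
    refine (norm_sub_le _ _).trans (add_le_add ?_ ?_)
    · rw [norm_div, norm_mul, norm_mul, norm_pow, Complex.norm_I, one_mul, Complex.norm_real,
        Real.norm_eq_abs, Complex.norm_ofNat]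
      gcongr
      exact mul_le_of_le_one_left (abs_nonneg x) hr2
    · rw [norm_mul, norm_pow]
      exact mul_le_of_le_one_left hm0 hr2
  have k2 : ‖-superpot a x + logDx z s x‖ ≤ |a| + (|x| / 2 + m) := by
    refine (norm_add_le _ _).trans (add_le_add ?_ (norm_logDx_le z s x))
    rw [norm_neg]; exact norm_superpot_le a x
  have k3 := norm_logDt_le z s x
  rw [← hm] at k3
  set Y := 1 + x ^ 2 with hY
  have y1 : 1 ≤ Y := by rw [hY]; nlinarith [sq_nonneg x]
  have y2 : |x| ≤ Y := by rw [hY]; nlinarith [sq_nonneg (|x| - 1), sq_abs x]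
  have y3 : x ^ 2 ≤ Y := by rw [hY]; linarith
  have y0 : 0 ≤ Y := zero_le_one.trans y1
  have y4 : Y ≤ Y * Y := le_mul_of_one_le_left y0 y1
  have y5 : ∀ {c : ℝ}, 0 ≤ c → c ≤ c * Y := fun h => le_mul_of_one_le_right h y1
  refine (norm_add_le _ _).trans ?_
  rw [norm_mul, add_mul]
  refine add_le_add (k1.trans ?_) ?_
  · refine le_trans ?_ (mul_le_mul_of_nonneg_left y4 (by positivity))
    rw [add_mul]
    linarith [y5 hm0]
  · have e1 : |a| + (|x| / 2 + m) ≤ (|a| + 1 / 2 + m) * Y := by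
      rw [add_mul, add_mul]
      linarith [y5 (abs_nonneg a), y5 hm0]
    have e2 : 1 / 2 + x ^ 2 / 4 + |x| * m + m ^ 2 ≤ (3 / 4 + m + m ^ 2) * Y := by
      rw [add_mul, add_mul]
      linarith [y5 hm0, y5 (sq_nonneg m), mul_le_mul_of_nonneg_right y2 hm0]
    calc ‖-superpot a x + logDx z s x‖ * ‖logDt z s x‖
        ≤ ((|a| + 1 / 2 + m) * Y) * ((3 / 4 + m + m ^ 2) * Y) :=
          mul_le_mul (k2.trans e1) (k3.trans e2) (norm_nonneg _) (by positivity)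
      _ = _ := by ring

lemma exists_phiZt_bound (a : ℝ) (z : ℂ) (t : ℝ) : ∃ B : ℝ → ℝ, MemLp B 2 volume ∧
    ∀ s ∈ Metric.ball t 1, ∀ x, ‖phiZt a z s x‖ ≤ B x := by
  -- A lower bound for the Gaussian rate valid for all $s$ with $|s-t|<1$.
  set δ : ℝ := (1 + (|t| + 1) ^ 2)⁻¹ / 4 with hδ
  have hδ0 : 0 < δ := by positivity
  set m := ‖z‖ with hm
  have hm0 : 0 ≤ m := norm_nonneg z
  set K : ℝ := ((1 / 2 + m) + (|a| + 1 / 2 + m) * (3 / 4 + m + m ^ 2)) *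
    (Phi z * vacNorm * Real.exp (3 / 2 * m ^ 2)) with hK
  have hP : 0 < Phi z := Real.exp_pos _
  have hv : 0 < vacNorm := by unfold vacNorm; positivity
  have hb : (-(δ : ℂ)).re < 0 := by simpa using hδ0
  have gE : ∀ c : ℝ, GaussDecay fun x : ℝ => ((Real.exp (-δ * x ^ 2 + c * x) : ℝ) : ℂ) := fun c => by
    have := GaussDecay.exp_quadratic hb c 0
    convert this using 2 with x
    push_cast
    rw [add_zero]
  -- The two exponentials together dominate $e^{m|x|}$ and keep the majorant smooth.
  have gS := (gE m).add (gE (-m))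
  have g1 : ∀ {f : ℝ → ℂ}, GaussDecay f → GaussDecay fun x : ℝ => ((1 + x ^ 2 : ℝ) : ℂ) * f x :=
    fun {f} hf => by
      have := hf.add hf.id_mul.id_mul
      convert this using 2 with x
      push_cast; ring
  have gB := ((g1 (g1 gS)).const_mul (K : ℂ)).memLp.norm
  refine ⟨_, gB, fun s hs x => ?_⟩
  have hs' : s ^ 2 ≤ (|t| + 1) ^ 2 := by
    rw [Metric.mem_ball, Real.dist_eq] at hs
    rw [sq_le_sq, abs_of_nonneg (by positivity : 0 ≤ |t| + 1)]
    have := abs_sub_abs_le_abs_sub s t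
    linarith
  have h4 : 4 * δ ≤ (1 + s ^ 2)⁻¹ := by
    rw [hδ, mul_div_cancel₀ _ (by norm_num)]
    exact inv_anti₀ (by positivity) (by linarith)
  have hE := expo_re_le (z := z) x h4
  have hψ : ‖psiZ z s x‖ ≤ Phi z * vacNorm * Real.exp (3 / 2 * m ^ 2) *
      (Real.exp (-δ * x ^ 2 + m * x) + Real.exp (-δ * x ^ 2 + -m * x)) := by
    rw [psiZ_eq_exp, norm_mul, Complex.norm_real, Real.norm_eq_abs, abs_of_pos (by positivity),
      Complex.norm_exp, mul_assoc (Phi z * vacNorm)]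
    refine mul_le_mul_of_nonneg_left ?_ (by positivity)
    refine (Real.exp_le_exp.2 hE).trans ?_
    rw [← hm, add_comm _ (3 / 2 * m ^ 2), Real.exp_add]
    refine mul_le_mul_of_nonneg_left ?_ (Real.exp_pos _).le
    rcases abs_choice x with h | h <;> rw [h]
    · linarith [Real.exp_pos (-δ * x ^ 2 + -m * x)]
    · rw [mul_neg, ← neg_mul]
      linarith [Real.exp_pos (-δ * x ^ 2 + m * x)]
  have hpoly := norm_phiZt_factor_le a z s x
  rw [← hm] at hpoly
  have hval : ‖(K : ℂ) * (((1 + x ^ 2 : ℝ) : ℂ) * (((1 + x ^ 2 : ℝ) : ℂ) *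
      (((Real.exp (-δ * x ^ 2 + m * x) : ℝ) : ℂ) + ((Real.exp (-δ * x ^ 2 + -m * x) : ℝ) : ℂ))))‖ =
      K * ((1 + x ^ 2) * ((1 + x ^ 2) *
        (Real.exp (-δ * x ^ 2 + m * x) + Real.exp (-δ * x ^ 2 + -m * x)))) := by
    rw [← Complex.ofReal_add, ← Complex.ofReal_mul, ← Complex.ofReal_mul, ← Complex.ofReal_mul,
      Complex.norm_real, Real.norm_eq_abs, abs_of_nonneg]
    positivity
  rw [hval, phiZt, norm_mul]
  refine (mul_le_mul hpoly hψ (norm_nonneg _) (by positivity)).trans_eq ?_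
  rw [hK]; ring

lemma continuous_psiZ (z : ℂ) (t : ℝ) : Continuous (psiZ z t) :=
  continuous_iff_continuousAt.2 fun x => (hasDerivAt_psiZ z t x).continuousAt

lemma continuous_phiZt (a : ℝ) (z : ℂ) (t : ℝ) : Continuous (phiZt a z t) := by
  have h1 := continuous_superpot a
  have h2 := continuous_psiZ z t
  unfold phiZt logDx logDt
  fun_prop

lemma memLp_phiZt (a : ℝ) (z : ℂ) (t : ℝ) : MemLp (phiZt a z t) 2 volume := by
  obtain ⟨B, hB, h⟩ := exists_phiZt_bound a z t
  refine hB.of_le (continuous_phiZt a z t).aestronglyMeasurable (ae_of_all _ fun x => ?_)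
  exact (h t (Metric.mem_ball_self one_pos) x).trans (le_abs_self _)

lemma hasDerivAt_toL2_phiZ (a : ℝ) (z : ℂ) (t : ℝ) :
    HasDerivAt (fun s => toL2 (phiZ a z s)) (toL2 (phiZt a z t)) t := by
  obtain ⟨B, hB, h⟩ := exists_phiZt_bound a z t
  exact hasDerivAt_toL2 (fun s x => hasDerivAt_phiZ_t a z s x) (fun s => (toL2_phiZ a z s).1)
    (memLp_phiZt a z t) hB h

/-! ### The Schrödinger equation in `L²` -/

lemma integral_mul_deriv_compactSupport {u u' η : ℝ → ℂ} (hu : ∀ x, HasDerivAt u (u' x) x)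
    (hu' : Continuous u') (hη : ContDiff ℝ ∞ η) (hs : HasCompactSupport η) :
    ∫ x, u x * deriv η x = -∫ x, u' x * η x := by
  have cu : Continuous u := continuous_iff_continuousAt.2 fun x => (hu x).continuousAt
  have hη' : ContDiff ℝ ∞ (deriv η) := (contDiff_infty_iff_deriv.1 hη).2
  exact integral_mul_deriv_eq_deriv_mul_of_integrable (fun x _ => hu x)
    (fun x _ => (hη.differentiable (by simp) x).hasDerivAt)
    ((cu.mul hη'.continuous).integrable_of_hasCompactSupport hs.deriv.mul_left)
    ((hu'.mul hη.continuous).integrable_of_hasCompactSupport hs.mul_left)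
    ((cu.mul hη.continuous).integrable_of_hasCompactSupport hs.mul_left)

/-- Two integrations by parts move the derivatives off the test function; the pointwise equation
then identifies $h_1\varphi_z$ with $i\partial_t\varphi_z$. -/
lemma hamiltonianGraph_phiZ (a : ℝ) (z : ℂ) (t : ℝ) :
    HamiltonianGraph (solitonPotential a) (toL2 (phiZ a z t))
      (Complex.I • toL2 (phiZt a z t)) := by
  intro η hη hs
  have hη' : ContDiff ℝ ∞ (deriv η) := (contDiff_infty_iff_deriv.1 hη).2
  have hη'' : ContDiff ℝ ∞ (deriv (deriv η)) := (contDiff_infty_iff_deriv.1 hη').2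
  have c0 : Continuous (phiZ a z t) :=
    continuous_iff_continuousAt.2 fun x => (hasDerivAt_phiZ a z t x).continuousAt
  have c1 : Continuous (phiZx a z t) :=
    continuous_iff_continuousAt.2 fun x => (hasDerivAt_phiZx a z t x).continuousAt
  have cs : Continuous (superpotDeriv a) :=
    continuous_iff_continuousAt.2 fun x => (hasDerivAt_superpotDeriv a x).continuousAt
  have c2 : Continuous (phiZxx a z t) := by
    have h1 := continuous_superpot a
    have h2 := continuous_psiZ z t
    unfold phiZxx logDx
    fun_prop
  have cV : Continuous fun x => (solitonPotential a x : ℂ) := by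
    simp only [solitonPotential_eq]; fun_prop
  have e1 := integral_mul_deriv_compactSupport (hasDerivAt_phiZ a z t) c1 hη' hs.deriv
  have e2 := integral_mul_deriv_compactSupport (hasDerivAt_phiZx a z t) c2 hη hs
  have hd2 : iteratedDeriv 2 η = deriv (deriv η) := by
    rw [iteratedDeriv_succ, iteratedDeriv_one]
  have iA : Integrable fun x => phiZ a z t x * deriv (deriv η) x :=
    (c0.mul hη''.continuous).integrable_of_hasCompactSupport hs.deriv.deriv.mul_left
  have iB : Integrable fun x => phiZ a z t x * ((solitonPotential a x : ℂ) * η x) :=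
    (c0.mul (cV.mul hη.continuous)).integrable_of_hasCompactSupport hs.mul_left.mul_left
  have iC : Integrable fun x => phiZxx a z t x * η x :=
    (c2.mul hη.continuous).integrable_of_hasCompactSupport hs.mul_left
  have hl : ∫ x, (toL2 (phiZ a z t)) x *
      (-(iteratedDeriv 2 η x) + (solitonPotential a x : ℂ) * η x) =
      ∫ x, (phiZ a z t x * ((solitonPotential a x : ℂ) * η x) -
        phiZ a z t x * deriv (deriv η) x) := by
    refine integral_congr_ae ?_
    filter_upwards [coeFn_toL2 (toL2_phiZ a z t).1] with x hx
    rw [hx, hd2]; ring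
  have hr : ∫ x, (Complex.I • toL2 (phiZt a z t) : L2) x * η x =
      ∫ x, (phiZ a z t x * ((solitonPotential a x : ℂ) * η x) - phiZxx a z t x * η x) := by
    refine integral_congr_ae ?_
    filter_upwards [coeFn_toL2 (memLp_phiZt a z t), Lp.coeFn_smul Complex.I (toL2 (phiZt a z t))]
      with x h1 h2
    rw [h2, Pi.smul_apply, h1, smul_eq_mul, schrodinger_phiZ]; ring
  rw [hl, hr, integral_sub iB iA, integral_sub iB iC, e1, e2, neg_neg]

/-- The reference time is immaterial: membership and resolution are proved in the space at time $t$,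
which is the same complement of the bound state. -/
lemma isCoherentSystem_phiZ {a : ℝ} (ha : 0 < a) (t₀ : ℝ) :
    IsCoherentSystem (solitonSpace a t₀) (solitonPotential a) Set.univ (HasMuIntegral a)
      (fun z t => toL2 (phiZ a z t)) where
  mem z _ t := by
    rw [solitonSpace_eq ha t₀, ← solitonSpace_eq ha t]
    exact phiZ_mem a z t
  isOpen := isOpen_univ
  isConnected := isConnected_univ
  resolution t f hf g hg := by
    rw [solitonSpace_eq ha t₀, ← solitonSpace_eq ha t] at hf hg
    exact hasMuIntegral_phiZ ha t hf hg
  schrodinger z _ t := by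
    refine ⟨_, hamiltonianGraph_phiZ a z t, ?_⟩
    rw [smul_smul, neg_mul, Complex.I_mul_I, neg_neg, one_smul]
    exact hasDerivAt_toL2_phiZ a z t

end SolitonCS

end

theorem theorem3 (a : ℝ) (ha : 0 < a) :
    -- the vectors `φₙ`, `φ_z` are square-integrable, and `φ_z = L ψ_z = Φ ∑ aₙ zⁿ φₙ` in `L²(ℝ)`
    (∀ (n : ℕ) (t : ℝ), MemLp (SolitonCS.phi a n t) 2 (volume : Measure ℝ)) ∧
    (∀ (z : ℂ) (t : ℝ), MemLp (SolitonCS.phiZ a z t) 2 (volume : Measure ℝ)) ∧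
    (∀ (z : ℂ) (t : ℝ),
      HasSum (fun n : ℕ => ((SolitonCS.Phi z : ℂ) * (SolitonCS.coef n : ℂ) * z ^ n) •
          SolitonCS.toL2 (SolitonCS.phi a n t))
        (SolitonCS.toL2 (SolitonCS.phiZ a z t))) ∧
    -- the space `H₁` is, at all times, the orthogonal complement of the bound state
    (∀ t : ℝ, SolitonCS.solitonSpace a t =
      (Submodule.span ℂ {SolitonCS.toL2 (SolitonCS.boundState a)})ᗮ) ∧
    -- all conditions of the definition of coherent states, with the measure `dμ = dy dν(x)`
    (∀ t₀ : ℝ, SolitonCS.IsCoherentSystem (SolitonCS.solitonSpace a t₀)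
      (SolitonCS.solitonPotential a) Set.univ (SolitonCS.HasMuIntegral a)
      (fun z t => SolitonCS.toL2 (SolitonCS.phiZ a z t))) ∧
    -- the wave functions are smooth and solve the Schrödinger equation pointwise
    (∀ z : ℂ, ContDiff ℝ ∞ (fun p : ℝ × ℝ => SolitonCS.phiZ a z p.2 p.1)) ∧
    (∀ (z : ℂ) (x t : ℝ),
      Complex.I * deriv (fun s : ℝ => SolitonCS.phiZ a z s x) t =
        -(iteratedDeriv 2 (SolitonCS.phiZ a z t) x) +
          (SolitonCS.solitonPotential a x : ℂ) * SolitonCS.phiZ a z t x) ∧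
    -- the measure solves the complex problem of moments
    (∃ R : ℕ → ℕ → ℂ,
      (∀ t : ℝ, SolitonCS.IsInverseMatrix (SolitonCS.gram a t) R) ∧
      ∀ n k : ℕ, SolitonCS.HasMuIntegral a
        (fun z : ℂ => (SolitonCS.coef n : ℂ) * (SolitonCS.coef k : ℂ) *
          (SolitonCS.Phi z : ℂ) ^ 2 * z ^ n * (starRingEnd ℂ z) ^ k)
        (R n k)) ∧
    -- the Fourier transform of `dν` is `ρ(t) dt`
    (∀ F : ℝ → ℂ, Integrable F →
      Integrable (fun t : ℝ => SolitonCS.fourierInt F t * (SolitonCS.rho a t : ℂ)) →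
      SolitonCS.HasNuIntegral a F
        (∫ t : ℝ, SolitonCS.fourierInt F t * (SolitonCS.rho a t : ℂ))) := by
  refine ⟨fun n t => (SolitonCS.gaussDecay_phi a n t).memLp, fun z t => (SolitonCS.toL2_phiZ a z t).1,
    fun z t => (SolitonCS.toL2_phiZ a z t).2, fun t => SolitonCS.solitonSpace_eq ha t,
    fun t₀ => SolitonCS.isCoherentSystem_phiZ ha t₀, fun z => SolitonCS.contDiff_phiZ a z,
    fun z x t => ?_, ⟨SolitonCS.gramInv a, fun t => SolitonCS.isInverseMatrix_gram ha t,
      fun n k => SolitonCS.hasMuIntegral_moment ha n k⟩,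
    fun F hF hF' => SolitonCS.hasNuIntegral ha hF hF'⟩
  rw [(SolitonCS.hasDerivAt_phiZ_t a z t x).deriv, SolitonCS.iteratedDeriv_two_phiZ,
    SolitonCS.schrodinger_phiZ]
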